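/- **Theorem ($L^2$-error estimate of ESFR schemes).** *Problem.* Let $k\ge 1$, $a\in\mathbb R\setminus\{0\}$, $T>0$, let $x_{1/2}<x_{3/2}<\dots<x_{N+1/2}$ ($N\ge1$), $I_j=[x_{j-1/2},x_{j+1/2}]$, $\Delta_j=|I_j|$, $\Delta x=\max_j\Delta_j$, $\Omega=[x_{1/2},x_{N+1/2}]$. Let $u_0$ be $|\Omega|$-periodic and locally in $H^{k+2}$, and let $u$ be the classical $|\Omega|$-periodic solution of $\partial_tu+a\,\partial_xu=0$ on $[0,T]$ with $u(\cdot,0)=u_0$. *Scheme.* Let $L_i$ be the Legendre polynomials, $a_k=\frac{(2k)!}{2^k(k!)^2}$, $\eta_k=\frac{c(2k+1)(a_kk!)^2}{2}$ and $c>c_-(k)=\frac{-2}{(2k+1)(a_kk!)^2}$ (equivalently $1+\eta_k>0$), and put $$g_L=\tfrac{(-1)^k}{2}\Bigl[L_k-\tfrac{\eta_kL_{k-1}+L_{k+1}}{1+\eta_k}\Bigr],\qquad g_R=\tfrac12\Bigl[L_k+\tfrac{\eta_kL_{k-1}+L_{k+1}}{1+\eta_k}\Bigr].$$ Let $r_0,\dots,r_k$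 be distinct solution points with Lagrange basis $l_0,\dots,l_k$ of $\mathcal P^k$. The approximate solution $u^\delta$ is given on $I_j$ by $u^\delta(x,t)=\hat u_j(r,t)=\sum_m\hat u_{j,m}(t)\,l_m(r)$, $r=2\frac{x-x_{j-1/2}}{\Delta_j}-1$, where on $[0,T]$, for all $j$ and $i$, $$\frac{d}{dt}\hat u_{j,i}+\frac{2}{\Delta_j}\Bigl[a\,\partial_r\hat u_j(r_i)+\bigl(f^I_{j-1/2}-a\hat u_j(-1)\bigr)g_L'(r_i)+\bigl(f^I_{j+1/2}-a\hat u_j(1)\bigr)g_R'(r_i)\Bigr]=0,$$ with the upwind flux $f^I_{j+1/2}=a\frac{u^-+u^+}{2}-\frac{|a|}{2}(u^+-u^-)$, $u^-=\hat u_j(1)$, $u^+=\hat u_{j+1}(-1)$, and cells numbered cyclically modulo $N$. The initial value $u^\delta(0)$ is arbitrary. Let $e=u-u^\delta$. *Interpolation and norms.* $R_h(w)$ is the function, polynomial of degree $\le k$ on every $I_j$, that agrees with $w$ at the $k+1$ Gauss–Radau points of $I_j$ (the images of the zeros of $L_{k+1}-L_k$ if $a>0$, which contain $x_{j+1/2}$,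 and of $L_{k+1}+L_k$ if $a<0$, which contain $x_{j-1/2}$). For $v$ piecewise polynomial, $$\|v\|_{k,2}^2=\sum_j\int_{I_j}v^2+\tfrac c2(\partial_x^kv)^2\bigl(\tfrac{\Delta_j}{2}\bigr)^{2k}dx .$$ For an interval $I$, $|f|_{H^m(I)}=\|\partial_x^mf\|_{L^2(I)}$. *Constants* (depending on $k$ only; the two choices of Gauss–Radau points are mirror images of each other). - $\zeta_a=\zeta_k$ and $\zeta_b=\zeta_{k+1}$, where $\zeta_n$ is the best constant such that for every bounded interval $I$ and $f\in H^{n+1}(I)$ $$\inf_{p\in\mathcal P^n}\|f+p\|_{2,n+1,I}\le\zeta_n|I|^{n+1}\frac{|f|_{H^{n+1}(I)}}{|I|^{1/2}},\qquad \|g\|_{2,n+1,I}^2=\sum_{l=0}^{n+1}|I|^{2l}\,\frac{|g|_{H^l(I)}^2}{|I|}.$$ - $\Lambda_k=\max_{r\in[-1,1]}\sum_i|\ell_i(r)|$ is the Lebesgue constant of interpolation at the Gauss–Radau points of $[-1,1]$, $\ell_i$ being their Lagrange basis. - $C_m$ is the best constant with $\|p'\|^2_{L^2(-1,1)}\le C_m\|p\|^2_{L^2(-1,1)}$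 for all $p\in\mathcal P^m$. - $C_{k,m}$ ($m=0,k$) is the best constant with $|w-R_hw|_{H^m(I)}\le C_{k,m}|I|^{k+1-m}|w|_{H^{k+1}(I)}$ for every bounded interval $I$ and $w\in H^{k+1}(I)$. *Conclusion.* The constants $\zeta_a,\zeta_b$, $C_1,\dots,C_k$, $C_{k,0},C_{k,k}$ exist (they are finite and the inequalities hold with them). If $c\ge 0$, then $$\begin{aligned}\|u(T)-u^\delta(T)\|_{L^2(\Omega)}\le{}&\|R_h(e(0))\|_{k,2}+\Bigl(|a|T(2\zeta_a+4\zeta_b\sqrt{C_k})(1+\Lambda_k)|u_0|_{H^{k+2}(\Omega)}+C_{k,0}|u_0|_{H^{k+1}(\Omega)}\\&+|c|\,C_{k,k}\bigl(\tfrac12\bigr)^k\sqrt{C_1\cdots C_k}\,|u_0|_{H^{k+2}(\Omega)}|a|\tfrac T2\Bigr)(\Delta x)^{k+1}\\&+\Bigl(|c|\bigl(\tfrac12\bigr)^k\sqrt{C_1\cdots C_k}\,|u_0|_{H^{k+1}(\Omega)}|a|\tfrac T2\Bigr)(\Delta x)^k.\end{aligned}$$ If $c_-(k)<c<0$, the same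 estimate holds with $\|R_h(e(0))\|_{k,2}$ divided by $\sqrt{1+\eta_k}$ and the three terms that contain $T$ divided by $1+\eta_k$. -/

import Mathlib

open MeasureTheory Polynomial
open scoped Nat

noncomputable section

namespace ESFR

/-! ## One-dimensional Sobolev spaces -/

/-- Membership of (the continuous representative of) `f` in the Sobolev space `H^m(α, β)`.
For `m = n + 1` this says: `f` is `C^n` on `[α, β]`, its `n`-th derivative is absolutely continuous
on `[α, β]`, and the (almost everywhere defined) derivative of order `n + 1` is in `L²(α, β)`. -/
def MemSobolev : ℕ → (ℝ → ℝ) → ℝ → ℝ → Prop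
  | 0, f, α, β => MemLp f 2 (volume.restrict (Set.Icc α β))
  | n + 1, f, α, β =>
      ContDiffOn ℝ n f (Set.Icc α β) ∧
      AbsolutelyContinuousOnInterval (iteratedDerivWithin n f (Set.Icc α β)) α β ∧
      MemLp (iteratedDerivWithin (n + 1) f (Set.Icc α β)) 2 (volume.restrict (Set.Icc α β))

/-- The Sobolev seminorm `|f|_{H^m(α, β)} = ‖∂^m f‖_{L²(α, β)}`. -/
def seminormH (m : ℕ) (f : ℝ → ℝ) (α β : ℝ) : ℝ :=
  √(∫ x in α..β, (iteratedDerivWithin m f (Set.Icc α β) x) ^ 2)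

/-- The averaged seminorm `|f|_{2,l,I} = |I|^{-1/2} ‖∂^l f‖_{L²(I)}` on `I = [α, β]`. -/
def avgSeminorm (l : ℕ) (f : ℝ → ℝ) (α β : ℝ) : ℝ :=
  seminormH l f α β / √(β - α)

/-- The length-dependent Sobolev norm
`‖f‖_{2,m,I} = (∑_{l ≤ m} |I|^{2l} |f|_{2,l,I}^2)^{1/2}` on `I = [α, β]`. -/
def modNorm (m : ℕ) (f : ℝ → ℝ) (α β : ℝ) : ℝ :=
  √(∑ l ∈ Finset.range (m + 1), (β - α) ^ (2 * l) * (avgSeminorm l f α β) ^ 2)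

/-- The norm of the class of `f` in the quotient `H^{k+1}(α, β) / P^k`. -/
def quotientNorm (k : ℕ) (f : ℝ → ℝ) (α β : ℝ) : ℝ :=
  ⨅ p : Polynomial.degreeLT ℝ (k + 1), modNorm (k + 1) (fun x => f x + (p : ℝ[X]).eval x) α β

/-- `ζ` is admissible in the Bramble-Hilbert norm equivalence on `H^{k+1} / P^k`,
on all bounded intervals at once. -/
def IsBrambleHilbertConst (k : ℕ) (ζ : ℝ) : Prop :=
  0 ≤ ζ ∧ ∀ α β : ℝ, α < β → ∀ f : ℝ → ℝ, MemSobolev (k + 1) f α β →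
    quotientNorm k f α β ≤ ζ * (β - α) ^ (k + 1) * avgSeminorm (k + 1) f α β

/-- The Bramble-Hilbert constant of `H^{k+1} / P^k`: the best admissible constant. -/
def brambleHilbertConst (k : ℕ) : ℝ := sInf {ζ : ℝ | IsBrambleHilbertConst k ζ}

/-- `C` is admissible in the Markov inequality `‖p'‖² ≤ C ‖p‖²` in `L²(-1, 1)` for polynomials of
degree at most `m`. -/
def IsMarkovConst (m : ℕ) (C : ℝ) : Prop :=
  0 ≤ C ∧ ∀ p : ℝ[X], p.natDegree ≤ m →
    ∫ r in (-1 : ℝ)..1, (p.derivative.eval r) ^ 2 ≤ C * ∫ r in (-1 : ℝ)..1, (p.eval r) ^ 2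

/-- The Markov constant `C_m`: the best constant in `‖p'‖² ≤ C ‖p‖²`, in other words the largest
eigenvalue of the stiffness matrix of the orthonormal Legendre basis of `P^m`. -/
def markovConst (m : ℕ) : ℝ := sInf {C : ℝ | IsMarkovConst m C}

/-! ## Legendre polynomials, Gauss-Radau points and interpolation -/

/-- The Legendre polynomial `L_n` (Rodrigues' formula). -/
def legendre (n : ℕ) : ℝ[X] :=
  C (1 / (2 ^ n * (n ! : ℝ))) * derivative^[n] ((X ^ 2 - 1) ^ n)

/-- The Radau polynomial `L_{k+1} - s L_k`, where `s` is the sign of the advection velocity: it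
vanishes at the right end `1` if `s = 1` and at the left end `-1` if `s = -1`. -/
def radauPoly (k : ℕ) (s : SignType) : ℝ[X] :=
  legendre (k + 1) - C ((s : SignType) : ℝ) * legendre k

/-- The `k + 1` Gauss-Radau points of `[-1, 1]` that contain the endpoint `s = ±1`. -/
def radauNodes (k : ℕ) (s : SignType) : Finset ℝ := (radauPoly k s).roots.toFinset

/-- The affine map from `[α, β]` to the reference element `[-1, 1]`. -/
def toRef (α β x : ℝ) : ℝ := 2 * ((x - α) / (β - α)) - 1

/-- The affine map from the reference element `[-1, 1]` to `[α, β]`. -/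
def fromRef (α β r : ℝ) : ℝ := (1 - r) / 2 * α + (1 + r) / 2 * β

/-- The Gauss-Radau interpolant `R_h(w)` on the cell `[α, β]`: the polynomial of degree at most `k`
that agrees with `w` at the Gauss-Radau points of `[α, β]`. -/
def Rh (k : ℕ) (s : SignType) (α β : ℝ) (w : ℝ → ℝ) (x : ℝ) : ℝ :=
  (Lagrange.interpolate (radauNodes k s) id (fun r => w (fromRef α β r))).eval (toRef α β x)

/-- The Lebesgue constant of Gauss-Radau interpolation: the maximum over `[-1, 1]` of the sum of the
absolute values of the Lagrange basis polynomials, i.e. the norm of the interpolation operator on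
continuous functions with the maximum norm. -/
def lebesgueConst (k : ℕ) (s : SignType) : ℝ :=
  ⨆ r : Set.Icc (-1 : ℝ) 1, ∑ i ∈ radauNodes k s,
    |(Lagrange.basis (radauNodes k s) id i).eval (r : ℝ)|

/-- `C` is admissible in the interpolation estimate
`|w - R_h w|_{H^m(I)} ≤ C |I|^{k+1-m} |w|_{H^{k+1}(I)}`, on all bounded intervals `I` at once. -/
def IsInterpConst (k m : ℕ) (s : SignType) (C : ℝ) : Prop :=
  0 ≤ C ∧ ∀ α β : ℝ, α < β → ∀ w : ℝ → ℝ, MemSobolev (k + 1) w α β →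
    seminormH m (fun x => w x - Rh k s α β w x) α β ≤
      C * (β - α) ^ (k + 1 - m) * seminormH (k + 1) w α β

/-- The interpolation constant `C_{k,m}`: the best admissible constant. -/
def interpConst (k m : ℕ) (s : SignType) : ℝ := sInf {C : ℝ | IsInterpConst k m s C}

/-! ## The energy-stable flux reconstruction scheme -/

/-- `a_k = (2k)! / (2^k (k!)^2)`, the leading coefficient of `L_k`. -/
def aCoeff (k : ℕ) : ℝ := ((2 * k).factorial : ℝ) / (2 ^ k * (k ! : ℝ) ^ 2)

/-- `η_k = c (2k+1) (a_k k!)^2 / 2`. -/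
def eta (k : ℕ) (c : ℝ) : ℝ := c * (2 * k + 1) * (aCoeff k * (k ! : ℝ)) ^ 2 / 2

/-- The lower end `c_-(k)` of the range of the ESFR parameter. -/
def cMinus (k : ℕ) : ℝ := -2 / ((2 * k + 1) * (aCoeff k * (k ! : ℝ)) ^ 2)

/-- The left correction function `g_L`. -/
def gL (k : ℕ) (c : ℝ) : ℝ[X] :=
  C ((-1 : ℝ) ^ k / 2) *
    (legendre k - C (1 / (1 + eta k c)) * (C (eta k c) * legendre (k - 1) + legendre (k + 1)))

/-- The right correction function `g_R`. -/
def gR (k : ℕ) (c : ℝ) : ℝ[X] :=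
  C (1 / 2 : ℝ) *
    (legendre k + C (1 / (1 + eta k c)) * (C (eta k c) * legendre (k - 1) + legendre (k + 1)))

/-- The upwind numerical flux `f^I(u⁻, u⁺)` for the flux `f(u) = a u`. -/
def upwindFlux (a um up : ℝ) : ℝ := a * ((um + up) / 2) - |a| / 2 * (up - um)

section Mesh

variable {N : ℕ}

/-- The left end of the cell `j` of the mesh with vertices `x 0 < x 1 < ⋯ < x N`. -/
def left (x : Fin (N + 1) → ℝ) (j : Fin N) : ℝ := x j.castSucc

/-- The right end of the cell `j`. -/
def right (x : Fin (N + 1) → ℝ) (j : Fin N) : ℝ := x j.succ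

/-- The length `Δ_j` of the cell `j`. -/
def width (x : Fin (N + 1) → ℝ) (j : Fin N) : ℝ := right x j - left x j

/-- The mesh size `Δx = max_j Δ_j`. -/
def meshSize (x : Fin (N + 1) → ℝ) : ℝ := ⨆ j : Fin N, width x j

/-- The broken Sobolev norm `‖v‖_{k,2}` of a family of functions, one on each cell. -/
def brokenNorm (k : ℕ) (c : ℝ) (x : Fin (N + 1) → ℝ) (v : Fin N → ℝ → ℝ) : ℝ :=
  √(∑ j, ∫ y in (left x j)..(right x j),
    ((v j y) ^ 2 + c / 2 * (iteratedDeriv k (v j) y) ^ 2 * (width x j / 2) ^ (2 * k)))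

/-- The `L²(Ω)` norm of a family of functions, one on each cell. -/
def normL2 (x : Fin (N + 1) → ℝ) (v : Fin N → ℝ → ℝ) : ℝ :=
  √(∑ j, ∫ y in (left x j)..(right x j), (v j y) ^ 2)

/-- The polynomial of degree at most `k` on the reference element with nodal values `V`
at the points `r`. -/
def nodalPoly {k : ℕ} (r V : Fin (k + 1) → ℝ) : ℝ[X] :=
  ∑ i, C (V i) * Lagrange.basis Finset.univ r i

/-- The approximate solution on the cell `j`, as a function of the physical variable `y`, for nodal
values `V j` on the cell `j`. -/
def cellFun {k : ℕ} (r : Fin (k + 1) → ℝ) (x : Fin (N + 1) → ℝ) (V : Fin N → Fin (k + 1) → ℝ)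
    (j : Fin N) (y : ℝ) : ℝ :=
  (nodalPoly r (V j)).eval (toRef (left x j) (right x j) y)

/-- The derivative at the node `r i` of the reconstructed flux on the cell `j` (discontinuous flux
plus correction flux), for nodal values `V`. Cells are numbered cyclically (`j - 1` and `j + 1` in `Fin N`), which is the periodic
boundary condition. All fluxes are those of the reference element (physical fluxes times
`2 / Δ_j`). -/
def fluxDerivative [NeZero N] {k : ℕ} (a c : ℝ) (r : Fin (k + 1) → ℝ) (x : Fin (N + 1) → ℝ)
    (V : Fin N → Fin (k + 1) → ℝ) (j : Fin N) (i : Fin (k + 1)) : ℝ :=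
  let fD : Fin (k + 1) → ℝ := fun m => 2 / width x j * (a * V j m)
  let fDL : ℝ := (nodalPoly r fD).eval (-1)
  let fDR : ℝ := (nodalPoly r fD).eval 1
  let fIL : ℝ := 2 / width x j *
    upwindFlux a ((nodalPoly r (V (j - 1))).eval 1) ((nodalPoly r (V j)).eval (-1))
  let fIR : ℝ := 2 / width x j *
    upwindFlux a ((nodalPoly r (V j)).eval 1) ((nodalPoly r (V (j + 1))).eval (-1));
  (∑ m, fD m * (Lagrange.basis Finset.univ r m).derivative.eval (r i))
    + (fIL - fDL) * (gL k c).derivative.eval (r i)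
    + (fIR - fDR) * (gR k c).derivative.eval (r i)

/-- `U t j i` (time, cell, node) are the nodal values of a solution on `[0, T]` of the semi-discrete
ESFR scheme of degree `k` and parameter `c` for `∂_t u + a ∂_x u = 0` with upwind flux, periodic
boundary conditions and solution points `r`. -/
def IsESFRSolution [NeZero N] {k : ℕ} (a c T : ℝ) (r : Fin (k + 1) → ℝ) (x : Fin (N + 1) → ℝ)
    (U : ℝ → Fin N → Fin (k + 1) → ℝ) : Prop :=
  ∀ t ∈ Set.Icc 0 T, ∀ j i,
    HasDerivWithinAt (fun s => U s j i) (-fluxDerivative a c r x (U t) j i) (Set.Icc 0 T) t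

end Mesh

/-- `u y t` is a classical solution of `∂_t u + a ∂_x u = 0` on `[0, T]`, periodic in space with
period `L`, with initial value `u₀`. -/
structure IsAdvectionSolution (a L T : ℝ) (u₀ : ℝ → ℝ) (u : ℝ → ℝ → ℝ) : Prop where
  periodic : ∀ t ∈ Set.Icc 0 T, Function.Periodic (fun y => u y t) L
  initial : ∀ y, u y 0 = u₀ y
  continuousOn : ContinuousOn (fun z : ℝ × ℝ => u z.1 z.2) (Set.univ ×ˢ Set.Icc 0 T)
  differentiable : ∀ y, ∀ t ∈ Set.Ioo 0 T, DifferentiableAt ℝ (fun z : ℝ × ℝ => u z.1 z.2) (y, t)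
  equation : ∀ y, ∀ t ∈ Set.Ioo 0 T,
    deriv (fun τ => u y τ) t + a * deriv (fun z => u z t) y = 0

end ESFR

end

/-!
The estimate is an energy argument. The derivatives of the correction functions `g_L`, `g_R` are the
Riesz representatives of the two endpoint evaluations on `P^k` for the modified inner product
`∫ (p q + (c / 2) p^(k) q^(k))` of the reference element (`modForm_derivative_gL`,
`modForm_derivative_gR`). Tested in this inner product, the flux reconstruction scheme is therefore
the upwind discontinuous Galerkin scheme (`width_mul_modForm_fluxDerivative`), whose form is
dissipative (`sum_upwindForm_self_nonneg`).

Split the error into the interpolation error `u - R_h u`, which is bounded by the constant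
`C_{k,0}`, and the discrete error `e = R_h u - u^δ`, a piecewise polynomial. The Gauss-Radau points
contain the end of the cell from which the upwind flux takes its value, so that all the fluxes of
`R_h u` are exact, and the half rate of growth of the energy `‖e‖²_{k,2}` consists of three terms
besides the dissipation (`energy_rate_cell_le`). With `ε = u - R_h u` they are
* `a ∫ (∂_x u - R_h ∂_x u) e`, bounded through the Bramble-Hilbert constant of `H^{k+1} / P^k`, the
  embedding `H^1 ⊂ C` and the Lebesgue constant (`abs_half_width_mul_integral_le`);
* `a ∫ ε ∂_x e`. The error of interpolating a polynomial of degree `k + 1` is a multiple of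
  `L_{k+1} ∓ L_k`, hence orthogonal to `P^{k-1}`, so that this term vanishes for `u` in `P^{k+1}`.
  The Bramble-Hilbert constant of `H^{k+2} / P^{k+1}` gains the order that Markov's inequality
  for `∂_x e` loses (`abs_integral_mul_derivative_le`);
* `a (c / 2) ∫ ∂^k (R_h ∂_x u) ∂^k e` with its weight, bounded by the constant `C_{k,k}` and
  Markov's inequality in the degrees `1, …, k` (`abs_half_width_mul_refIntegral_iterate_le`).

The solution is `u(y, t) = u₀(y - a t)`, so that by periodicity its seminorms over `Ω` do not depend
on time, and the bound on the rate is integrated over `[0, T]` (`sqrt_le_of_deriv_le`). The modified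
norm dominates the `L²` norm up to the factor `1` if `c ≥ 0` and `1 + η_k` if `c < 0`.

The constants exist because the remainder of the Taylor polynomial at the left end of a cell is
controlled by the highest seminorm (`MemSobolev.abs_iteratedDerivWithin_le`), and, for Markov's
inequality, by induction on the degree with Legendre polynomials; the best constants are admissible
because the sets of admissible constants are closed. That the Radau polynomial has `k + 1` distinct
zeros in `[-1, 1]` follows from Rolle's theorem and the Rodrigues formula `radauPoly_eq`.
-/

namespace ESFR

/-! ### Integration of polynomials on the reference element -/

/-- The integral over the reference element `[-1, 1]`, as a linear functional on polynomials. -/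
noncomputable def refIntegral : ℝ[X] →ₗ[ℝ] ℝ where
  toFun p := ∫ r in (-1 : ℝ)..1, p.eval r
  map_add' p q := by
    simp only [eval_add]
    exact intervalIntegral.integral_add (p.continuous.intervalIntegrable _ _)
      (q.continuous.intervalIntegrable _ _)
  map_smul' b p := by simp [eval_smul]

lemma refIntegral_apply (p : ℝ[X]) : refIntegral p = ∫ r in (-1 : ℝ)..1, p.eval r := rfl

lemma refIntegral_C (b : ℝ) : refIntegral (C b) = 2 * b := by
  simp only [refIntegral_apply, eval_C, intervalIntegral.integral_const, smul_eq_mul]; norm_num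

lemma refIntegral_C_mul (b : ℝ) (p : ℝ[X]) : refIntegral (C b * p) = b * refIntegral p := by
  rw [← smul_eq_C_mul, map_smul, smul_eq_mul]

lemma refIntegral_derivative (p : ℝ[X]) :
    refIntegral (derivative p) = p.eval 1 - p.eval (-1) :=
  intervalIntegral.integral_eq_sub_of_hasDerivAt (fun r _ => p.hasDerivAt r)
    ((derivative p).continuous.intervalIntegrable _ _)

lemma refIntegral_derivative_mul (p q : ℝ[X]) :
    refIntegral (derivative p * q) =
      p.eval 1 * q.eval 1 - p.eval (-1) * q.eval (-1) - refIntegral (p * derivative q) := by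
  have := refIntegral_derivative (p * q)
  rw [derivative_mul, map_add, eval_mul, eval_mul] at this
  linarith

lemma refIntegral_mul_self_nonneg (p : ℝ[X]) : 0 ≤ refIntegral (p * p) := by
  rw [refIntegral_apply]
  exact intervalIntegral.integral_nonneg (by norm_num)
    fun r _ => by rw [eval_mul]; exact mul_self_nonneg _

lemma refIntegral_mul_sq_le (p q : ℝ[X]) :
    refIntegral (p * q) ^ 2 ≤ refIntegral (p * p) * refIntegral (q * q) := by
  have h : ∀ t : ℝ, 0 ≤ refIntegral (q * q) * (t * t) + 2 * refIntegral (p * q) * t +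
      refIntegral (p * p) := fun t => by
    have := refIntegral_mul_self_nonneg (p + C t * q)
    have e : (p + C t * q) * (p + C t * q) =
        p * p + C (2 * t) * (p * q) + C (t * t) * (q * q) := by
      simp only [C_mul]; rw [show (C (2 : ℝ) : ℝ[X]) = 2 from rfl]; ring
    rw [e, map_add, map_add, refIntegral_C_mul, refIntegral_C_mul] at this
    linarith
  have := discrim_le_zero h
  rw [discrim] at this
  nlinarith

/-- Integration by parts `m` times: a polynomial that vanishes to order `m` at both ends of the
reference element has an `m`-th derivative orthogonal to the polynomials of degree below `m`. -/
lemma refIntegral_iterate_derivative_mul {m : ℕ} : ∀ {q ψ : ℝ[X]}, (X ^ 2 - 1) ^ m ∣ q →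
    derivative^[m] ψ = 0 → refIntegral (derivative^[m] q * ψ) = 0 := by
  induction m with
  | zero => intro q ψ _ hψ; simp_all
  | succ m ih =>
    intro q ψ hq hψ
    have hb : (X ^ 2 - 1 : ℝ[X]) ∣ derivative^[m] q := by
      simpa using pow_sub_dvd_iterate_derivative_of_pow_dvd m hq
    obtain ⟨g, hg⟩ := hb
    rw [Function.iterate_succ_apply', refIntegral_derivative_mul,
      ih ((pow_dvd_pow _ m.le_succ).trans hq) (by rwa [Function.iterate_succ_apply] at hψ), hg]
    simp

/-- The `m`-th derivative of a polynomial of degree at most `m` is constant. -/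
lemma iterate_derivative_eq_C {m : ℕ} {p : ℝ[X]} (hp : p.natDegree ≤ m) :
    derivative^[m] p = C (p.coeff m * (m ! : ℝ)) := by
  have h0 : (derivative^[m] p).natDegree = 0 := by
    have := natDegree_iterate_derivative p m; omega
  rw [eq_C_of_natDegree_eq_zero h0, coeff_iterate_derivative]
  simp [Nat.descFactorial_self, mul_comm]

/-! ### Legendre polynomials -/

lemma natDegree_X_sq_sub_one_pow (n : ℕ) : ((X ^ 2 - 1 : ℝ[X]) ^ n).natDegree = 2 * n := by
  rw [natDegree_pow, show (X ^ 2 - 1 : ℝ[X]) = X ^ 2 - C 1 by simp, natDegree_X_pow_sub_C]; ring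

lemma natDegree_legendre_le (n : ℕ) : (legendre n).natDegree ≤ n := by
  refine (natDegree_C_mul_le _ _).trans ((natDegree_iterate_derivative _ _).trans ?_)
  rw [natDegree_X_sq_sub_one_pow]; omega

lemma refIntegral_legendre_mul {n : ℕ} {ψ : ℝ[X]} (hψ : derivative^[n] ψ = 0) :
    refIntegral (legendre n * ψ) = 0 := by
  rw [legendre, mul_assoc, refIntegral_C_mul,
    refIntegral_iterate_derivative_mul dvd_rfl hψ, mul_zero]

/-- `∂^n L_n = a_n n!`, in the form `(2n)! / (2^n n!)`. -/
lemma iterate_derivative_legendre (n : ℕ) :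
    derivative^[n] (legendre n) = C (aCoeff n * (n ! : ℝ)) := by
  have hm : ((X ^ 2 - 1 : ℝ[X]) ^ n).Monic := by
    rw [show (X ^ 2 - 1 : ℝ[X]) = X ^ 2 - C 1 by simp]
    exact (monic_X_pow_sub_C 1 two_ne_zero).pow n
  have hc : ((X ^ 2 - 1 : ℝ[X]) ^ n).coeff (2 * n) = 1 := by
    rw [← natDegree_X_sq_sub_one_pow n]; exact hm.coeff_natDegree
  rw [legendre, iterate_derivative_C_mul, ← Function.iterate_add_apply, ← two_mul,
    iterate_derivative_eq_C (natDegree_X_sq_sub_one_pow n).le, hc, ← C_mul, aCoeff]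
  congr 1
  have : (n ! : ℝ) ≠ 0 := by positivity
  field_simp

lemma eval_one_legendre (n : ℕ) : (legendre n).eval 1 = 1 := by
  have h := aeval_iterate_derivative_self (A := ℝ) ((X ^ 2 - 1 : ℝ[X]) ^ n) n 1
    (p' := (X + 1) ^ n) (by
      rw [← mul_pow]; simp only [Algebra.algebraMap_self, map_id, map_one]; congr 1; ring)
  rw [coe_aeval_eq_eval] at h
  rw [legendre, eval_mul, eval_C, h]
  have : (n ! : ℝ) ≠ 0 := by positivity
  simp; norm_num; field_simp

lemma eval_neg_one_legendre (n : ℕ) : (legendre n).eval (-1) = (-1) ^ n := by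
  have h := aeval_iterate_derivative_self (A := ℝ) ((X ^ 2 - 1 : ℝ[X]) ^ n) n (-1)
    (p' := (X - 1) ^ n) (by
      rw [← mul_pow]; simp only [Algebra.algebraMap_self, map_id, map_one, C_neg]; congr 1; ring)
  rw [coe_aeval_eq_eval] at h
  rw [legendre, eval_mul, eval_C, h]
  have : (n ! : ℝ) ≠ 0 := by positivity
  simp only [eval_pow, eval_sub, eval_X, eval_one, nsmul_eq_mul]
  rw [show (-1 - 1 : ℝ) = (-1) * 2 by norm_num, mul_pow]
  field_simp

lemma refIntegral_legendre_mul_self (n : ℕ) :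
    refIntegral (legendre n * legendre n) = 2 / (2 * n + 1) := by
  -- Integrate `(X L_n^2)' = L_n^2 + 2 L_n (X L_n')`, where `X L_n' - n L_n` has degree below `n`.
  have h1 := refIntegral_derivative (X * (legendre n * legendre n))
  have h2 : derivative (X * (legendre n * legendre n)) = legendre n * legendre n +
      C 2 * (legendre n * (derivative (legendre n) * X - C (n : ℝ) * legendre n)) +
      C (2 * n : ℝ) * (legendre n * legendre n) := by
    simp only [derivative_mul, derivative_X, C_mul]
    rw [show (C (2 : ℝ) : ℝ[X]) = 2 from rfl]; ring
  have h3 : refIntegral (legendre n *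
      (derivative (legendre n) * X - C (n : ℝ) * legendre n)) = 0 := by
    apply refIntegral_legendre_mul
    have : derivative^[n + 1] (legendre n) = 0 :=
      iterate_derivative_eq_zero (Nat.lt_succ_of_le (natDegree_legendre_le n))
    rw [iterate_derivative_sub, iterate_derivative_derivative_mul_X, this,
      iterate_derivative_C_mul]
    simp
  rw [h2, map_add, map_add, refIntegral_C_mul, refIntegral_C_mul, h3] at h1
  simp only [eval_mul, eval_X, eval_one_legendre, eval_neg_one_legendre] at h1
  rw [← mul_pow] at h1
  norm_num at h1
  rw [eq_div_iff (by positivity)]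
  linarith

lemma aCoeff_mul_factorial_pos (n : ℕ) : 0 < aCoeff n * (n ! : ℝ) := by
  unfold aCoeff; positivity

lemma aCoeff_mul_factorial_succ (n : ℕ) :
    aCoeff (n + 1) * ((n + 1)! : ℝ) = (2 * n + 1) * (aCoeff n * (n ! : ℝ)) := by
  unfold aCoeff
  rw [show 2 * (n + 1) = 2 * n + 1 + 1 by ring, Nat.factorial_succ (2 * n + 1),
    Nat.factorial_succ (2 * n), Nat.factorial_succ n]
  have : (n ! : ℝ) ≠ 0 := by positivity
  have : (n + 1 : ℝ) ≠ 0 := by positivity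
  push_cast
  field_simp
  ring

/-- Testing a polynomial of degree at most `n` with `L_n` recovers its `n`-th derivative. -/
lemma refIntegral_legendre_mul_eq {n : ℕ} {w : ℝ[X]} {v : ℝ} (hw : derivative^[n] w = C v) :
    refIntegral (legendre n * w) = v / (aCoeff n * (n ! : ℝ)) * (2 / (2 * n + 1)) := by
  have hA := aCoeff_mul_factorial_pos n
  have h := refIntegral_legendre_mul (n := n)
    (ψ := w - C (v / (aCoeff n * (n ! : ℝ))) * legendre n) (by
      rw [iterate_derivative_sub, hw, iterate_derivative_C_mul, iterate_derivative_legendre,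
        ← C_mul, div_mul_cancel₀ _ hA.ne', sub_self])
  rw [mul_sub, map_sub, mul_left_comm, refIntegral_C_mul, refIntegral_legendre_mul_self] at h
  linarith

/-! ### The modified inner product and the correction functions -/

/-- The inner product `∫ (p q + (c / 2) p^(k) q^(k))` on the reference element in which the
flux reconstruction scheme becomes a discontinuous Galerkin scheme. -/
noncomputable def modForm (k : ℕ) (c : ℝ) : ℝ[X] →ₗ[ℝ] ℝ[X] →ₗ[ℝ] ℝ :=
  LinearMap.mk₂ ℝ
    (fun p q => refIntegral (p * q) +
      c / 2 * refIntegral (derivative^[k] p * derivative^[k] q))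
    (fun p p' q => by simp only [iterate_map_add, add_mul, map_add]; ring)
    (fun b p q => by
      simp only [iterate_derivative_smul, smul_mul_assoc, map_smul, smul_eq_mul]; ring)
    (fun p q q' => by simp only [iterate_map_add, mul_add, map_add]; ring)
    (fun b p q => by
      simp only [iterate_derivative_smul, mul_smul_comm, map_smul, smul_eq_mul]; ring)

lemma modForm_apply (k : ℕ) (c : ℝ) (p q : ℝ[X]) :
    modForm k c p q = refIntegral (p * q) +
      c / 2 * refIntegral (derivative^[k] p * derivative^[k] q) := rfl

lemma modForm_symm (k : ℕ) (c : ℝ) (p q : ℝ[X]) : modForm k c p q = modForm k c q p := by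
  rw [modForm_apply, modForm_apply, mul_comm p, mul_comm (derivative^[k] p)]

lemma modForm_derivative_of_natDegree_le {k : ℕ} (c : ℝ) {p : ℝ[X]} (hp : p.natDegree ≤ k)
    (q : ℝ[X]) : modForm k c (derivative p) q = refIntegral (derivative p * q) := by
  rw [modForm_apply, ← Function.iterate_succ_apply,
    iterate_derivative_eq_zero (Nat.lt_succ_of_le hp)]
  simp

lemma modForm_derivative_legendre {k : ℕ} (c : ℝ) {w : ℝ[X]} (hw : w.natDegree ≤ k) :
    modForm k c (derivative (legendre k)) w = w.eval 1 - (-1) ^ k * w.eval (-1) := by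
  rw [modForm_derivative_of_natDegree_le c (natDegree_legendre_le k), refIntegral_derivative_mul,
    refIntegral_legendre_mul, eval_one_legendre, eval_neg_one_legendre]
  · ring
  · rw [← Function.iterate_succ_apply]
    exact iterate_derivative_eq_zero (Nat.lt_succ_of_le hw)

lemma modForm_derivative_legendre_core {k : ℕ} (hk : 1 ≤ k) (c : ℝ) {w : ℝ[X]}
    (hw : w.natDegree ≤ k) :
    modForm k c (derivative (C (eta k c) * legendre (k - 1) + legendre (k + 1))) w =
      (1 + eta k c) * (w.eval 1 - (-1) ^ (k + 1) * w.eval (-1)) := by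
  obtain ⟨n, rfl⟩ : ∃ n, k = n + 1 := ⟨k - 1, by omega⟩
  rw [Nat.add_sub_cancel]
  obtain ⟨v, hv⟩ : ∃ v, derivative^[n + 1] w = C v := ⟨_, iterate_derivative_eq_C hw⟩
  have hv' : derivative^[n] (derivative w) = C v := by rwa [← Function.iterate_succ_apply]
  have h1 := refIntegral_legendre_mul_eq hv'
  have h2 : refIntegral (legendre (n + 1 + 1) * derivative w) = 0 := by
    apply refIntegral_legendre_mul
    rw [← Function.iterate_succ_apply]
    exact iterate_derivative_eq_zero (by omega)
  have h3 : derivative^[n + 1 + 1] (legendre n) = 0 :=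
    iterate_derivative_eq_zero (by have := natDegree_legendre_le n; omega)
  rw [modForm_apply, refIntegral_derivative_mul, ← Function.iterate_succ_apply,
    iterate_map_add, iterate_derivative_C_mul, h3, iterate_derivative_legendre, hv,
    mul_zero, zero_add, ← C_mul, refIntegral_C, add_mul, map_add, h2, mul_assoc,
    refIntegral_C_mul, h1]
  simp only [eval_add, eval_mul, eval_C, eval_one_legendre, eval_neg_one_legendre]
  have hA := aCoeff_mul_factorial_pos n
  have e1 := aCoeff_mul_factorial_succ n
  have e2 := aCoeff_mul_factorial_succ (n + 1)
  rw [e1] at e2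
  rw [e2]
  simp only [eta]
  rw [e1]
  set A := aCoeff n * (n ! : ℝ)
  have : (2 * n + 1 : ℝ) ≠ 0 := by positivity
  push_cast
  field_simp
  ring

lemma one_add_eta_pos {k : ℕ} {c : ℝ} (hc : cMinus k < c) : 0 < 1 + eta k c := by
  have hA := aCoeff_mul_factorial_pos k
  have hd : 0 < (2 * k + 1) * (aCoeff k * (k ! : ℝ)) ^ 2 := by positivity
  rw [cMinus, div_lt_iff₀ hd] at hc
  rw [eta]; linarith

/-- The derivative of the right correction function represents evaluation at `1` on `P^k`. -/
lemma modForm_derivative_gR {k : ℕ} (hk : 1 ≤ k) {c : ℝ} (hc : cMinus k < c) {w : ℝ[X]}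
    (hw : w.natDegree ≤ k) : modForm k c (derivative (gR k c)) w = w.eval 1 := by
  have hη := (one_add_eta_pos hc).ne'
  rw [gR, ← smul_eq_C_mul, derivative_smul, map_smul, LinearMap.smul_apply, map_add, map_add,
    LinearMap.add_apply, ← smul_eq_C_mul (1 / (1 + eta k c)), derivative_smul, map_smul,
    LinearMap.smul_apply, modForm_derivative_legendre c hw,
    modForm_derivative_legendre_core hk c hw]
  simp only [smul_eq_mul]
  field_simp
  ring

/-- The derivative of the left correction function represents minus the evaluation at `-1`. -/
lemma modForm_derivative_gL {k : ℕ} (hk : 1 ≤ k) {c : ℝ} (hc : cMinus k < c) {w : ℝ[X]}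
    (hw : w.natDegree ≤ k) : modForm k c (derivative (gL k c)) w = -w.eval (-1) := by
  have hη := (one_add_eta_pos hc).ne'
  rw [gL, ← smul_eq_C_mul, derivative_smul, map_smul, LinearMap.smul_apply, map_sub, map_sub,
    LinearMap.sub_apply, ← smul_eq_C_mul (1 / (1 + eta k c)), derivative_smul, map_smul,
    LinearMap.smul_apply, modForm_derivative_legendre c hw,
    modForm_derivative_legendre_core hk c hw]
  simp only [smul_eq_mul]
  field_simp
  have : ((-1 : ℝ) ^ k) * (-1) ^ k = 1 := by rw [← mul_pow]; simp
  rw [pow_succ]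
  linear_combination (-2 * w.eval (-1)) * this

lemma natDegree_gR_le (k : ℕ) (c : ℝ) : (gR k c).natDegree ≤ k + 1 := by
  have h := natDegree_legendre_le
  refine (natDegree_C_mul_le _ _).trans (natDegree_add_le_of_degree_le ((h k).trans (by omega)) ?_)
  refine (natDegree_C_mul_le _ _).trans (natDegree_add_le_of_degree_le ?_ (h _))
  exact (natDegree_C_mul_le _ _).trans ((h _).trans (by omega))

lemma natDegree_gL_le (k : ℕ) (c : ℝ) : (gL k c).natDegree ≤ k + 1 := by
  have h := natDegree_legendre_le
  refine (natDegree_C_mul_le _ _).trans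
    ((natDegree_sub_le_iff_left ((natDegree_C_mul_le _ _).trans ?_)).2 ((h k).trans (by omega)))
  exact natDegree_add_le_of_degree_le
    ((natDegree_C_mul_le _ _).trans ((h _).trans (by omega))) (h _)

/-- For `c < 0` the modified form dominates the `L²` form up to the factor `1 + η`. -/
lemma one_add_eta_mul_le_modForm {k : ℕ} {c : ℝ} (hc : c ≤ 0) {w : ℝ[X]}
    (hw : w.natDegree ≤ k) : (1 + eta k c) * refIntegral (w * w) ≤ modForm k c w w := by
  obtain ⟨v, hv⟩ : ∃ v, derivative^[k] w = C v := ⟨_, iterate_derivative_eq_C hw⟩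
  have h1 := refIntegral_mul_sq_le (legendre k) w
  rw [refIntegral_legendre_mul_eq hv, refIntegral_legendre_mul_self] at h1
  rw [modForm_apply, hv, ← C_mul, refIntegral_C, eta]
  have hA := aCoeff_mul_factorial_pos k
  set A := aCoeff k * (k ! : ℝ)
  have h2 : v * v ≤ (2 * k + 1) * A ^ 2 / 2 * refIntegral (w * w) := by
    have hk : (0 : ℝ) < 2 * k + 1 := by positivity
    rw [mul_pow, div_pow, div_pow] at h1
    have := mul_le_mul_of_nonneg_left h1 (by positivity : 0 ≤ A ^ 2 * ((2 * k + 1) / 2) ^ 2)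
    calc v * v = A ^ 2 * ((2 * k + 1) / 2) ^ 2 * (v ^ 2 / A ^ 2 * (2 ^ 2 / (2 * k + 1) ^ 2)) := by
          field_simp
      _ ≤ _ := this
      _ = _ := by field_simp
  nlinarith [mul_le_mul_of_nonpos_left h2 hc]

lemma refIntegral_le_modForm {k : ℕ} {c : ℝ} (hc : 0 ≤ c) (w : ℝ[X]) :
    refIntegral (w * w) ≤ modForm k c w w := by
  rw [modForm_apply]
  have := refIntegral_mul_self_nonneg (derivative^[k] w)
  have : 0 ≤ c / 2 * refIntegral (derivative^[k] w * derivative^[k] w) := by positivity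
  linarith

/-! ### Gauss-Radau points -/

/-- A Rodrigues formula: `L_{k+1} - σ L_k` is a multiple of `∂^k ((X - σ) (X^2 - 1)^k)`. -/
lemma radauPoly_eq (k : ℕ) (s : SignType) :
    radauPoly k s = C (1 / (2 ^ k * (k ! : ℝ))) *
      derivative^[k] ((X - C (s : ℝ)) * (X ^ 2 - 1) ^ k) := by
  have h1 : derivative ((X ^ 2 - 1 : ℝ[X]) ^ (k + 1)) =
      C (2 * (k + 1) : ℝ) * (X * (X ^ 2 - 1) ^ k) := by
    rw [derivative_pow_succ]
    simp only [derivative_sub, derivative_X_pow, derivative_one, C_mul, C_add, C_1]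
    simp
    rw [show (C (2 : ℝ) : ℝ[X]) = 2 from rfl]; ring
  have hf : (k ! : ℝ) ≠ 0 := by positivity
  rw [radauPoly, legendre, legendre, Function.iterate_succ_apply, h1, iterate_derivative_C_mul,
    sub_mul, iterate_derivative_sub, iterate_derivative_C_mul, mul_sub, ← mul_assoc, ← C_mul,
    Nat.factorial_succ]
  congr 1
  · congr 2
    push_cast
    field_simp
    ring
  · ring

lemma coe_sign_eq {s : SignType} (hs : s ≠ 0) : (s : ℝ) = 1 ∨ (s : ℝ) = -1 := by
  cases s <;> simp_all

lemma coeff_legendre_self (n : ℕ) : (legendre n).coeff n = aCoeff n := by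
  have h := iterate_derivative_legendre n
  rw [iterate_derivative_eq_C (natDegree_legendre_le n)] at h
  exact mul_right_cancel₀ (by positivity : (n ! : ℝ) ≠ 0) (C_injective h)

lemma aCoeff_pos (n : ℕ) : 0 < aCoeff n := by unfold aCoeff; positivity

lemma coeff_radauPoly (k : ℕ) (s : SignType) : (radauPoly k s).coeff (k + 1) = aCoeff (k + 1) := by
  rw [radauPoly, coeff_sub, coeff_C_mul, coeff_legendre_self,
    coeff_eq_zero_of_natDegree_lt (Nat.lt_succ_of_le (natDegree_legendre_le k))]
  simp

lemma radauPoly_ne_zero (k : ℕ) (s : SignType) : radauPoly k s ≠ 0 := fun h => by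
  have := coeff_radauPoly k s
  rw [h, coeff_zero] at this
  exact (aCoeff_pos _).ne this

lemma natDegree_radauPoly_le (k : ℕ) (s : SignType) : (radauPoly k s).natDegree ≤ k + 1 := by
  have h := natDegree_legendre_le
  exact (natDegree_sub_le_iff_left ((natDegree_C_mul_le _ _).trans ((h k).trans (by omega)))).2
    (h _)

lemma refIntegral_radauPoly_mul {k : ℕ} (s : SignType) {ψ : ℝ[X]} (hψ : derivative^[k] ψ = 0) :
    refIntegral (radauPoly k s * ψ) = 0 := by
  rw [radauPoly_eq, mul_assoc, refIntegral_C_mul,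
    refIntegral_iterate_derivative_mul (dvd_mul_left _ _) hψ, mul_zero]

/-- Repeated use of Rolle's theorem: the `j`-th derivative of a polynomial that vanishes to order
`k ≥ j` at both ends of `[-1, 1]` has `j` zeros inside. -/
lemma exists_roots_iterate_derivative {k : ℕ} {q : ℝ[X]} (hq : (X ^ 2 - 1) ^ k ∣ q) :
    ∀ j ≤ k, ∃ y : ℕ → ℝ, y 0 = -1 ∧ y (j + 1) = 1 ∧ (∀ i ≤ j, y i < y (i + 1)) ∧
      ∀ i, 1 ≤ i → i ≤ j → (derivative^[j] q).eval (y i) = 0 := by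
  intro j
  induction j with
  | zero =>
    intro _
    refine ⟨fun i => 2 * i - 1, by norm_num, by norm_num, fun i _ => by push_cast; linarith,
      fun i h1 h2 => by omega⟩
  | succ j ih =>
    intro hj
    obtain ⟨y, h0, h1, hlt, hroot⟩ := ih (by omega)
    have hdvd : (X ^ 2 - 1 : ℝ[X]) ∣ derivative^[j] q :=
      (dvd_pow_self _ (by omega : k - j ≠ 0)).trans (pow_sub_dvd_iterate_derivative_of_pow_dvd j hq)
    have hz : ∀ i ≤ j + 1, (derivative^[j] q).eval (y i) = 0 := by
      intro i hi
      obtain ⟨g, hg⟩ := hdvd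
      rcases Nat.eq_zero_or_pos i with rfl | hi0
      · rw [h0, hg]; simp
      · rcases hi.lt_or_eq with h | rfl
        · exact hroot i hi0 (by omega)
        · rw [h1, hg]; simp
    have hR : ∀ i, ∃ z, i ≤ j → y i < z ∧ z < y (i + 1) ∧
        (derivative^[j + 1] q).eval z = 0 := by
      intro i
      by_cases hi : i ≤ j
      · obtain ⟨z, hz1, hz2⟩ := exists_hasDerivAt_eq_zero (hlt i hi)
          (derivative^[j] q).continuous.continuousOn
          (by rw [hz i (by omega), hz (i + 1) (by omega)])
          (fun x _ => (derivative^[j] q).hasDerivAt x)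
        exact ⟨z, fun _ => ⟨hz1.1, hz1.2, by rwa [Function.iterate_succ_apply']⟩⟩
      · exact ⟨0, fun h => absurd h hi⟩
    choose z hz' using hR
    refine ⟨fun i => if i = 0 then -1 else if i ≤ j + 1 then z (i - 1) else 1, by simp, by simp,
      ?_, ?_⟩
    · intro i hi
      rcases Nat.eq_zero_or_pos i with rfl | hi0
      · simpa [h0] using (hz' 0 (by omega)).1
      · obtain ⟨m, rfl⟩ : ∃ m, i = m + 1 := ⟨i - 1, by omega⟩
        have hm := hz' m (by omega)
        rcases hi.lt_or_eq with h | h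
        · have hm' := hz' (m + 1) (by omega)
          simpa [show m ≤ j by omega, show m + 1 ≤ j by omega] using hm.2.1.trans hm'.1
        · obtain rfl : m = j := by omega
          rw [h1] at hm
          simpa using hm.2.1
    · intro i hi1 hi2
      obtain ⟨m, rfl⟩ : ∃ m, i = m + 1 := ⟨i - 1, by omega⟩
      simpa [show m ≤ j by omega] using (hz' m (by omega)).2.2

/-- The Gauss-Radau points are `k + 1` distinct points of `[-1, 1]`, one of them the endpoint `s`:
`k` of them are the interior zeros provided by Rolle's theorem. -/
lemma radauNodes_spec (k : ℕ) {s : SignType} (hs : s ≠ 0) :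
    (radauNodes k s).card = k + 1 ∧ (∀ ρ ∈ radauNodes k s, ρ ∈ Set.Icc (-1 : ℝ) 1) ∧
      (s : ℝ) ∈ radauNodes k s := by
  obtain ⟨y, h0, h1, hlt, hroot⟩ := exists_roots_iterate_derivative
    (dvd_mul_left ((X ^ 2 - 1 : ℝ[X]) ^ k) (X - C (s : ℝ))) k le_rfl
  have hmono : ∀ d i, i + d ≤ k + 1 → y i ≤ y (i + d) := by
    intro d
    induction d with
    | zero => intro i _; exact le_rfl
    | succ d ih => intro i hi; exact (ih i (by omega)).trans (hlt (i + d) (by omega)).le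
  have hstrict : ∀ i j, i < j → j ≤ k + 1 → y i < y j := by
    intro i j hij hj
    obtain ⟨d, rfl⟩ : ∃ d, j = i + 1 + d := ⟨j - i - 1, by omega⟩
    exact (hlt i (by omega)).trans_le (hmono d _ hj)
  have hint : ∀ i ∈ Finset.Icc 1 k, -1 < y i ∧ y i < 1 := by
    intro i hi
    rw [Finset.mem_Icc] at hi
    exact ⟨h0 ▸ hstrict 0 i (by omega) (by omega), h1 ▸ hstrict i (k + 1) (by omega) le_rfl⟩
  set S : Finset ℝ := insert (s : ℝ) ((Finset.Icc 1 k).image y) with hS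
  have hScard : S.card = k + 1 := by
    rw [hS, Finset.card_insert_of_notMem, Finset.card_image_of_injOn]
    · simp
    · intro i hi j hj hij
      simp only [Finset.coe_Icc, Set.mem_Icc] at hi hj
      rcases lt_trichotomy i j with h | h | h
      · exact absurd hij (hstrict i j h (by omega)).ne
      · exact h
      · exact absurd hij (hstrict j i h (by omega)).ne'
    · intro h
      obtain ⟨i, hi, hi'⟩ := Finset.mem_image.1 h
      have := hint i hi
      rcases coe_sign_eq hs with h | h <;> linarith
  have hsroot : (radauPoly k s).eval (s : ℝ) = 0 := by
    rw [radauPoly, eval_sub, eval_mul, eval_C]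
    rcases coe_sign_eq hs with h | h <;> rw [h]
    · simp [eval_one_legendre]
    · simp [eval_neg_one_legendre, pow_succ]
  have hsub : S ⊆ radauNodes k s := by
    intro ρ hρ
    rw [radauNodes, Multiset.mem_toFinset, mem_roots (radauPoly_ne_zero k s), IsRoot]
    rcases Finset.mem_insert.1 hρ with rfl | hρ
    · exact hsroot
    · obtain ⟨i, hi, rfl⟩ := Finset.mem_image.1 hρ
      rw [Finset.mem_Icc] at hi
      rw [radauPoly_eq, eval_mul, hroot i hi.1 hi.2, mul_zero]
  have hcard : (radauNodes k s).card ≤ S.card := by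
    rw [hScard]
    exact (Multiset.toFinset_card_le _).trans ((card_roots' _).trans (natDegree_radauPoly_le k s))
  have heq := Finset.eq_of_subset_of_card_le hsub hcard
  rw [← heq]
  refine ⟨hScard, fun ρ hρ => ?_, Finset.mem_insert_self _ _⟩
  rcases Finset.mem_insert.1 hρ with rfl | hρ
  · rcases coe_sign_eq hs with h | h <;> rw [h] <;> norm_num
  · obtain ⟨i, hi, rfl⟩ := Finset.mem_image.1 hρ
    exact ⟨(hint i hi).1.le, (hint i hi).2.le⟩

/-- The Gauss-Radau interpolant of degree at most `k` on the reference element. -/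
noncomputable def radauInterp (k : ℕ) (s : SignType) (g : ℝ → ℝ) : ℝ[X] :=
  Lagrange.interpolate (radauNodes k s) id g

lemma radauInterp_eq_sum (k : ℕ) (s : SignType) (g : ℝ → ℝ) :
    radauInterp k s g = ∑ ρ ∈ radauNodes k s, C (g ρ) * Lagrange.basis (radauNodes k s) id ρ :=
  Lagrange.interpolate_apply _ _ _

lemma eval_radauInterp {k : ℕ} {s : SignType} (g : ℝ → ℝ) {ρ : ℝ} (hρ : ρ ∈ radauNodes k s) :
    (radauInterp k s g).eval ρ = g ρ :=
  Lagrange.eval_interpolate_at_node g (Function.injective_id.injOn) hρ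

lemma natDegree_radauInterp_le (k : ℕ) {s : SignType} (hs : s ≠ 0) (g : ℝ → ℝ) :
    (radauInterp k s g).natDegree ≤ k := by
  have h := Lagrange.degree_interpolate_lt (s := radauNodes k s) (v := id) g
    Function.injective_id.injOn
  rw [(radauNodes_spec k hs).1] at h
  rcases eq_or_ne (radauInterp k s g) 0 with h0 | h0
  · simp [h0]
  · exact Nat.lt_succ_iff.1 ((natDegree_lt_iff_degree_lt h0).2 h)

lemma radauInterp_eq_of_eval {k : ℕ} {s : SignType} (hs : s ≠ 0) {g : ℝ → ℝ} {p : ℝ[X]}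
    (hp : p.natDegree ≤ k) (h : ∀ ρ ∈ radauNodes k s, p.eval ρ = g ρ) : radauInterp k s g = p := by
  refine (Lagrange.eq_interpolate_of_eval_eq g Function.injective_id.injOn ?_ h).symm
  rw [(radauNodes_spec k hs).1]
  exact lt_of_le_of_lt (natDegree_le_iff_degree_le.1 hp) (by exact_mod_cast Nat.lt_succ_self k)

lemma radauInterp_add (k : ℕ) (s : SignType) (g h : ℝ → ℝ) :
    radauInterp k s (fun ρ => g ρ + h ρ) = radauInterp k s g + radauInterp k s h :=
  map_add (Lagrange.interpolate (radauNodes k s) id) g h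

lemma radauInterp_sub (k : ℕ) (s : SignType) (g h : ℝ → ℝ) :
    radauInterp k s (fun ρ => g ρ - h ρ) = radauInterp k s g - radauInterp k s h :=
  map_sub (Lagrange.interpolate (radauNodes k s) id) g h

/-- The interpolation error of a polynomial of degree `k + 1` is a multiple of the Radau polynomial,
and therefore orthogonal to `P^{k-1}`. -/
lemma refIntegral_sub_radauInterp_mul {k : ℕ} {s : SignType} (hs : s ≠ 0) {p ψ : ℝ[X]}
    (hp : p.natDegree ≤ k + 1) (hψ : derivative^[k] ψ = 0) :
    refIntegral ((p - radauInterp k s (fun ρ => p.eval ρ)) * ψ) = 0 := by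
  set b := p.coeff (k + 1) / aCoeff (k + 1)
  have hdeg : (p - C b * radauPoly k s).natDegree ≤ k := by
    have h1 : (p - C b * radauPoly k s).natDegree ≤ k + 1 :=
      (natDegree_sub_le_iff_left ((natDegree_C_mul_le _ _).trans (natDegree_radauPoly_le k s))).2 hp
    rw [natDegree_le_iff_coeff_eq_zero]
    intro n hn
    rcases (Nat.succ_le_of_lt hn).lt_or_eq with h | h
    · exact coeff_eq_zero_of_natDegree_lt (lt_of_le_of_lt h1 h)
    · rw [← h, coeff_sub, coeff_C_mul, Nat.succ_eq_add_one, coeff_radauPoly,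
        div_mul_cancel₀ _ (aCoeff_pos _).ne', sub_self]
  have heq : radauInterp k s (fun ρ => p.eval ρ) = p - C b * radauPoly k s := by
    refine radauInterp_eq_of_eval hs hdeg fun ρ hρ => ?_
    have : (radauPoly k s).eval ρ = 0 := by
      rw [radauNodes, Multiset.mem_toFinset, mem_roots (radauPoly_ne_zero k s)] at hρ
      exact hρ
    rw [eval_sub, eval_mul, this, mul_zero, sub_zero]
  rw [heq, sub_sub_cancel, mul_assoc, refIntegral_C_mul, refIntegral_radauPoly_mul s hψ, mul_zero]

/-! ### The Markov constants -/

lemma refIntegral_mul_self (p : ℝ[X]) : refIntegral (p * p) = ∫ r in (-1 : ℝ)..1, p.eval r ^ 2 := by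
  rw [refIntegral_apply]
  simp only [eval_mul, sq]

lemma exists_isMarkovConst (m : ℕ) : ∃ b, IsMarkovConst m b := by
  simp only [IsMarkovConst, ← refIntegral_mul_self]
  induction m with
  | zero =>
    refine ⟨0, le_rfl, fun p hp => ?_⟩
    rw [eq_C_of_natDegree_eq_zero (Nat.le_zero.1 hp)]
    simp
  | succ m ih =>
    obtain ⟨b, hb0, hb⟩ := ih
    set L := legendre (m + 1)
    have hL : 0 < refIntegral (L * L) := by
      rw [refIntegral_legendre_mul_self]; positivity
    have hL' := refIntegral_mul_self_nonneg (derivative L)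
    refine ⟨2 * (refIntegral (derivative L * derivative L) / refIntegral (L * L)) + 2 * b,
      by positivity, fun p hp => ?_⟩
    -- Split off the top Legendre component, which is orthogonal to the rest.
    set l := p.coeff (m + 1) / aCoeff (m + 1)
    set w := p - C l * L with hw
    have hdeg : w.natDegree ≤ m := by
      have h1 : w.natDegree ≤ m + 1 :=
        (natDegree_sub_le_iff_left ((natDegree_C_mul_le _ _).trans (natDegree_legendre_le _))).2 hp
      rw [natDegree_le_iff_coeff_eq_zero]
      intro n hn
      rcases (Nat.succ_le_of_lt hn).lt_or_eq with h | h
      · exact coeff_eq_zero_of_natDegree_lt (lt_of_le_of_lt h1 h)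
      · rw [← h, hw, coeff_sub, coeff_C_mul, Nat.succ_eq_add_one, coeff_legendre_self,
          div_mul_cancel₀ _ (aCoeff_pos _).ne', sub_self]
    have horth : refIntegral (L * w) = 0 :=
      refIntegral_legendre_mul (iterate_derivative_eq_zero (Nat.lt_succ_of_le hdeg))
    have hp' : p = C l * L + w := by rw [hw]; ring
    have e1 : refIntegral (p * p) = l ^ 2 * refIntegral (L * L) + refIntegral (w * w) := by
      have : p * p = C (l ^ 2) * (L * L) + C (2 * l) * (L * w) + w * w := by
        rw [hp']; simp only [C_mul, C_pow]; rw [show (C (2 : ℝ) : ℝ[X]) = 2 from rfl]; ring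
      rw [this, map_add, map_add, refIntegral_C_mul, refIntegral_C_mul, horth]; ring
    have e2 : refIntegral (derivative p * derivative p) ≤
        2 * (l ^ 2 * refIntegral (derivative L * derivative L)) +
          2 * refIntegral (derivative w * derivative w) := by
      have h1 := refIntegral_mul_self_nonneg (C l * derivative L - derivative w)
      have h2 : derivative p * derivative p +
          (C l * derivative L - derivative w) * (C l * derivative L - derivative w) =
          C (2 * l ^ 2) * (derivative L * derivative L) + C 2 * (derivative w * derivative w) := by
        rw [hp', derivative_add, derivative_C_mul]
        simp only [C_mul, C_pow]; rw [show (C (2 : ℝ) : ℝ[X]) = 2 from rfl]; ring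
      have h3 := congrArg refIntegral h2
      rw [map_add, map_add, refIntegral_C_mul, refIntegral_C_mul] at h3
      linarith
    have e3 := hb w hdeg
    have hww := refIntegral_mul_self_nonneg w
    calc _ ≤ 2 * (l ^ 2 * refIntegral (derivative L * derivative L)) +
          2 * (b * refIntegral (w * w)) := by linarith
      _ ≤ (2 * (refIntegral (derivative L * derivative L) / refIntegral (L * L)) + 2 * b) *
          (l ^ 2 * refIntegral (L * L) + refIntegral (w * w)) := by
        have : (2 * (refIntegral (derivative L * derivative L) / refIntegral (L * L)) + 2 * b) *
            (l ^ 2 * refIntegral (L * L) + refIntegral (w * w)) =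
            2 * (l ^ 2 * refIntegral (derivative L * derivative L)) +
            2 * (b * refIntegral (w * w)) + (2 * b * (l ^ 2 * refIntegral (L * L)) +
            2 * (refIntegral (derivative L * derivative L) / refIntegral (L * L)) *
              refIntegral (w * w)) := by
          field_simp; ring
        rw [this]
        have : 0 ≤ 2 * b * (l ^ 2 * refIntegral (L * L)) +
            2 * (refIntegral (derivative L * derivative L) / refIntegral (L * L)) *
              refIntegral (w * w) := by positivity
        linarith
      _ = _ := by rw [e1]

lemma isMarkovConst_markovConst (m : ℕ) : IsMarkovConst m (markovConst m) := by
  have hcl : IsClosed {b : ℝ | IsMarkovConst m b} := by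
    simp only [IsMarkovConst, Set.ofPred_and, Set.ofPred_forall]
    refine (isClosed_le (by fun_prop) (by fun_prop)).inter
      (isClosed_iInter fun p => isClosed_iInter fun _ => isClosed_le (by fun_prop) (by fun_prop))
  exact hcl.csInf_mem (exists_isMarkovConst m) ⟨0, fun b hb => hb.1⟩

lemma refIntegral_derivative_mul_self_le {m : ℕ} {p : ℝ[X]} (hp : p.natDegree ≤ m) :
    refIntegral (derivative p * derivative p) ≤ markovConst m * refIntegral (p * p) := by
  rw [refIntegral_mul_self, refIntegral_mul_self]
  exact (isMarkovConst_markovConst m).2 p hp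

/-- Markov's inequality in each of the degrees `m, m - 1, …, 1` bounds the derivative of
order `m`. -/
lemma refIntegral_iterate_derivative_mul_self_le {m : ℕ} : ∀ {p : ℝ[X]}, p.natDegree ≤ m →
    refIntegral (derivative^[m] p * derivative^[m] p) ≤
      (∏ i ∈ Finset.Icc 1 m, markovConst i) * refIntegral (p * p) := by
  induction m with
  | zero => intro p _; simp
  | succ m ih =>
    intro p hp
    have h0 : 0 ≤ ∏ i ∈ Finset.Icc 1 m, markovConst i :=
      Finset.prod_nonneg fun i _ => (isMarkovConst_markovConst i).1
    have h1 := ih (p := derivative p) (by have := natDegree_derivative_le p; omega)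
    have h2 := mul_le_mul_of_nonneg_left (refIntegral_derivative_mul_self_le hp) h0
    rw [Function.iterate_succ_apply, Finset.prod_Icc_succ_top (by omega), mul_assoc]
    exact h1.trans h2

/-! ### Sobolev functions on one interval -/

lemma sq_setIntegral_mul_le {α β : ℝ} {f g : ℝ → ℝ}
    (hf : MemLp f 2 (volume.restrict (Set.Icc α β)))
    (hg : MemLp g 2 (volume.restrict (Set.Icc α β))) :
    (∫ x in Set.Icc α β, f x * g x) ^ 2 ≤
      (∫ x in Set.Icc α β, f x ^ 2) * ∫ x in Set.Icc α β, g x ^ 2 := by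
  have hf2 := hf.integrable_sq
  have hg2 := hg.integrable_sq
  have hfg : Integrable (fun x => f x * g x) (volume.restrict (Set.Icc α β)) :=
    hf.integrable_mul hg
  have h : ∀ t : ℝ, 0 ≤ (∫ x in Set.Icc α β, g x ^ 2) * (t * t) +
      2 * (∫ x in Set.Icc α β, f x * g x) * t + ∫ x in Set.Icc α β, f x ^ 2 := fun t => by
    have h0 : 0 ≤ ∫ x in Set.Icc α β, (f x + t * g x) ^ 2 :=
      integral_nonneg fun x => sq_nonneg _
    have e : ∫ x in Set.Icc α β, (f x + t * g x) ^ 2 =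
        ∫ x in Set.Icc α β, (f x ^ 2 + (2 * t) * (f x * g x) + (t * t) * g x ^ 2) :=
      integral_congr_ae (Filter.Eventually.of_forall fun x => by ring)
    have i1 := hfg.const_mul (2 * t)
    have i2 := hg2.const_mul (t * t)
    rw [e, integral_add (f := fun x => f x ^ 2 + 2 * t * (f x * g x)) (hf2.add i1) i2,
      integral_add hf2 i1, integral_const_mul, integral_const_mul] at h0
    linarith
  have := discrim_le_zero h
  rw [discrim] at this
  nlinarith

lemma intervalIntegral_eq_setIntegral_Icc {α β : ℝ} (h : α ≤ β) (f : ℝ → ℝ) :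
    ∫ x in α..β, f x = ∫ x in Set.Icc α β, f x := by
  rw [intervalIntegral.integral_of_le h, integral_Icc_eq_integral_Ioc]

lemma memLp_of_continuousOn {α β : ℝ} {f : ℝ → ℝ} (hf : ContinuousOn f (Set.Icc α β)) :
    MemLp f 2 (volume.restrict (Set.Icc α β)) := by
  obtain ⟨b, hb⟩ := isCompact_Icc.exists_bound_of_continuousOn hf
  exact MemLp.of_bound (hf.aestronglyMeasurable measurableSet_Icc) b
    ((ae_restrict_iff' measurableSet_Icc).2 (Filter.Eventually.of_forall hb))

lemma seminormH_nonneg (m : ℕ) (f : ℝ → ℝ) (α β : ℝ) : 0 ≤ seminormH m f α β := Real.sqrt_nonneg _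

lemma seminormH_sq {α β : ℝ} (h : α ≤ β) (m : ℕ) (f : ℝ → ℝ) :
    seminormH m f α β ^ 2 = ∫ x in α..β, (iteratedDerivWithin m f (Set.Icc α β) x) ^ 2 :=
  Real.sq_sqrt (intervalIntegral.integral_nonneg h fun _ _ => sq_nonneg _)

/-- Away from the two endpoints the one-sided derivatives are derivatives. -/
lemma iteratedDerivWithin_Icc_eq_of_mem_Ioo {α β : ℝ} (m : ℕ) (f : ℝ → ℝ) {x : ℝ}
    (hx : x ∈ Set.Ioo α β) :
    iteratedDerivWithin m f (Set.Icc α β) x = iteratedDeriv m f x := by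
  rw [← iteratedDerivWithin_univ, iteratedDerivWithin, iteratedDerivWithin,
    iteratedFDerivWithin_congr_set]
  filter_upwards [Ioo_mem_nhds hx.1 hx.2] with z hz
  exact eq_iff_iff.2 ⟨fun _ => trivial, fun _ => Set.Ioo_subset_Icc_self hz⟩

lemma seminormH_eq_iteratedDeriv {α β : ℝ} (h : α ≤ β) (m : ℕ) (f : ℝ → ℝ) :
    seminormH m f α β = √(∫ x in α..β, (iteratedDeriv m f x) ^ 2) := by
  rw [seminormH, intervalIntegral.integral_of_le h, intervalIntegral.integral_of_le h,
    integral_Ioc_eq_integral_Ioo, integral_Ioc_eq_integral_Ioo]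
  congr 1
  refine setIntegral_congr_fun measurableSet_Ioo fun x hx => ?_
  simp only [iteratedDerivWithin_Icc_eq_of_mem_Ioo m f hx]

lemma seminormH_le_of_bound {α β : ℝ} (h : α ≤ β) {m : ℕ} {f : ℝ → ℝ} {b : ℝ} (hb0 : 0 ≤ b)
    (hb : ∀ x ∈ Set.Icc α β, |iteratedDerivWithin m f (Set.Icc α β) x| ≤ b) :
    seminormH m f α β ≤ √(β - α) * b := by
  rw [seminormH, ← Real.sqrt_sq hb0, ← Real.sqrt_mul (by linarith)]
  refine Real.sqrt_le_sqrt ?_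
  have := intervalIntegral.norm_integral_le_of_norm_le_const (a := α) (b := β)
    (f := fun x => (iteratedDerivWithin m f (Set.Icc α β) x) ^ 2) (C := b ^ 2) (fun x hx => by
      rw [Set.uIoc_of_le h] at hx
      rw [Real.norm_eq_abs, abs_pow]
      exact pow_le_pow_left₀ (abs_nonneg _) (hb x (Set.Ioc_subset_Icc_self hx)) 2)
  rw [abs_of_nonneg (by linarith : 0 ≤ β - α), mul_comm] at this
  exact (le_abs_self _).trans this

lemma avgSeminorm_nonneg (m : ℕ) (f : ℝ → ℝ) (α β : ℝ) : 0 ≤ avgSeminorm m f α β :=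
  div_nonneg (seminormH_nonneg _ _ _ _) (Real.sqrt_nonneg _)

lemma sqrt_mul_avgSeminorm {α β : ℝ} (h : α < β) (m : ℕ) (f : ℝ → ℝ) :
    √(β - α) * avgSeminorm m f α β = seminormH m f α β := by
  rw [avgSeminorm, mul_div_cancel₀]
  exact (Real.sqrt_pos.2 (by linarith)).ne'

lemma modNorm_nonneg (m : ℕ) (f : ℝ → ℝ) (α β : ℝ) : 0 ≤ modNorm m f α β := Real.sqrt_nonneg _

/-- The fundamental theorem of calculus and the Cauchy-Schwarz inequality. -/
lemma sq_sub_le_of_absolutelyContinuous {α β : ℝ} {g : ℝ → ℝ} (h : α ≤ β)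
    (hac : AbsolutelyContinuousOnInterval g α β)
    (hg : MemLp (derivWithin g (Set.Icc α β)) 2 (volume.restrict (Set.Icc α β)))
    {y z : ℝ} (hy : y ∈ Set.Icc α β) (hz : z ∈ Set.Icc α β) :
    (g y - g z) ^ 2 ≤ (β - α) * ∫ x in α..β, derivWithin g (Set.Icc α β) x ^ 2 := by
  wlog hzy : z ≤ y generalizing y z
  · rw [← neg_sub, neg_sq]; exact this hz hy (le_of_not_ge hzy)
  have hsub : Set.Icc z y ⊆ Set.Icc α β := Set.Icc_subset_Icc hz.1 hy.2
  have h1 := (hac.mono (c := z) (d := y) (by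
    rw [Set.uIcc_of_le hzy, Set.uIcc_of_le h]; exact hsub)).integral_deriv_eq_sub
  have h2 : ∫ x in z..y, deriv g x = ∫ x in Set.Icc z y, derivWithin g (Set.Icc α β) x * 1 := by
    rw [intervalIntegral.integral_of_le hzy, integral_Ioc_eq_integral_Ioo,
      integral_Icc_eq_integral_Ioo]
    refine setIntegral_congr_fun measurableSet_Ioo fun x hx => ?_
    rw [mul_one]
    exact (derivWithin_of_mem_nhds
      (Icc_mem_nhds (hz.1.trans_lt hx.1) (hx.2.trans_le hy.2))).symm
  have h3 := sq_setIntegral_mul_le (hg.mono_measure (Measure.restrict_mono hsub le_rfl))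
    (memLp_of_continuousOn (α := z) (β := y) (f := fun _ => 1) continuousOn_const)
  have h4 : ∫ x in Set.Icc z y, derivWithin g (Set.Icc α β) x ^ 2 ≤
      ∫ x in Set.Icc α β, derivWithin g (Set.Icc α β) x ^ 2 :=
    setIntegral_mono_set hg.integrable_sq
      (Filter.Eventually.of_forall fun x => sq_nonneg _) hsub.eventuallyLE
  have h5 : 0 ≤ ∫ x in Set.Icc z y, derivWithin g (Set.Icc α β) x ^ 2 :=
    integral_nonneg fun x => sq_nonneg _
  have h6 : ∫ x in Set.Icc z y, (1 : ℝ) ^ 2 = y - z := by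
    simp [hzy]
  rw [← h1, h2, intervalIntegral_eq_setIntegral_Icc h]
  rw [h6] at h3
  calc _ ≤ _ := h3
    _ ≤ (∫ x in Set.Icc α β, derivWithin g (Set.Icc α β) x ^ 2) * (β - α) :=
      mul_le_mul h4 (by linarith [hz.1, hy.2]) (by linarith) (h5.trans h4)
    _ = _ := mul_comm _ _

lemma modNorm_sq {α β : ℝ} (h : α ≤ β) (m : ℕ) (f : ℝ → ℝ) : modNorm m f α β ^ 2 =
    ∑ l ∈ Finset.range (m + 1), (β - α) ^ (2 * l) * (avgSeminorm l f α β) ^ 2 := by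
  have : 0 ≤ β - α := by linarith
  exact Real.sq_sqrt (Finset.sum_nonneg fun l _ => by positivity)

/-- The embedding `H^1 ⊂ C` with an explicit constant. -/
lemma abs_le_sqrt_two_mul_modNorm {α β : ℝ} (h : α < β) {f : ℝ → ℝ}
    (hf : ContDiffOn ℝ 1 f (Set.Icc α β)) (m : ℕ) {y : ℝ} (hy : y ∈ Set.Icc α β) :
    |f y| ≤ √2 * modNorm (m + 1) f α β := by
  have hd : 0 < β - α := by linarith
  have hac : AbsolutelyContinuousOnInterval f α β :=
    ContDiffOn.absolutelyContinuousOnInterval (by rwa [Set.uIcc_of_le h.le])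
  have hcont := hf.continuousOn
  have hderiv : ContinuousOn (derivWithin f (Set.Icc α β)) (Set.Icc α β) :=
    hf.continuousOn_derivWithin (uniqueDiffOn_Icc h) le_rfl
  have e0 := seminormH_sq h.le 0 f
  have e1 := seminormH_sq h.le 1 f
  simp only [iteratedDerivWithin_zero] at e0
  simp only [iteratedDerivWithin_one] at e1
  have key : ∀ z ∈ Set.Icc α β,
      f y ^ 2 ≤ 2 * f z ^ 2 + 2 * ((β - α) * seminormH 1 f α β ^ 2) := by
    intro z hz
    have := sq_sub_le_of_absolutelyContinuous h.le hac (memLp_of_continuousOn hderiv) hy hz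
    rw [← e1] at this
    nlinarith [sq_nonneg (f y - 2 * f z)]
  -- Average the inequality over `z`.
  have hint : (β - α) * f y ^ 2 ≤
      2 * seminormH 0 f α β ^ 2 + (β - α) * (2 * ((β - α) * seminormH 1 f α β ^ 2)) := by
    have hi : IntervalIntegrable (fun z => f z ^ 2) volume α β :=
      (ContinuousOn.pow (by rwa [Set.uIcc_of_le h.le]) 2).intervalIntegrable
    have := intervalIntegral.integral_mono_on h.le (f := fun _ => f y ^ 2)
      (g := fun z => 2 * f z ^ 2 + 2 * ((β - α) * seminormH 1 f α β ^ 2)) (by simp)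
      ((hi.const_mul 2).add (by simp)) key
    rw [intervalIntegral.integral_add (hi.const_mul 2) (by simp)] at this
    simp only [intervalIntegral.integral_const, intervalIntegral.integral_const_mul,
      smul_eq_mul, ← e0] at this
    linarith
  have hsum : avgSeminorm 0 f α β ^ 2 + (β - α) ^ 2 * avgSeminorm 1 f α β ^ 2 ≤
      modNorm (m + 1) f α β ^ 2 := by
    rw [modNorm_sq h.le]
    have := Finset.sum_le_sum_of_subset_of_nonneg
      (f := fun l => (β - α) ^ (2 * l) * (avgSeminorm l f α β) ^ 2)
      (Finset.range_mono (by omega : 2 ≤ m + 1 + 1)) (fun l _ _ => by positivity)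
    simpa [Finset.sum_range_succ] using this
  have hs0 := sqrt_mul_avgSeminorm h 0 f
  have hs1 := sqrt_mul_avgSeminorm h 1 f
  have hsq := Real.sq_sqrt hd.le
  rw [← hs0, ← hs1, mul_pow, mul_pow, hsq] at hint
  have h2 : f y ^ 2 ≤ 2 * modNorm (m + 1) f α β ^ 2 := by
    have : (β - α) * f y ^ 2 ≤ (β - α) * (2 * (avgSeminorm 0 f α β ^ 2 +
        (β - α) ^ 2 * avgSeminorm 1 f α β ^ 2)) := by linarith
    linarith [le_of_mul_le_mul_left this hd]
  rw [← Real.sqrt_sq_eq_abs, ← Real.sqrt_sq (modNorm_nonneg (m + 1) f α β),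
    ← Real.sqrt_mul (by norm_num)]
  exact Real.sqrt_le_sqrt h2

/-! ### Polynomials on an interval -/

lemma iteratedDeriv_eval_affine (p : ℝ[X]) (b d : ℝ) (l : ℕ) :
    iteratedDeriv l (fun y => p.eval (b * y + d)) =
      fun y => b ^ l * (derivative^[l] p).eval (b * y + d) := by
  induction l with
  | zero => simp
  | succ l ih =>
    ext y
    rw [iteratedDeriv_succ, ih]
    have h1 : HasDerivAt (fun y : ℝ => b * y + d) b y := by
      simpa using ((hasDerivAt_id y).const_mul b).add_const d
    have h2 := (((derivative^[l] p).hasDerivAt (b * y + d)).comp y h1).const_mul (b ^ l)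
    rw [Function.iterate_succ_apply', pow_succ]
    refine h2.deriv.trans ?_
    ring

lemma contDiff_eval (p : ℝ[X]) (n : WithTop ℕ∞) : ContDiff ℝ n (fun y => p.eval y) := by
  simpa [coe_aeval_eq_eval] using p.contDiff_aeval (𝕜 := ℝ) n

lemma contDiff_eval_affine (p : ℝ[X]) (b d : ℝ) (n : WithTop ℕ∞) :
    ContDiff ℝ n (fun y => p.eval (b * y + d)) :=
  (contDiff_eval p n).comp (by fun_prop)

lemma toRef_eq (α β y : ℝ) :
    toRef α β y = 2 / (β - α) * y + (-(2 * α) / (β - α) - 1) := by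
  rw [toRef]; ring

lemma iteratedDeriv_eval_toRef (p : ℝ[X]) (α β : ℝ) (l : ℕ) :
    iteratedDeriv l (fun y => p.eval (toRef α β y)) =
      fun y => (2 / (β - α)) ^ l * (derivative^[l] p).eval (toRef α β y) := by
  simp only [toRef_eq]; exact iteratedDeriv_eval_affine _ _ _ _

lemma contDiff_eval_toRef (p : ℝ[X]) (α β : ℝ) (n : WithTop ℕ∞) :
    ContDiff ℝ n (fun y => p.eval (toRef α β y)) := by
  simp only [toRef_eq]; exact contDiff_eval_affine _ _ _ _

lemma iteratedDerivWithin_eval {α β : ℝ} (h : α < β) (p : ℝ[X]) (l : ℕ) {y : ℝ}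
    (hy : y ∈ Set.Icc α β) :
    iteratedDerivWithin l (fun y => p.eval y) (Set.Icc α β) y = (derivative^[l] p).eval y := by
  rw [iteratedDerivWithin_eq_iteratedDeriv (uniqueDiffOn_Icc h) (contDiff_eval p _).contDiffAt hy]
  simpa using congrFun (iteratedDeriv_eval_affine p 1 0 l) y

lemma toRef_fromRef {α β : ℝ} (h : α < β) (r : ℝ) : toRef α β (fromRef α β r) = r := by
  have : β - α ≠ 0 := by linarith
  rw [toRef, fromRef]; field_simp; ring

lemma fromRef_toRef {α β : ℝ} (h : α < β) (y : ℝ) : fromRef α β (toRef α β y) = y := by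
  have : β - α ≠ 0 := by linarith
  rw [toRef, fromRef]; field_simp; ring

lemma fromRef_mem {α β : ℝ} (h : α ≤ β) {r : ℝ} (hr : r ∈ Set.Icc (-1 : ℝ) 1) :
    fromRef α β r ∈ Set.Icc α β := by
  rw [fromRef]
  constructor <;> nlinarith [hr.1, hr.2]

lemma toRef_mem {α β : ℝ} (h : α < β) {y : ℝ} (hy : y ∈ Set.Icc α β) :
    toRef α β y ∈ Set.Icc (-1 : ℝ) 1 := by
  have hd : 0 < β - α := by linarith
  have h1 : 0 ≤ (y - α) / (β - α) := div_nonneg (by linarith [hy.1]) hd.le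
  have h2 : (y - α) / (β - α) ≤ 1 := (div_le_one hd).2 (by linarith [hy.2])
  rw [toRef]
  constructor <;> linarith

lemma fromRef_eq (α β r : ℝ) : fromRef α β r = (β - α) / 2 * r + (α + β) / 2 := by
  rw [fromRef]; ring

/-- Change of variables to the reference element. -/
lemma integral_eq_refElement (α β : ℝ) (f : ℝ → ℝ) :
    ∫ y in α..β, f y = (β - α) / 2 * ∫ r in (-1 : ℝ)..1, f (fromRef α β r) := by
  simp only [fromRef_eq]
  rw [intervalIntegral.mul_integral_comp_mul_add]
  congr 1 <;> ring

/-- A polynomial in the physical variable, as a polynomial on the reference element. -/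
lemma exists_eval_fromRef (α β : ℝ) (p : ℝ[X]) :
    ∃ q : ℝ[X], q.natDegree ≤ p.natDegree ∧ ∀ r, q.eval r = p.eval (fromRef α β r) := by
  refine ⟨p.comp (C ((β - α) / 2) * X + C ((α + β) / 2)), ?_, fun r => ?_⟩
  · rw [natDegree_comp]
    exact (Nat.mul_le_mul_left _ natDegree_linear_le).trans (mul_one _).le
  · rw [eval_comp, fromRef_eq]; simp

/-! ### Adding polynomials; Taylor remainders -/

lemma absolutelyContinuousOnInterval_congr {α β : ℝ} {f g : ℝ → ℝ}
    (hfg : ∀ x ∈ Set.uIcc α β, f x = g x) (hf : AbsolutelyContinuousOnInterval f α β) :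
    AbsolutelyContinuousOnInterval g α β := by
  rw [absolutelyContinuousOnInterval_iff] at *
  intro ε hε
  obtain ⟨δ, hδ, H⟩ := hf ε hε
  refine ⟨δ, hδ, fun E hE hlt => lt_of_eq_of_lt (Finset.sum_congr rfl fun i hi => ?_) (H E hE hlt)⟩
  rw [hfg _ (hE.1 i hi).1, hfg _ (hE.1 i hi).2]

lemma MemSobolev.add_polynomial {n : ℕ} {f : ℝ → ℝ} {α β : ℝ} (h : α < β)
    (hf : MemSobolev (n + 1) f α β) {p : ℝ[X]} (hp : p.natDegree ≤ n) :
    MemSobolev (n + 1) (fun x => f x + p.eval x) α β ∧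
      seminormH (n + 1) (fun x => f x + p.eval x) α β = seminormH (n + 1) f α β := by
  obtain ⟨h1, h2, h3⟩ := hf
  have hu := uniqueDiffOn_Icc h
  obtain ⟨b, hb⟩ : ∃ b, derivative^[n] p = C b := ⟨_, iterate_derivative_eq_C hp⟩
  have e0 : Set.EqOn (iteratedDerivWithin n (fun x => f x + p.eval x) (Set.Icc α β))
      (fun x => iteratedDerivWithin n f (Set.Icc α β) x + b) (Set.Icc α β) := fun x hx => by
    rw [iteratedDerivWithin_fun_add hx hu (h1 x hx) (contDiff_eval p _).contDiffAt.contDiffWithinAt,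
      iteratedDerivWithin_eval h p n hx, hb, eval_C]
  have e1 : Set.EqOn (iteratedDerivWithin (n + 1) (fun x => f x + p.eval x) (Set.Icc α β))
      (iteratedDerivWithin (n + 1) f (Set.Icc α β)) (Set.Icc α β) := fun x hx => by
    rw [iteratedDerivWithin_succ, iteratedDerivWithin_succ,
      derivWithin_congr e0 (e0 hx), derivWithin_add_const]
  refine ⟨⟨h1.add (contDiff_eval p _).contDiffOn, ?_, ?_⟩, ?_⟩
  · have hb : AbsolutelyContinuousOnInterval (fun _ : ℝ => b) α β :=
      contDiffOn_const.absolutelyContinuousOnInterval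
    refine absolutelyContinuousOnInterval_congr (fun x hx => ?_) (h2.fun_add hb)
    rw [Set.uIcc_of_le h.le] at hx
    exact (e0 hx).symm
  · exact (memLp_congr_ae ((ae_restrict_iff' measurableSet_Icc).2
      (Filter.Eventually.of_forall fun x hx => e1 hx))).2 h3
  · rw [seminormH, seminormH]
    congr 1
    refine intervalIntegral.integral_congr fun x hx => ?_
    rw [Set.uIcc_of_le h.le] at hx
    simp only [e1 hx]

/-- Subtracting the Taylor polynomial at the left end. -/
lemma exists_polynomial_iteratedDerivWithin_eq_zero {n : ℕ} {f : ℝ → ℝ} {α β : ℝ} (h : α < β)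
    (hf : ContDiffOn ℝ n f (Set.Icc α β)) : ∃ p : ℝ[X], p.natDegree ≤ n ∧
      ∀ l ≤ n, iteratedDerivWithin l (fun x => f x + p.eval x) (Set.Icc α β) α = 0 := by
  have hα : α ∈ Set.Icc α β := Set.left_mem_Icc.2 h.le
  set d : ℕ → ℝ := fun l => iteratedDerivWithin l f (Set.Icc α β) α
  refine ⟨∑ i ∈ Finset.range (n + 1), C (-d i / (i ! : ℝ)) * (X - C α) ^ i, ?_, ?_⟩
  · refine natDegree_sum_le_of_forall_le _ _ fun i hi => (natDegree_C_mul_le _ _).trans ?_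
    rw [natDegree_pow, natDegree_X_sub_C, mul_one]
    exact Nat.lt_succ_iff.1 (Finset.mem_range.1 hi)
  · intro l hl
    rw [iteratedDerivWithin_fun_add hα (uniqueDiffOn_Icc h)
      ((hf α hα).of_le (by exact_mod_cast hl)) (contDiff_eval _ _).contDiffAt.contDiffWithinAt,
      iteratedDerivWithin_eval h _ l hα, iterate_derivative_sum, eval_finsetSum,
      Finset.sum_eq_single l]
    · rw [iterate_derivative_C_mul, iterate_derivative_X_sub_pow_self]
      have : (l ! : ℝ) ≠ 0 := by positivity
      simp only [eval_mul, eval_C, eval_natCast]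
      rw [div_mul_cancel₀ _ this]
      ring
    · intro i _ hil
      rw [iterate_derivative_C_mul, iterate_derivative_X_sub_pow, eval_mul, eval_smul, eval_pow]
      rcases lt_or_gt_of_ne hil with hlt | hgt
      · simp [Nat.descFactorial_of_lt hlt]
      · simp [show i - l ≠ 0 by omega]
    · intro hl'
      exact absurd (Finset.mem_range.2 (by omega)) hl'

/-- A function whose derivatives up to order `n` vanish at the left end is controlled, with these
derivatives, by its seminorm of order `n + 1`. -/
lemma MemSobolev.abs_iteratedDerivWithin_le {n : ℕ} {f : ℝ → ℝ} {α β : ℝ} (h : α < β)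
    (hf : MemSobolev (n + 1) f α β)
    (h0 : ∀ l ≤ n, iteratedDerivWithin l f (Set.Icc α β) α = 0) :
    ∀ d ≤ n, ∀ y ∈ Set.Icc α β, |iteratedDerivWithin (n - d) f (Set.Icc α β) y| ≤
      (β - α) ^ d * (√(β - α) * seminormH (n + 1) f α β) := by
  obtain ⟨h1, h2, h3⟩ := hf
  have hα : α ∈ Set.Icc α β := Set.left_mem_Icc.2 h.le
  have hd0 : 0 ≤ β - α := by linarith
  intro d
  induction d with
  | zero =>
    intro _ y hy
    have hsucc : iteratedDerivWithin (n + 1) f (Set.Icc α β) =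
        derivWithin (iteratedDerivWithin n f (Set.Icc α β)) (Set.Icc α β) :=
      iteratedDerivWithin_succ
    have := sq_sub_le_of_absolutelyContinuous h.le h2 (hsucc ▸ h3) hy hα
    rw [h0 n le_rfl, sub_zero, ← hsucc, ← seminormH_sq h.le] at this
    rw [pow_zero, one_mul, Nat.sub_zero, ← Real.sqrt_sq_eq_abs,
      ← Real.sqrt_sq (seminormH_nonneg (n + 1) f α β), ← Real.sqrt_mul hd0]
    exact Real.sqrt_le_sqrt this
  | succ d ih =>
    intro hd y hy
    set b := (β - α) ^ d * (√(β - α) * seminormH (n + 1) f α β) with hb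
    have hb0 : 0 ≤ b := by have := seminormH_nonneg (n + 1) f α β; positivity
    have hdiff : DifferentiableOn ℝ (iteratedDerivWithin (n - (d + 1)) f (Set.Icc α β))
        (Set.Icc α β) := h1.differentiableOn_iteratedDerivWithin
          (by exact_mod_cast (by omega : n - (d + 1) < n)) (uniqueDiffOn_Icc h)
    have hbd : ∀ x ∈ Set.Icc α β, ‖derivWithin (iteratedDerivWithin (n - (d + 1)) f
        (Set.Icc α β)) (Set.Icc α β) x‖ ≤ b := fun x hx => by
      rw [← iteratedDerivWithin_succ, show n - (d + 1) + 1 = n - d by omega, Real.norm_eq_abs]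
      exact ih (by omega) x hx
    have := (convex_Icc α β).norm_image_sub_le_of_norm_derivWithin_le hdiff hbd hα hy
    rw [h0 _ (by omega), sub_zero, Real.norm_eq_abs, Real.norm_eq_abs,
      abs_of_nonneg (by linarith [hy.1] : 0 ≤ y - α)] at this
    calc _ ≤ _ := this
      _ ≤ b * (β - α) := mul_le_mul_of_nonneg_left (by linarith [hy.2]) hb0
      _ = _ := by rw [hb]; ring

/-! ### The Bramble-Hilbert constants -/

lemma bddBelow_modNorm (n : ℕ) (f : ℝ → ℝ) (α β : ℝ) :
    BddBelow (Set.range fun p : Polynomial.degreeLT ℝ (n + 1) =>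
      modNorm (n + 1) (fun x => f x + (p : ℝ[X]).eval x) α β) :=
  ⟨0, by rintro _ ⟨p, rfl⟩; exact modNorm_nonneg _ _ _ _⟩

lemma quotientNorm_le {n : ℕ} (f : ℝ → ℝ) (α β : ℝ) {p : ℝ[X]} (hp : p.natDegree ≤ n) :
    quotientNorm n f α β ≤ modNorm (n + 1) (fun x => f x + p.eval x) α β :=
  ciInf_le (bddBelow_modNorm n f α β)
    (⟨p, mem_degreeLT.2 (lt_of_le_of_lt (natDegree_le_iff_degree_le.1 hp)
      (by exact_mod_cast Nat.lt_succ_self n))⟩ : Polynomial.degreeLT ℝ (n + 1))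

lemma le_mul_quotientNorm {n : ℕ} {f : ℝ → ℝ} {α β b X : ℝ} (hb : 0 ≤ b)
    (h : ∀ p : ℝ[X], p.natDegree ≤ n → X ≤ b * modNorm (n + 1) (fun x => f x + p.eval x) α β) :
    X ≤ b * quotientNorm n f α β := by
  rw [quotientNorm, Real.mul_iInf_of_nonneg hb]
  refine le_ciInf fun p => h p ?_
  have := mem_degreeLT.1 p.2
  rcases eq_or_ne (p : ℝ[X]) 0 with h0 | h0
  · simp [h0]
  · exact Nat.lt_succ_iff.1 ((natDegree_lt_iff_degree_lt h0).2 this)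

/-- The Taylor remainder at the left end shows that `√(n + 2)` is admissible. -/
lemma isBrambleHilbertConst_sqrt (n : ℕ) : IsBrambleHilbertConst n √(n + 2) := by
  refine ⟨Real.sqrt_nonneg _, fun α β h f hf => ?_⟩
  have hd : 0 < β - α := by linarith
  obtain ⟨p, hp, hp0⟩ := exists_polynomial_iteratedDerivWithin_eq_zero h hf.1
  obtain ⟨hg, hg1⟩ := hf.add_polynomial h hp
  have hbound := hg.abs_iteratedDerivWithin_le h hp0
  refine (quotientNorm_le f α β hp).trans ?_
  set g := fun x => f x + p.eval x
  have hs := seminormH_nonneg (n + 1) g α β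
  have hA := avgSeminorm_nonneg (n + 1) g α β
  have hAA : avgSeminorm (n + 1) f α β = avgSeminorm (n + 1) g α β := by
    rw [avgSeminorm, avgSeminorm, hg1]
  have hsq := Real.sq_sqrt hd.le
  have hl : ∀ l ∈ Finset.range (n + 1 + 1), (β - α) ^ (2 * l) * avgSeminorm l g α β ^ 2 ≤
      ((β - α) ^ (n + 1) * avgSeminorm (n + 1) g α β) ^ 2 := by
    intro l hl
    rw [Finset.mem_range] at hl
    rcases (Nat.lt_succ_iff.1 hl).lt_or_eq with hlt | rfl
    · have h1 : seminormH l g α β ≤ √(β - α) *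
          ((β - α) ^ (n - l) * (√(β - α) * seminormH (n + 1) g α β)) :=
        seminormH_le_of_bound h.le (by positivity) (by
          simpa [show n - (n - l) = l by omega] using hbound (n - l) (by omega))
      have h2 : avgSeminorm l g α β ≤ (β - α) ^ (n + 1 - l) * avgSeminorm (n + 1) g α β := by
        rw [avgSeminorm, div_le_iff₀ (Real.sqrt_pos.2 hd)]
        refine h1.trans (le_of_eq ?_)
        rw [← sqrt_mul_avgSeminorm h (n + 1), show n + 1 - l = n - l + 1 by omega, pow_succ]
        linear_combination (√(β - α) * (β - α) ^ (n - l) * avgSeminorm (n + 1) g α β) * hsq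
      have h3 : (β - α) ^ l * avgSeminorm l g α β ≤
          (β - α) ^ (n + 1) * avgSeminorm (n + 1) g α β := by
        have := mul_le_mul_of_nonneg_left h2 (by positivity : 0 ≤ (β - α) ^ l)
        rwa [← mul_assoc, ← pow_add, show l + (n + 1 - l) = n + 1 by omega] at this
      rw [mul_comm 2 l, pow_mul, ← mul_pow]
      exact pow_le_pow_left₀ (mul_nonneg (by positivity) (avgSeminorm_nonneg _ _ _ _)) h3 2
    · rw [mul_pow, ← pow_mul, mul_comm 2]
  rw [hAA, modNorm, mul_assoc, ← Real.sqrt_sq (by positivity : 0 ≤ (β - α) ^ (n + 1) *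
    avgSeminorm (n + 1) g α β), ← Real.sqrt_mul (by positivity)]
  refine Real.sqrt_le_sqrt ((Finset.sum_le_card_nsmul _ _ _ hl).trans (le_of_eq ?_))
  rw [Finset.card_range, nsmul_eq_mul]
  push_cast
  ring

lemma isBrambleHilbertConst_brambleHilbertConst (n : ℕ) :
    IsBrambleHilbertConst n (brambleHilbertConst n) := by
  have hcl : IsClosed {b : ℝ | IsBrambleHilbertConst n b} := by
    simp only [IsBrambleHilbertConst, Set.ofPred_and, Set.ofPred_forall]
    refine (isClosed_le (by fun_prop) (by fun_prop)).inter
      (isClosed_iInter fun _ => isClosed_iInter fun _ => isClosed_iInter fun _ =>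
        isClosed_iInter fun _ => isClosed_iInter fun _ => isClosed_le (by fun_prop) (by fun_prop))
  exact hcl.csInf_mem ⟨_, isBrambleHilbertConst_sqrt n⟩ ⟨0, fun b hb => hb.1⟩

/-! ### Gauss-Radau interpolation -/

lemma bddAbove_lebesgue (k : ℕ) (s : SignType) :
    BddAbove (Set.range fun r : Set.Icc (-1 : ℝ) 1 => ∑ i ∈ radauNodes k s,
      |(Lagrange.basis (radauNodes k s) id i).eval (r : ℝ)|) := by
  have hc : Continuous fun r : Set.Icc (-1 : ℝ) 1 => ∑ i ∈ radauNodes k s,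
      |(Lagrange.basis (radauNodes k s) id i).eval (r : ℝ)| :=
    continuous_finsetSum _ fun i _ =>
      ((Polynomial.continuous _).comp continuous_subtype_val).abs
  exact (isCompact_range hc).bddAbove

lemma lebesgueConst_nonneg (k : ℕ) (s : SignType) : 0 ≤ lebesgueConst k s :=
  Real.iSup_nonneg fun _ => Finset.sum_nonneg fun _ _ => abs_nonneg _

lemma abs_eval_radauInterp_le {k : ℕ} {s : SignType} {g : ℝ → ℝ} {b : ℝ}
    (hb : ∀ ρ ∈ radauNodes k s, |g ρ| ≤ b) {r : ℝ} (hb0 : 0 ≤ b) (hr : r ∈ Set.Icc (-1 : ℝ) 1) :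
    |(radauInterp k s g).eval r| ≤ lebesgueConst k s * b := by
  rw [radauInterp_eq_sum, eval_finsetSum]
  have h1 := le_ciSup (bddAbove_lebesgue k s) ⟨r, hr⟩
  calc _ ≤ ∑ ρ ∈ radauNodes k s, |(C (g ρ) * Lagrange.basis (radauNodes k s) id ρ).eval r| :=
        Finset.abs_sum_le_sum_abs _ _
    _ ≤ ∑ ρ ∈ radauNodes k s, |(Lagrange.basis (radauNodes k s) id ρ).eval r| * b := by
        refine Finset.sum_le_sum fun ρ hρ => ?_
        rw [eval_mul, eval_C, abs_mul, mul_comm]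
        exact mul_le_mul_of_nonneg_left (hb ρ hρ) (abs_nonneg _)
    _ = (∑ ρ ∈ radauNodes k s, |(Lagrange.basis (radauNodes k s) id ρ).eval r|) * b :=
        (Finset.sum_mul _ _ _).symm
    _ ≤ _ := mul_le_mul_of_nonneg_right h1 hb0

lemma Rh_eq (k : ℕ) (s : SignType) (α β : ℝ) (w : ℝ → ℝ) (y : ℝ) :
    Rh k s α β w y = (radauInterp k s (fun r => w (fromRef α β r))).eval (toRef α β y) := rfl

/-- The interpolation error on the reference element in terms of the supremum of the function. -/
lemma abs_sub_radauInterp_le {k : ℕ} {s : SignType} (hs : s ≠ 0) {α β : ℝ} (h : α < β)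
    {w : ℝ → ℝ} {b : ℝ} (hb : ∀ y ∈ Set.Icc α β, |w y| ≤ b) {r : ℝ}
    (hr : r ∈ Set.Icc (-1 : ℝ) 1) :
    |w (fromRef α β r) - (radauInterp k s (fun r => w (fromRef α β r))).eval r| ≤
      (1 + lebesgueConst k s) * b := by
  have hb0 : 0 ≤ b := (abs_nonneg _).trans (hb α (Set.left_mem_Icc.2 h.le))
  have h1 := abs_eval_radauInterp_le (k := k) (s := s) (g := fun r => w (fromRef α β r)) (b := b)
    (fun ρ hρ => hb _ (fromRef_mem h.le ((radauNodes_spec k hs).2.1 ρ hρ))) hb0 hr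
  have h2 := hb _ (fromRef_mem h.le hr)
  calc _ ≤ _ := abs_sub _ _
    _ ≤ b + lebesgueConst k s * b := add_le_add h2 h1
    _ = _ := by ring

/-- Polynomials of degree at most `k` do not change the interpolation error. -/
lemma sub_radauInterp_add_polynomial {k : ℕ} {s : SignType} (hs : s ≠ 0) (α β : ℝ)
    (w : ℝ → ℝ) {p : ℝ[X]} (hp : p.natDegree ≤ k) (r : ℝ) :
    (w (fromRef α β r) + p.eval (fromRef α β r)) -
      (radauInterp k s (fun r => w (fromRef α β r) + p.eval (fromRef α β r))).eval r =
    w (fromRef α β r) - (radauInterp k s (fun r => w (fromRef α β r))).eval r := by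
  obtain ⟨q, hq, hq'⟩ := exists_eval_fromRef α β p
  simp only [← hq']
  rw [radauInterp_add, radauInterp_eq_of_eval hs (hq.trans hp) (fun ρ _ => rfl), eval_add]
  ring

/-- The interpolation error in the maximum norm: the Bramble-Hilbert inequality, the embedding
`H^1 ⊂ C` and the Lebesgue constant. -/
lemma abs_sub_radauInterp_le_brambleHilbert {k : ℕ} (hk : 1 ≤ k) {s : SignType} (hs : s ≠ 0)
    {α β : ℝ} (h : α < β) {w : ℝ → ℝ} (hw : MemSobolev (k + 1) w α β) {r : ℝ}
    (hr : r ∈ Set.Icc (-1 : ℝ) 1) :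
    |w (fromRef α β r) - (radauInterp k s (fun r => w (fromRef α β r))).eval r| ≤
      (1 + lebesgueConst k s) * √2 *
        (brambleHilbertConst k * (β - α) ^ (k + 1) * avgSeminorm (k + 1) w α β) := by
  have hL := lebesgueConst_nonneg k s
  refine le_trans (le_mul_quotientNorm (n := k) (f := w) (α := α) (β := β) (by positivity)
    fun p hp => ?_) (mul_le_mul_of_nonneg_left
      ((isBrambleHilbertConst_brambleHilbertConst k).2 α β h w hw) (by positivity))
  rw [← sub_radauInterp_add_polynomial hs α β w hp, mul_assoc]
  refine abs_sub_radauInterp_le hs h (w := fun y => w y + p.eval y) (fun y hy => ?_) hr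
  exact abs_le_sqrt_two_mul_modNorm h
    ((hw.1.of_le (by exact_mod_cast hk)).add (contDiff_eval p 1).contDiffOn) k hy

lemma abs_refIntegral_le {g : ℝ → ℝ} {b : ℝ} (hb0 : 0 ≤ b)
    (hg : ContinuousOn g (Set.Icc (-1) 1)) (hb : ∀ r ∈ Set.Icc (-1 : ℝ) 1, |g r| ≤ b) (ψ : ℝ[X]) :
    |∫ r in (-1 : ℝ)..1, g r * ψ.eval r| ≤ b * (√2 * √(refIntegral (ψ * ψ))) := by
  have h11 : (-1 : ℝ) ≤ 1 := by norm_num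
  have h1 := sq_setIntegral_mul_le (memLp_of_continuousOn hg)
    (memLp_of_continuousOn (ψ.continuous.continuousOn (s := Set.Icc (-1 : ℝ) 1)))
  rw [← intervalIntegral_eq_setIntegral_Icc h11, ← intervalIntegral_eq_setIntegral_Icc h11,
    ← intervalIntegral_eq_setIntegral_Icc h11, ← refIntegral_mul_self] at h1
  have h2 : ∫ r in (-1 : ℝ)..1, g r ^ 2 ≤ 2 * b ^ 2 := by
    have := intervalIntegral.integral_mono_on (μ := volume) h11
      (f := fun r => g r ^ 2) (g := fun _ => b ^ 2)
      (ContinuousOn.pow (by rwa [Set.uIcc_of_le h11]) 2).intervalIntegrable intervalIntegrable_const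
      (fun r hr => by rw [← sq_abs]; exact pow_le_pow_left₀ (abs_nonneg _) (hb r hr) 2)
    rw [intervalIntegral.integral_const, smul_eq_mul] at this
    linarith
  have h3 := refIntegral_mul_self_nonneg ψ
  rw [← Real.sqrt_mul (by norm_num), ← Real.sqrt_sq_eq_abs]
  nth_rw 1 [← Real.sqrt_sq hb0]
  rw [← Real.sqrt_mul (sq_nonneg b)]
  refine Real.sqrt_le_sqrt (h1.trans ?_)
  nlinarith [mul_le_mul_of_nonneg_right h2 h3]

lemma continuousOn_comp_fromRef {α β : ℝ} (h : α < β) {w : ℝ → ℝ}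
    (hw : ContinuousOn w (Set.Icc α β)) :
    ContinuousOn (fun r => w (fromRef α β r)) (Set.Icc (-1) 1) := by
  refine hw.comp ?_ fun r hr => fromRef_mem h.le hr
  change ContinuousOn (fun r => fromRef α β r) _
  simp only [fromRef_eq]
  fun_prop

/-- The interpolation error is almost orthogonal to `P^{k-1}`, one order better than its size:
as a functional of `w` the left side annihilates `P^{k+1}`. -/
lemma abs_integral_sub_radauInterp_mul_le {k : ℕ} (hk : 1 ≤ k) {s : SignType} (hs : s ≠ 0)
    {α β : ℝ} (h : α < β) {w : ℝ → ℝ} (hw : MemSobolev (k + 2) w α β) {ψ : ℝ[X]}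
    (hψ : derivative^[k] ψ = 0) :
    |∫ r in (-1 : ℝ)..1, (w (fromRef α β r) -
        (radauInterp k s (fun r => w (fromRef α β r))).eval r) * ψ.eval r| ≤
      (1 + lebesgueConst k s) * √2 *
        (brambleHilbertConst (k + 1) * (β - α) ^ (k + 2) * avgSeminorm (k + 2) w α β) *
          (√2 * √(refIntegral (ψ * ψ))) := by
  have hL := lebesgueConst_nonneg k s
  have hBH := (isBrambleHilbertConst_brambleHilbertConst (k + 1)).2 α β h w hw
  set D := √2 * √(refIntegral (ψ * ψ)) with hD
  have hD0 : 0 ≤ D := by positivity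
  have hwc : ContinuousOn w (Set.Icc α β) := hw.1.continuousOn
  have key : ∀ p : ℝ[X], p.natDegree ≤ k + 1 →
      |∫ r in (-1 : ℝ)..1, (w (fromRef α β r) -
        (radauInterp k s (fun r => w (fromRef α β r))).eval r) * ψ.eval r| ≤
      ((1 + lebesgueConst k s) * √2 * D) *
        modNorm (k + 1 + 1) (fun x => w x + p.eval x) α β := by
    intro p hp
    obtain ⟨q, hq, hq'⟩ := exists_eval_fromRef α β p
    have h0 := refIntegral_sub_radauInterp_mul hs (hq.trans hp) hψ
    have hc1 : ContinuousOn (fun r => w (fromRef α β r) -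
        (radauInterp k s (fun r => w (fromRef α β r))).eval r) (Set.Icc (-1) 1) :=
      (continuousOn_comp_fromRef h hwc).sub (Polynomial.continuous _).continuousOn
    have hI1 : IntervalIntegrable (fun r => (w (fromRef α β r) -
        (radauInterp k s (fun r => w (fromRef α β r))).eval r) * ψ.eval r) volume (-1) 1 := by
      refine ContinuousOn.intervalIntegrable ?_
      rw [Set.uIcc_of_le (by norm_num)]
      exact hc1.mul ψ.continuous.continuousOn
    have e : ∫ r in (-1 : ℝ)..1, (w (fromRef α β r) -
          (radauInterp k s (fun r => w (fromRef α β r))).eval r) * ψ.eval r =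
        ∫ r in (-1 : ℝ)..1, ((w (fromRef α β r) + p.eval (fromRef α β r)) -
          (radauInterp k s (fun r => w (fromRef α β r) + p.eval (fromRef α β r))).eval r) *
            ψ.eval r := by
      rw [← add_zero (∫ r in (-1 : ℝ)..1, _), ← h0, refIntegral_apply,
        ← intervalIntegral.integral_add hI1 ((Polynomial.continuous _).intervalIntegrable _ _)]
      refine intervalIntegral.integral_congr fun r _ => ?_
      simp only [← hq', radauInterp_add, eval_mul, eval_sub, eval_add]
      ring
    have hmem : ContDiffOn ℝ 1 (fun x => w x + p.eval x) (Set.Icc α β) :=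
      (hw.1.of_le (by exact_mod_cast (by omega : 1 ≤ k + 1))).add (contDiff_eval p 1).contDiffOn
    rw [e]
    have hM := modNorm_nonneg (k + 1 + 1) (fun x => w x + p.eval x) α β
    have := abs_refIntegral_le (g := fun r => (w (fromRef α β r) + p.eval (fromRef α β r)) -
          (radauInterp k s (fun r => w (fromRef α β r) + p.eval (fromRef α β r))).eval r)
      (b := (1 + lebesgueConst k s) * (√2 * modNorm (k + 1 + 1) (fun x => w x + p.eval x) α β))
      (by positivity)
      ((continuousOn_comp_fromRef h hmem.continuousOn).sub (Polynomial.continuous _).continuousOn)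
      (fun r hr => abs_sub_radauInterp_le hs h (w := fun y => w y + p.eval y)
        (fun y hy => abs_le_sqrt_two_mul_modNorm h hmem (k + 1) hy) hr) ψ
    refine this.trans (le_of_eq ?_)
    rw [hD]; ring
  refine (le_mul_quotientNorm (by positivity) key).trans ?_
  calc _ ≤ _ := mul_le_mul_of_nonneg_left hBH (by positivity)
    _ = _ := by ring

/-! ### The interpolation constants -/

lemma exists_bound_iterate_derivative_radauInterp (k m : ℕ) (s : SignType) :
    ∃ b, 0 ≤ b ∧ ∀ (g : ℝ → ℝ) (M : ℝ), (∀ ρ ∈ radauNodes k s, |g ρ| ≤ M) →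
      ∀ r ∈ Set.Icc (-1 : ℝ) 1, |(derivative^[m] (radauInterp k s g)).eval r| ≤ b * M := by
  have h : ∀ ρ, ∃ b, ∀ r ∈ Set.Icc (-1 : ℝ) 1,
      ‖(derivative^[m] (Lagrange.basis (radauNodes k s) id ρ)).eval r‖ ≤ b := fun ρ =>
    isCompact_Icc.exists_bound_of_continuousOn (Polynomial.continuous _).continuousOn
  choose b hb using h
  have hb0 : ∀ ρ, 0 ≤ b ρ := fun ρ => (norm_nonneg _).trans (hb ρ 0 (by norm_num))
  refine ⟨∑ ρ ∈ radauNodes k s, b ρ, Finset.sum_nonneg fun ρ _ => hb0 ρ, fun g M hM r hr => ?_⟩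
  rw [radauInterp_eq_sum, iterate_derivative_sum, eval_finsetSum, Finset.sum_mul]
  refine (Finset.abs_sum_le_sum_abs _ _).trans (Finset.sum_le_sum fun ρ hρ => ?_)
  rw [iterate_derivative_C_mul, eval_mul, eval_C, abs_mul, mul_comm]
  exact mul_le_mul (hb ρ r hr) (hM ρ hρ) (abs_nonneg _) (hb0 ρ)

lemma exists_isInterpConst {k m : ℕ} (hm : m ≤ k) {s : SignType} (hs : s ≠ 0) :
    ∃ b, IsInterpConst k m s b := by
  obtain ⟨b, hb0, hb⟩ := exists_bound_iterate_derivative_radauInterp k m s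
  refine ⟨1 + 2 ^ m * b, by positivity, fun α β h w hw => ?_⟩
  have hd : 0 < β - α := by linarith
  obtain ⟨p, hp, hp0⟩ := exists_polynomial_iteratedDerivWithin_eq_zero h hw.1
  obtain ⟨hg, hg1⟩ := hw.add_polynomial h hp
  have hbound := hg.abs_iteratedDerivWithin_le h hp0
  rw [hg1] at hbound
  set g := fun x => w x + p.eval x with hgdef
  have hS := seminormH_nonneg (k + 1) w α β
  set M := √(β - α) * seminormH (k + 1) w α β with hM
  have hM0 : 0 ≤ M := by positivity
  have hsup : ∀ y ∈ Set.Icc α β, |g y| ≤ (β - α) ^ k * M := by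
    simpa using hbound k le_rfl
  -- The Taylor polynomial does not change the interpolation error.
  have e : (fun x => w x - Rh k s α β w x) = fun x => g x + (-Rh k s α β g x) := by
    ext x
    have := sub_radauInterp_add_polynomial hs α β w hp (toRef α β x)
    rw [fromRef_toRef h] at this
    rw [Rh_eq, Rh_eq, ← sub_eq_add_neg, hgdef]
    exact this.symm
  have hpt : ∀ x ∈ Set.Icc α β,
      |iteratedDerivWithin m (fun x => g x + (-Rh k s α β g x)) (Set.Icc α β) x| ≤
        (1 + 2 ^ m * b) * (β - α) ^ (k - m) * M := by
    intro x hx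
    have hR := contDiff_eval_toRef (-radauInterp k s (fun r => g (fromRef α β r))) α β m
    have hRe : (fun x => -Rh k s α β g x) = fun y =>
        (-radauInterp k s (fun r => g (fromRef α β r))).eval (toRef α β y) := by
      ext y; rw [Rh_eq, eval_neg]
    have h1 : iteratedDerivWithin m (fun x => -Rh k s α β g x) (Set.Icc α β) x =
        -((2 / (β - α)) ^ m *
        (derivative^[m] (radauInterp k s (fun r => g (fromRef α β r)))).eval (toRef α β x)) := by
      rw [hRe, iteratedDerivWithin_eq_iteratedDeriv (uniqueDiffOn_Icc h) hR.contDiffAt hx,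
        iteratedDeriv_eval_toRef]
      simp only [iterate_derivative_neg, eval_neg, mul_neg]
    rw [iteratedDerivWithin_fun_add hx (uniqueDiffOn_Icc h)
      ((hg.1 x hx).of_le (by exact_mod_cast hm))
      (by rw [hRe]; exact hR.contDiffAt.contDiffWithinAt), h1]
    have h2 := hb (fun r => g (fromRef α β r)) ((β - α) ^ k * M)
      (fun ρ hρ => hsup _ (fromRef_mem h.le ((radauNodes_spec k hs).2.1 ρ hρ))) _ (toRef_mem h hx)
    have h3 := hbound (k - m) (by omega) x hx
    rw [show k - (k - m) = m by omega] at h3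
    refine (abs_add_le _ _).trans ?_
    rw [abs_neg, abs_mul, abs_of_nonneg (by positivity : 0 ≤ (2 / (β - α)) ^ m)]
    calc _ ≤ (β - α) ^ (k - m) * M + (2 / (β - α)) ^ m * (b * ((β - α) ^ k * M)) :=
          add_le_add h3 (mul_le_mul_of_nonneg_left h2 (by positivity))
      _ = (β - α) ^ (k - m) * M +
          (2 / (β - α)) ^ m * (b * ((β - α) ^ m * (β - α) ^ (k - m) * M)) := by
          rw [← pow_add, show m + (k - m) = k by omega]
      _ = _ := by rw [div_pow]; field_simp
  rw [e]
  refine (seminormH_le_of_bound h.le (by positivity) hpt).trans (le_of_eq ?_)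
  rw [hM, show k + 1 - m = k - m + 1 by omega, pow_succ]
  linear_combination ((1 + 2 ^ m * b) * (β - α) ^ (k - m) * seminormH (k + 1) w α β) *
    Real.mul_self_sqrt hd.le

lemma isInterpConst_interpConst {k m : ℕ} (hm : m ≤ k) {s : SignType} (hs : s ≠ 0) :
    IsInterpConst k m s (interpConst k m s) := by
  have hcl : IsClosed {b : ℝ | IsInterpConst k m s b} := by
    simp only [IsInterpConst, Set.ofPred_and, Set.ofPred_forall]
    refine (isClosed_le (by fun_prop) (by fun_prop)).inter
      (isClosed_iInter fun _ => isClosed_iInter fun _ => isClosed_iInter fun _ =>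
        isClosed_iInter fun _ => isClosed_iInter fun _ => isClosed_le (by fun_prop) (by fun_prop))
  exact hcl.csInf_mem (exists_isInterpConst hm hs) ⟨0, fun b hb => hb.1⟩

/-! ### The exact solution -/

/-- The classical solution is constant along the characteristics. -/
lemma IsAdvectionSolution.eq_initial {a L T : ℝ} {u₀ : ℝ → ℝ} {u : ℝ → ℝ → ℝ}
    (hu : IsAdvectionSolution a L T u₀ u) {t : ℝ} (ht : t ∈ Set.Icc 0 T) (y : ℝ) :
    u y t = u₀ (y - a * t) := by
  rcases ht.1.eq_or_lt with rfl | ht0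
  · rw [hu.initial]; simp
  set f : ℝ → ℝ := fun τ => u (a * τ + (y - a * t)) τ with hf
  have hcont : ContinuousOn f (Set.Icc 0 t) := by
    refine hu.continuousOn.comp (f := fun τ : ℝ => (a * τ + (y - a * t), τ))
      (by fun_prop) fun τ hτ => ⟨trivial, hτ.1, hτ.2.trans ht.2⟩
  have hder : ∀ τ ∈ Set.Ioo 0 t, HasDerivAt f 0 τ := by
    intro τ hτ
    have hτT : τ ∈ Set.Ioo 0 T := ⟨hτ.1, hτ.2.trans_le ht.2⟩
    set z := a * τ + (y - a * t) with hz
    have hF := (hu.differentiable z τ hτT).hasFDerivAt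
    set F' := fderiv ℝ (fun z : ℝ × ℝ => u z.1 z.2) (z, τ)
    have h1 : HasDerivAt (fun τ' => u z τ') (F' (0, 1)) τ :=
      hF.comp_hasDerivAt (f := fun τ' : ℝ => (z, τ')) τ
        ((hasDerivAt_const τ z).prodMk (hasDerivAt_id τ))
    have h2 : HasDerivAt (fun z' => u z' τ) (F' (1, 0)) z :=
      hF.comp_hasDerivAt (f := fun z' : ℝ => (z', τ)) z
        ((hasDerivAt_id z).prodMk (hasDerivAt_const z τ))
    have hlin : HasDerivAt (fun τ' : ℝ => a * τ' + (y - a * t)) a τ := by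
      simpa using ((hasDerivAt_id τ).const_mul a).add_const (y - a * t)
    have h3 : HasDerivAt f (F' (a, 1)) τ :=
      hF.comp_hasDerivAt (f := fun τ' : ℝ => (a * τ' + (y - a * t), τ')) τ
        (hlin.prodMk (hasDerivAt_id τ))
    have heq := hu.equation z τ hτT
    rw [h1.deriv, h2.deriv] at heq
    have : F' (a, 1) = F' (0, 1) + a * F' (1, 0) := by
      rw [← smul_eq_mul, ← map_smul, ← map_add]; simp
    rwa [this, heq] at h3
  obtain ⟨τ, hτ, hslope⟩ := exists_hasDerivAt_eq_slope f (fun _ => 0) ht0 hcont hder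
  have h0 : f t = f 0 := by
    rw [eq_div_iff (by linarith)] at hslope; linarith
  have e1 : f t = u y t := by simp only [hf]; congr 1; ring
  have e2 : f 0 = u₀ (y - a * t) := by simp only [hf]; rw [hu.initial]; congr 1; ring
  rw [← e1, h0, e2]

/-! ### Local Sobolev regularity on the line -/

lemma contDiff_of_memSobolev {n : ℕ} {f : ℝ → ℝ}
    (hf : ∀ α β : ℝ, α < β → MemSobolev (n + 1) f α β) : ContDiff ℝ n f :=
  contDiff_iff_contDiffAt.2 fun x => (hf (x - 1) (x + 1) (by linarith)).1.contDiffAt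
    (Icc_mem_nhds (by linarith) (by linarith))

lemma memSobolev_succ_iff {n : ℕ} {f : ℝ → ℝ} (hf : ContDiff ℝ n f) {α β : ℝ} (h : α < β) :
    MemSobolev (n + 1) f α β ↔ AbsolutelyContinuousOnInterval (iteratedDeriv n f) α β ∧
      MemLp (iteratedDeriv (n + 1) f) 2 (volume.restrict (Set.Icc α β)) := by
  have e1 : ∀ x ∈ Set.uIcc α β, iteratedDerivWithin n f (Set.Icc α β) x = iteratedDeriv n f x := by
    intro x hx
    rw [Set.uIcc_of_le h.le] at hx
    exact iteratedDerivWithin_eq_iteratedDeriv (uniqueDiffOn_Icc h) hf.contDiffAt hx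
  have e2 : iteratedDerivWithin (n + 1) f (Set.Icc α β) =ᵐ[volume.restrict (Set.Icc α β)]
      iteratedDeriv (n + 1) f := by
    rw [← Measure.restrict_congr_set Ioo_ae_eq_Icc]
    exact (ae_restrict_iff' measurableSet_Ioo).2 (Filter.Eventually.of_forall fun x hx =>
      iteratedDerivWithin_Icc_eq_of_mem_Ioo _ _ hx)
  rw [MemSobolev, memLp_congr_ae e2]
  exact ⟨fun H => ⟨absolutelyContinuousOnInterval_congr e1 H.2.1, H.2.2⟩, fun H =>
    ⟨hf.contDiffOn, absolutelyContinuousOnInterval_congr (fun x hx => (e1 x hx).symm) H.1, H.2⟩⟩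

lemma memSobolev_deriv {n : ℕ} {f : ℝ → ℝ}
    (hf : ∀ α β : ℝ, α < β → MemSobolev (n + 2) f α β) {α β : ℝ} (h : α < β) :
    MemSobolev (n + 1) (deriv f) α β := by
  have hc := contDiff_of_memSobolev hf
  have := (memSobolev_succ_iff hc h).1 (hf α β h)
  rw [iteratedDeriv_succ', iteratedDeriv_succ'] at this
  exact (memSobolev_succ_iff (ContDiff.deriv' (by exact_mod_cast hc)) h).2 this

lemma memSobolev_of_succ {n : ℕ} {f : ℝ → ℝ}
    (hf : ∀ α β : ℝ, α < β → MemSobolev (n + 2) f α β) {α β : ℝ} (h : α < β) :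
    MemSobolev (n + 1) f α β := by
  have hc := contDiff_of_memSobolev hf
  refine (memSobolev_succ_iff (hc.of_le (by exact_mod_cast n.le_succ)) h).2 ⟨?_, ?_⟩
  · exact ((contDiff_nat_succ_iff_contDiff_one_iteratedDeriv.1
      (by exact_mod_cast hc)).2).contDiffOn.absolutelyContinuousOnInterval
  · exact memLp_of_continuousOn (hc.continuous_iteratedDeriv' (n + 1)).continuousOn

lemma memLp_comp_sub {f : ℝ → ℝ} {α β τ : ℝ}
    (hf : MemLp f 2 (volume.restrict (Set.Icc (α - τ) (β - τ)))) :
    MemLp (fun y => f (y - τ)) 2 (volume.restrict (Set.Icc α β)) := by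
  have := (measurePreserving_sub_right (volume : Measure ℝ) τ).restrict_preimage
    (s := Set.Icc (α - τ) (β - τ)) measurableSet_Icc
  have e : (fun x => x - τ) ⁻¹' Set.Icc (α - τ) (β - τ) = Set.Icc α β := by
    ext x; simp
  rw [e] at this
  exact hf.comp_measurePreserving this

lemma memSobolev_comp_sub {n : ℕ} {f : ℝ → ℝ}
    (hf : ∀ α β : ℝ, α < β → MemSobolev (n + 1) f α β) (τ : ℝ) {α β : ℝ} (h : α < β) :
    MemSobolev (n + 1) (fun y => f (y - τ)) α β := by
  have hc := contDiff_of_memSobolev hf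
  have H := (memSobolev_succ_iff hc (by linarith : α - τ < β - τ)).1 (hf _ _ (by linarith))
  have hc' : ContDiff ℝ n (fun y => f (y - τ)) := hc.comp (contDiff_id.sub contDiff_const)
  refine (memSobolev_succ_iff hc' h).2 ?_
  rw [iteratedDeriv_comp_sub_const, iteratedDeriv_comp_sub_const]
  refine ⟨?_, memLp_comp_sub H.2⟩
  have H1 := H.1
  rw [absolutelyContinuousOnInterval_iff] at *
  intro ε hε
  obtain ⟨δ, hδ, H'⟩ := H1 ε hε
  refine ⟨δ, hδ, fun E hE hlt => H' (E.1, fun i => ((E.2 i).1 - τ, (E.2 i).2 - τ)) ⟨?_, ?_⟩ ?_⟩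
  · intro i hi
    have := hE.1 i hi
    rw [Set.uIcc_of_le h.le] at this
    rw [Set.uIcc_of_le (by linarith)]
    simpa using this
  · intro i hi j hj hij
    have := hE.2 hi hj hij
    simp only [Function.onFun, Set.disjoint_left, Set.mem_uIoc] at this ⊢
    intro z hz1 hz2
    refine this (a := z + τ) ?_ ?_
    · rcases hz1 with hz | hz
      · exact Or.inl ⟨by linarith, by linarith⟩
      · exact Or.inr ⟨by linarith, by linarith⟩
    · rcases hz2 with hz | hz
      · exact Or.inl ⟨by linarith, by linarith⟩
      · exact Or.inr ⟨by linarith, by linarith⟩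
  · simpa using hlt

lemma memLp_iteratedDeriv_of_memSobolev {n : ℕ} {f : ℝ → ℝ}
    (hf : ∀ α β : ℝ, α < β → MemSobolev (n + 1) f α β) {α β : ℝ} (h : α < β) :
    MemLp (iteratedDeriv (n + 1) f) 2 (volume.restrict (Set.Icc α β)) :=
  ((memSobolev_succ_iff (contDiff_of_memSobolev hf) h).1 (hf α β h)).2

/-! ### Meshes -/

section Mesh

variable {N : ℕ}

lemma width_pos {x : Fin (N + 1) → ℝ} (hx : StrictMono x) (j : Fin N) : 0 < width x j :=
  sub_pos.2 (hx j.castSucc_lt_succ)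

lemma left_lt_right {x : Fin (N + 1) → ℝ} (hx : StrictMono x) (j : Fin N) :
    left x j < right x j := hx j.castSucc_lt_succ

lemma width_le_meshSize (x : Fin (N + 1) → ℝ) (j : Fin N) : width x j ≤ meshSize x :=
  le_ciSup (Set.finite_range (width x)).bddAbove j

lemma sum_integral_cells {f : ℝ → ℝ} (hf : ∀ α β, IntervalIntegrable f volume α β) :
    ∀ {N : ℕ} (x : Fin (N + 1) → ℝ),
      ∑ j, ∫ y in (left x j)..(right x j), f y = ∫ y in (x 0)..(x (Fin.last N)), f y := by
  intro N
  induction N with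
  | zero => intro x; simp
  | succ N ih =>
    intro x
    rw [Fin.sum_univ_castSucc]
    have := ih (fun i => x i.castSucc)
    simp only [left, right] at this ⊢
    rw [Fin.castSucc_zero] at this
    simp only [Fin.succ_castSucc] at this ⊢
    rw [this, intervalIntegral.integral_add_adjacent_intervals (hf _ _) (hf _ _)]
    simp [Fin.succ_last]

/-- Translation invariance of the Sobolev seminorm of a periodic function, summed over the mesh. -/
lemma sum_sq_seminormH_comp_sub {x : Fin (N + 1) → ℝ} (hx : StrictMono x) (m : ℕ) {f : ℝ → ℝ}
    (hper : Function.Periodic f (x (Fin.last N) - x 0))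
    (hf : ∀ α β : ℝ, α < β → MemLp (iteratedDeriv m f) 2 (volume.restrict (Set.Icc α β)))
    (τ : ℝ) :
    ∑ j, seminormH m (fun y => f (y - τ)) (left x j) (right x j) ^ 2 =
      seminormH m f (x 0) (x (Fin.last N)) ^ 2 := by
  have hle : x 0 ≤ x (Fin.last N) := hx.monotone (Fin.zero_le _)
  have hint : ∀ α β, IntervalIntegrable (fun y => iteratedDeriv m f y ^ 2) volume α β := by
    have : ∀ α β, α < β → IntervalIntegrable (fun y => iteratedDeriv m f y ^ 2) volume α β := by
      intro α β h
      rw [intervalIntegrable_iff_integrableOn_Icc_of_le h.le]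
      exact (hf α β h).integrable_sq
    intro α β
    rcases lt_trichotomy α β with h | rfl | h
    · exact this α β h
    · exact IntervalIntegrable.refl
    · exact (this β α h).symm
  have hint' : ∀ α β, IntervalIntegrable (fun y => iteratedDeriv m f (y - τ) ^ 2) volume α β := by
    intro α β
    have := (hint (α - τ) (β - τ)).comp_sub_right τ
    simpa using this
  have hp : Function.Periodic (fun y => iteratedDeriv m f y ^ 2) (x (Fin.last N) - x 0) := by
    intro y
    have h1 := congrFun (iteratedDeriv_comp_add_const m f (x (Fin.last N) - x 0)) y
    have h2 : (fun z => f (z + (x (Fin.last N) - x 0))) = f := funext hper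
    rw [h2] at h1
    simp only [h1]
  have e : ∀ j, seminormH m (fun y => f (y - τ)) (left x j) (right x j) ^ 2 =
      ∫ y in (left x j)..(right x j), iteratedDeriv m f (y - τ) ^ 2 := by
    intro j
    rw [seminormH_eq_iteratedDeriv (left_lt_right hx j).le, Real.sq_sqrt
      (intervalIntegral.integral_nonneg (left_lt_right hx j).le fun _ _ => sq_nonneg _),
      iteratedDeriv_comp_sub_const]
  rw [Finset.sum_congr rfl fun j _ => e j, sum_integral_cells hint',
    seminormH_eq_iteratedDeriv hle, Real.sq_sqrt
      (intervalIntegral.integral_nonneg hle fun _ _ => sq_nonneg _),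
    intervalIntegral.integral_comp_sub_right (fun y => iteratedDeriv m f y ^ 2)]
  have := hp.intervalIntegral_add_eq (x 0 - τ) (x 0)
  rw [show x 0 - τ + (x (Fin.last N) - x 0) = x (Fin.last N) - τ by ring,
    show x 0 + (x (Fin.last N) - x 0) = x (Fin.last N) by ring] at this
  exact this

/-- Cyclically neighbouring cells share a vertex, up to a period. -/
lemma apply_left_add_one [NeZero N] (x : Fin (N + 1) → ℝ) {g : ℝ → ℝ}
    (hg : Function.Periodic g (x (Fin.last N) - x 0)) (j : Fin N) :
    g (left x (j + 1)) = g (right x j) := by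
  obtain ⟨M, rfl⟩ : ∃ M, N = M + 1 := ⟨N - 1, by have := NeZero.pos N; omega⟩
  rcases Fin.eq_castSucc_or_eq_last j with ⟨i, rfl⟩ | rfl
  · rw [left, right, Fin.coeSucc_eq_succ, Fin.succ_castSucc]
  · rw [left, right, Fin.last_add_one, Fin.succ_last, Fin.castSucc_zero, ← hg (x 0)]
    congr 1; ring

lemma apply_right_sub_one [NeZero N] (x : Fin (N + 1) → ℝ) {g : ℝ → ℝ}
    (hg : Function.Periodic g (x (Fin.last N) - x 0)) (j : Fin N) :
    g (right x (j - 1)) = g (left x j) := by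
  have := apply_left_add_one x hg (j - 1)
  rw [sub_add_cancel] at this
  exact this.symm

end Mesh

/-! ### The scheme as a discontinuous Galerkin method -/

lemma nodalPoly_eq_interpolate {k : ℕ} (r V : Fin (k + 1) → ℝ) :
    nodalPoly r V = Lagrange.interpolate Finset.univ r V :=
  (Lagrange.interpolate_apply _ _ _).symm

lemma natDegree_nodalPoly_le {k : ℕ} {r : Fin (k + 1) → ℝ} (hr : Function.Injective r)
    (V : Fin (k + 1) → ℝ) : (nodalPoly r V).natDegree ≤ k := by
  rw [nodalPoly_eq_interpolate]
  have h := Lagrange.degree_interpolate_lt (s := Finset.univ) (v := r) V hr.injOn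
  rw [Finset.card_univ, Fintype.card_fin] at h
  rcases eq_or_ne (Lagrange.interpolate Finset.univ r V) 0 with h0 | h0
  · simp [h0]
  · exact Nat.lt_succ_iff.1 ((natDegree_lt_iff_degree_lt h0).2 h)

lemma nodalPoly_eq_of_eval {k : ℕ} {r : Fin (k + 1) → ℝ} (hr : Function.Injective r)
    {V : Fin (k + 1) → ℝ} {p : ℝ[X]} (hp : p.natDegree ≤ k) (h : ∀ i, p.eval (r i) = V i) :
    nodalPoly r V = p := by
  rw [nodalPoly_eq_interpolate]
  refine (Lagrange.eq_interpolate_of_eval_eq V hr.injOn ?_ fun i _ => h i).symm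
  rw [Finset.card_univ, Fintype.card_fin]
  exact lt_of_le_of_lt (natDegree_le_iff_degree_le.1 hp) (by exact_mod_cast Nat.lt_succ_self k)

lemma eval_nodalPoly {k : ℕ} {r : Fin (k + 1) → ℝ} (hr : Function.Injective r)
    (V : Fin (k + 1) → ℝ) (i : Fin (k + 1)) : (nodalPoly r V).eval (r i) = V i := by
  rw [nodalPoly_eq_interpolate]
  exact Lagrange.eval_interpolate_at_node V hr.injOn (Finset.mem_univ i)

lemma nodalPoly_mul {k : ℕ} (r V : Fin (k + 1) → ℝ) (b : ℝ) :
    nodalPoly r (fun m => b * V m) = C b * nodalPoly r V := by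
  simp only [nodalPoly, Finset.mul_sum, C_mul, mul_assoc]

section Mesh

variable {N : ℕ}

/-- The upwind discontinuous Galerkin form of `a ∂_x` on the cell `j`, with test function `w`, for
the piecewise polynomial `p` given on the reference element. -/
noncomputable def upwindForm [NeZero N] (a : ℝ) (p : Fin N → ℝ[X]) (j : Fin N) (w : ℝ[X]) : ℝ :=
  a * refIntegral (derivative (p j) * w)
    + (upwindFlux a ((p j).eval 1) ((p (j + 1)).eval (-1)) - a * (p j).eval 1) * w.eval 1
    - (upwindFlux a ((p (j - 1)).eval 1) ((p j).eval (-1)) - a * (p j).eval (-1)) * w.eval (-1)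

/-- In the modified inner product, the flux reconstruction scheme is the upwind discontinuous
Galerkin scheme. -/
lemma width_mul_modForm_fluxDerivative [NeZero N] {k : ℕ} (hk : 1 ≤ k) (a : ℝ) {c : ℝ}
    (hc : cMinus k < c) {r : Fin (k + 1) → ℝ} (hr : Function.Injective r)
    {x : Fin (N + 1) → ℝ} (hx : StrictMono x) (V : Fin N → Fin (k + 1) → ℝ) (j : Fin N)
    {w : ℝ[X]} (hw : w.natDegree ≤ k) :
    width x j / 2 * modForm k c (nodalPoly r (fluxDerivative a c r x V j)) w =
      upwindForm a (fun j => nodalPoly r (V j)) j w := by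
  have hwp := width_pos hx j
  set p := fun j => nodalPoly r (V j) with hp
  set A := upwindFlux a ((p (j - 1)).eval 1) ((p j).eval (-1)) - a * (p j).eval (-1) with hA
  set B := upwindFlux a ((p j).eval 1) ((p (j + 1)).eval (-1)) - a * (p j).eval 1 with hB
  have hfD : nodalPoly r (fun m => 2 / width x j * (a * V j m)) =
      C (2 / width x j * a) * p j := by
    rw [← nodalPoly_mul]; congr 1; ext m; ring
  have hD : nodalPoly r (fluxDerivative a c r x V j) =
      (2 / width x j) • (a • derivative (p j) + A • derivative (gL k c) +
        B • derivative (gR k c)) := by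
    refine nodalPoly_eq_of_eval hr ?_ fun i => ?_
    · have h1 := natDegree_derivative_le (p j)
      have h2 := natDegree_derivative_le (gL k c)
      have h3 := natDegree_derivative_le (gR k c)
      have h4 := natDegree_nodalPoly_le hr (V j)
      have h5 := natDegree_gL_le k c
      have h6 := natDegree_gR_le k c
      have h4' : (p j).natDegree ≤ k := h4
      refine (natDegree_smul_le _ _).trans (natDegree_add_le_of_degree_le
        (natDegree_add_le_of_degree_le ?_ ?_) ?_) <;>
      exact (natDegree_smul_le _ _).trans (by omega)
    · have h1 : ∑ m, 2 / width x j * (a * V j m) *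
          (Lagrange.basis Finset.univ r m).derivative.eval (r i) =
          2 / width x j * a * (derivative (p j)).eval (r i) := by
        have := congrArg (fun q => (derivative q).eval (r i)) hfD
        simp only [derivative_C_mul, eval_mul, eval_C] at this
        rw [← this, nodalPoly, derivative_sum, eval_finsetSum]
        simp only [derivative_C_mul, eval_mul, eval_C]
      simp only [fluxDerivative]
      rw [h1, hfD]
      simp only [eval_smul, eval_add, eval_mul, eval_C, smul_eq_mul]
      rw [hA, hB]
      ring
  rw [hD, map_smul, LinearMap.smul_apply, map_add, map_add, LinearMap.add_apply,
    LinearMap.add_apply, map_smul, map_smul, map_smul, LinearMap.smul_apply, LinearMap.smul_apply,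
    LinearMap.smul_apply, modForm_derivative_gL hk hc hw, modForm_derivative_gR hk hc hw,
    modForm_derivative_of_natDegree_le c (natDegree_nodalPoly_le hr (V j))]
  simp only [smul_eq_mul, upwindForm]
  field_simp
  ring

lemma upwindForm_sub [NeZero N] (a : ℝ) (p q : Fin N → ℝ[X]) (j : Fin N) (w : ℝ[X]) :
    upwindForm a (fun j => p j - q j) j w = upwindForm a p j w - upwindForm a q j w := by
  simp only [upwindForm, upwindFlux, sub_mul, map_sub, eval_sub]
  ring

/-- The upwind flux is dissipative: the form is `|a| / 2` times the sum of the squared jumps. -/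
lemma sum_upwindForm_self [NeZero N] (a : ℝ) (p : Fin N → ℝ[X]) :
    ∑ j, upwindForm a p j (p j) =
      ∑ j, |a| / 2 * ((p (j + 1)).eval (-1) - (p j).eval 1) ^ 2 := by
  have h1 : ∀ j, upwindForm a p j (p j) =
      (upwindFlux a ((p j).eval 1) ((p (j + 1)).eval (-1)) * (p j).eval 1 -
        a / 2 * (p j).eval 1 ^ 2) -
      (upwindFlux a ((p (j - 1)).eval 1) ((p j).eval (-1)) * (p j).eval (-1) -
        a / 2 * (p j).eval (-1) ^ 2) := by
    intro j
    have := refIntegral_derivative_mul (p j) (p j)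
    rw [mul_comm (p j) (derivative (p j))] at this
    rw [upwindForm]
    linear_combination (a / 2) * this
  rw [Finset.sum_congr rfl fun j _ => h1 j, Finset.sum_sub_distrib,
    ← Equiv.sum_comp (Equiv.addRight (1 : Fin N)) (fun j =>
      upwindFlux a ((p (j - 1)).eval 1) ((p j).eval (-1)) * (p j).eval (-1) -
        a / 2 * (p j).eval (-1) ^ 2), ← Finset.sum_sub_distrib]
  refine Finset.sum_congr rfl fun j _ => ?_
  simp only [Equiv.coe_addRight, add_sub_cancel_right, upwindFlux]
  ring

lemma sum_upwindForm_self_nonneg [NeZero N] (a : ℝ) (p : Fin N → ℝ[X]) :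
    0 ≤ ∑ j, upwindForm a p j (p j) := by
  rw [sum_upwindForm_self]
  exact Finset.sum_nonneg fun j _ => by positivity

/-- The Gauss-Radau interpolant, cell by cell on the reference element. -/
noncomputable def meshInterp (k : ℕ) (s : SignType) (x : Fin (N + 1) → ℝ) (g : ℝ → ℝ)
    (j : Fin N) : ℝ[X] :=
  radauInterp k s (fun ρ => g (fromRef (left x j) (right x j) ρ))

lemma fromRef_one (α β : ℝ) : fromRef α β 1 = β := by rw [fromRef]; ring

lemma fromRef_neg_one (α β : ℝ) : fromRef α β (-1) = α := by rw [fromRef]; ring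

/-- The upwind flux only sees the ends of the cells at which the Gauss-Radau interpolant is
exact. -/
lemma upwindFlux_meshInterp [NeZero N] (k : ℕ) {a : ℝ} (ha : a ≠ 0) (x : Fin (N + 1) → ℝ)
    {g : ℝ → ℝ} (hg : Function.Periodic g (x (Fin.last N) - x 0)) (j : Fin N) :
    upwindFlux a ((meshInterp k (SignType.sign a) x g j).eval 1)
      ((meshInterp k (SignType.sign a) x g (j + 1)).eval (-1)) = a * g (right x j) := by
  have hmem := (radauNodes_spec k (sign_ne_zero.2 ha)).2.2
  rcases lt_or_gt_of_ne ha with h | h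
  · have h1 := eval_radauInterp (fun ρ => g (fromRef (left x (j + 1)) (right x (j + 1)) ρ)) hmem
    rw [sign_neg h] at h1 ⊢
    rw [SignType.coe_neg_one, fromRef_neg_one, apply_left_add_one x hg] at h1
    rw [upwindFlux, abs_of_neg h, meshInterp, meshInterp, h1]
    ring
  · have h1 := eval_radauInterp (fun ρ => g (fromRef (left x j) (right x j) ρ)) hmem
    rw [sign_pos h] at h1 ⊢
    rw [SignType.coe_one, fromRef_one] at h1
    rw [upwindFlux, abs_of_pos h, meshInterp, meshInterp, h1]
    ring

/-- Consistency: on the interpolant of a smooth periodic function `g` the upwind form is that of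
`a g'`, up to the defect of orthogonality of the interpolation error. -/
lemma upwindForm_meshInterp [NeZero N] (k : ℕ) {a : ℝ} (ha : a ≠ 0) {x : Fin (N + 1) → ℝ}
    {g : ℝ → ℝ} (hg : Function.Periodic g (x (Fin.last N) - x 0))
    (hgc : ContDiff ℝ 1 g) (j : Fin N) (w : ℝ[X]) :
    upwindForm a (meshInterp k (SignType.sign a) x g) j w =
      a * (width x j / 2) *
        (∫ r in (-1 : ℝ)..1, deriv g (fromRef (left x j) (right x j) r) * w.eval r) +
      a * ∫ r in (-1 : ℝ)..1, (g (fromRef (left x j) (right x j) r) -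
        (meshInterp k (SignType.sign a) x g j).eval r) * (derivative w).eval r := by
  have hL := upwindFlux_meshInterp k ha x hg (j - 1)
  rw [sub_add_cancel, apply_right_sub_one x hg] at hL
  have hR := upwindFlux_meshInterp k ha x hg j
  set P := meshInterp k (SignType.sign a) x g
  have hF : Continuous (fun r => fromRef (left x j) (right x j) r) := by
    simp only [fromRef_eq]; fun_prop
  have hd : ∀ r, HasDerivAt (fun r => g (fromRef (left x j) (right x j) r))
      (deriv g (fromRef (left x j) (right x j) r) * (width x j / 2)) r := by
    intro r
    have h1 : HasDerivAt (fun r => fromRef (left x j) (right x j) r) (width x j / 2) r := by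
      simp only [fromRef_eq]
      simpa [width] using ((hasDerivAt_id r).const_mul ((right x j - left x j) / 2)).add_const
        ((left x j + right x j) / 2)
    exact ((hgc.differentiable one_ne_zero).differentiableAt.hasDerivAt).comp r h1
  have hcd : Continuous (fun r => deriv g (fromRef (left x j) (right x j) r)) :=
    (hgc.continuous_deriv le_rfl).comp hF
  have hcg : Continuous (fun r => g (fromRef (left x j) (right x j) r)) := hgc.continuous.comp hF
  have hc1 : Continuous (fun r => deriv g (fromRef (left x j) (right x j) r) *
      (width x j / 2) * w.eval r) := (hcd.mul continuous_const).mul w.continuous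
  have hc2 : Continuous (fun r => g (fromRef (left x j) (right x j) r) * (derivative w).eval r) :=
    hcg.mul (derivative w).continuous
  have hparts := intervalIntegral.integral_deriv_mul_eq_sub (a := -1) (b := 1)
    (u := fun r => g (fromRef (left x j) (right x j) r)) (v := fun r => w.eval r)
    (fun r _ => hd r) (fun r _ => w.hasDerivAt r)
    ((hcd.mul continuous_const).intervalIntegrable _ _)
    ((derivative w).continuous.intervalIntegrable _ _)
  rw [fromRef_one, fromRef_neg_one, intervalIntegral.integral_add
    (hc1.intervalIntegrable _ _) (hc2.intervalIntegrable _ _)] at hparts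
  have e1 : ∫ r in (-1 : ℝ)..1, deriv g (fromRef (left x j) (right x j) r) * (width x j / 2) *
      w.eval r = width x j / 2 *
        ∫ r in (-1 : ℝ)..1, deriv g (fromRef (left x j) (right x j) r) * w.eval r := by
    rw [← intervalIntegral.integral_const_mul]
    exact intervalIntegral.integral_congr fun r _ => by ring
  have e2 : ∫ r in (-1 : ℝ)..1, (g (fromRef (left x j) (right x j) r) - (P j).eval r) *
      (derivative w).eval r =
      (∫ r in (-1 : ℝ)..1, g (fromRef (left x j) (right x j) r) * (derivative w).eval r) -
        refIntegral (P j * derivative w) := by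
    rw [refIntegral_apply, ← intervalIntegral.integral_sub
      (hc2.intervalIntegrable _ _)
      ((P j * derivative w).continuous.intervalIntegrable _ _)]
    refine intervalIntegral.integral_congr fun r _ => ?_
    simp only [eval_mul]; ring
  rw [e1] at hparts
  rw [e2, upwindForm, hL, hR, refIntegral_derivative_mul]
  linear_combination (-a) * hparts

/-! ### The energy identity -/

lemma hasDerivWithinAt_modForm_nodalPoly {k : ℕ} (c : ℝ) (r : Fin (k + 1) → ℝ)
    {V : ℝ → Fin (k + 1) → ℝ} {V' : Fin (k + 1) → ℝ} {S : Set ℝ} {t : ℝ}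
    (hV : ∀ i, HasDerivWithinAt (fun τ => V τ i) (V' i) S t) :
    HasDerivWithinAt (fun τ => modForm k c (nodalPoly r (V τ)) (nodalPoly r (V τ)))
      (2 * modForm k c (nodalPoly r V') (nodalPoly r (V t))) S t := by
  have e : ∀ V W : Fin (k + 1) → ℝ, modForm k c (nodalPoly r V) (nodalPoly r W) =
      ∑ i, ∑ m, V i * W m * modForm k c (Lagrange.basis Finset.univ r i)
        (Lagrange.basis Finset.univ r m) := by
    intro V W
    simp only [nodalPoly, ← smul_eq_C_mul, map_sum, map_smul, LinearMap.sum_apply,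
      LinearMap.smul_apply, smul_eq_mul, Finset.mul_sum]
    rw [Finset.sum_comm]
    exact Finset.sum_congr rfl fun i _ => Finset.sum_congr rfl fun m _ => by ring
  have h : HasDerivWithinAt (fun τ => ∑ i, ∑ m, V τ i * V τ m *
      modForm k c (Lagrange.basis Finset.univ r i) (Lagrange.basis Finset.univ r m))
      (∑ i, ∑ m, (V' i * V t m + V t i * V' m) *
        modForm k c (Lagrange.basis Finset.univ r i) (Lagrange.basis Finset.univ r m)) S t :=
    HasDerivWithinAt.fun_sum fun i _ => HasDerivWithinAt.fun_sum fun m _ =>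
      ((hV i).fun_mul (hV m)).mul_const _
  simp only [e]
  convert h using 1
  have e3 : ∑ i, ∑ m, V t i * V' m * modForm k c (Lagrange.basis Finset.univ r i)
      (Lagrange.basis Finset.univ r m) = ∑ i, ∑ m, V' i * V t m *
        modForm k c (Lagrange.basis Finset.univ r i) (Lagrange.basis Finset.univ r m) := by
    rw [← e, ← e, modForm_symm]
  simp only [add_mul, Finset.sum_add_distrib, e3]
  ring

/-- A differential inequality `E' ≤ 2 B √E` bounds the growth of `√E`. The square root is
regularized, since `E` may vanish. -/
lemma sqrt_le_of_deriv_le {E E' : ℝ → ℝ} {B T : ℝ} (hT : 0 ≤ T) (hB : 0 ≤ B)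
    (hE : ∀ t ∈ Set.Icc 0 T, HasDerivWithinAt E (E' t) (Set.Icc 0 T) t)
    (hE0 : ∀ t, 0 ≤ E t) (hle : ∀ t ∈ Set.Icc 0 T, E' t ≤ 2 * B * √(E t)) :
    √(E T) ≤ √(E 0) + B * T := by
  refine le_of_forall_pos_le_add fun ε hε => ?_
  have hpos : ∀ t, 0 < E t + ε ^ 2 := fun t => by have := hE0 t; positivity
  have hcont : ContinuousOn E (Set.Icc 0 T) := fun t ht => (hE t ht).continuousWithinAt
  have hanti : AntitoneOn (fun t => √(E t + ε ^ 2) - B * t) (Set.Icc 0 T) := by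
    refine antitoneOn_of_hasDerivWithinAt_nonpos
      (f' := fun t => E' t / (2 * √(E t + ε ^ 2)) - B * 1) (convex_Icc 0 T)
      (by fun_prop) ?_ ?_
    · intro t ht
      have h1 := (hE t (interior_subset ht)).mono (interior_subset (s := Set.Icc 0 T))
      exact ((h1.add_const (ε ^ 2)).sqrt (hpos t).ne').sub
        ((hasDerivWithinAt_id t _).const_mul B)
    · intro t ht
      have h1 := hle t (interior_subset ht)
      have h2 : √(E t) ≤ √(E t + ε ^ 2) := Real.sqrt_le_sqrt (by nlinarith)
      have h3 := Real.sqrt_pos.2 (hpos t)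
      rw [sub_nonpos, mul_one, div_le_iff₀ (by positivity)]
      nlinarith [mul_le_mul_of_nonneg_left h2 hB]
  have h1 := hanti (Set.left_mem_Icc.2 hT) (Set.right_mem_Icc.2 hT) hT
  have h2 : √(E T) ≤ √(E T + ε ^ 2) := Real.sqrt_le_sqrt (by nlinarith)
  have h3 : √(E 0 + ε ^ 2) ≤ √(E 0) + ε := by
    have := Real.sqrt_nonneg (E 0)
    rw [Real.sqrt_le_left (by positivity)]
    nlinarith [Real.sq_sqrt (hE0 0)]
  simp only at h1
  linarith

end Mesh

/-! ### Error terms on one cell -/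

lemma abs_refIntegral_mul_le (p q : ℝ[X]) :
    |refIntegral (p * q)| ≤ √(refIntegral (p * p)) * √(refIntegral (q * q)) := by
  rw [← Real.sqrt_mul (refIntegral_mul_self_nonneg p), ← Real.sqrt_sq_eq_abs]
  exact Real.sqrt_le_sqrt (refIntegral_mul_sq_le p q)

lemma integral_sq_eval_toRef {α β : ℝ} (h : α < β) (p : ℝ[X]) :
    ∫ y in α..β, (p.eval (toRef α β y)) ^ 2 = (β - α) / 2 * refIntegral (p * p) := by
  rw [integral_eq_refElement, refIntegral_mul_self]
  simp only [toRef_fromRef h]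

lemma seminormH_eval_toRef {α β : ℝ} (h : α < β) (m : ℕ) (p : ℝ[X]) :
    seminormH m (fun y => p.eval (toRef α β y)) α β =
      (2 / (β - α)) ^ m *
        √((β - α) / 2 * refIntegral (derivative^[m] p * derivative^[m] p)) := by
  have hd : 0 < β - α := by linarith
  rw [seminormH_eq_iteratedDeriv h.le, iteratedDeriv_eval_toRef]
  simp only [mul_pow]
  rw [intervalIntegral.integral_const_mul, integral_sq_eval_toRef h, Real.sqrt_mul (by positivity),
    Real.sqrt_sq (by positivity)]

lemma sqrt_integral_add_sq_le {α β : ℝ} (h : α ≤ β) {f g : ℝ → ℝ}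
    (hf : MemLp f 2 (volume.restrict (Set.Icc α β)))
    (hg : MemLp g 2 (volume.restrict (Set.Icc α β))) :
    √(∫ x in α..β, (f x + g x) ^ 2) ≤ √(∫ x in α..β, f x ^ 2) + √(∫ x in α..β, g x ^ 2) := by
  rw [intervalIntegral_eq_setIntegral_Icc h, intervalIntegral_eq_setIntegral_Icc h,
    intervalIntegral_eq_setIntegral_Icc h]
  have hfg : Integrable (fun x => f x * g x) (volume.restrict (Set.Icc α β)) :=
    hf.integrable_mul hg
  have i1 := hfg.const_mul 2
  have e : ∫ x in Set.Icc α β, (f x + g x) ^ 2 = (∫ x in Set.Icc α β, f x ^ 2) +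
      2 * (∫ x in Set.Icc α β, f x * g x) + ∫ x in Set.Icc α β, g x ^ 2 := by
    rw [← integral_const_mul, ← integral_add hf.integrable_sq i1,
      ← integral_add (f := fun x => f x ^ 2 + 2 * (f x * g x)) (hf.integrable_sq.add i1)
        hg.integrable_sq]
    exact integral_congr_ae (Filter.Eventually.of_forall fun x => by ring)
  have hf0 : 0 ≤ ∫ x in Set.Icc α β, f x ^ 2 := integral_nonneg fun _ => sq_nonneg _
  have hg0 : 0 ≤ ∫ x in Set.Icc α β, g x ^ 2 := integral_nonneg fun _ => sq_nonneg _
  have hcs := Real.abs_le_sqrt (sq_setIntegral_mul_le hf hg)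
  rw [Real.sqrt_mul hf0] at hcs
  rw [Real.sqrt_le_left (by positivity), e, add_sq, Real.sq_sqrt hf0, Real.sq_sqrt hg0]
  have := (le_abs_self _).trans hcs
  linarith

lemma abs_half_width_mul_integral_le {k : ℕ} (hk : 1 ≤ k) {s : SignType} (hs : s ≠ 0) {α β : ℝ}
    (h : α < β) {v : ℝ → ℝ} (hv : MemSobolev (k + 1) v α β) (e : ℝ[X]) :
    |(β - α) / 2 * ∫ r in (-1 : ℝ)..1, (v (fromRef α β r) -
        (radauInterp k s (fun r => v (fromRef α β r))).eval r) * e.eval r| ≤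
      √2 * (1 + lebesgueConst k s) * brambleHilbertConst k * (β - α) ^ (k + 1) *
        seminormH (k + 1) v α β * √((β - α) / 2 * refIntegral (e * e)) := by
  have hd : 0 < β - α := by linarith
  have hL := lebesgueConst_nonneg k s
  have hζ := (isBrambleHilbertConst_brambleHilbertConst k).1
  have hA := avgSeminorm_nonneg (k + 1) v α β
  have h1 := abs_refIntegral_le (by positivity)
    ((continuousOn_comp_fromRef h hv.1.continuousOn).sub (Polynomial.continuous _).continuousOn)
    (fun r hr => abs_sub_radauInterp_le_brambleHilbert hk hs h hv hr) e
  rw [abs_mul, abs_of_pos (by positivity : 0 < (β - α) / 2)]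
  refine (mul_le_mul_of_nonneg_left h1 (by positivity)).trans (le_of_eq ?_)
  rw [← sqrt_mul_avgSeminorm h, Real.sqrt_mul (by positivity : 0 ≤ (β - α) / 2),
    Real.sqrt_div hd.le]
  have h2 := Real.mul_self_sqrt hd.le
  have h3 := Real.mul_self_sqrt (zero_le_two (α := ℝ))
  have h4 : √2 ≠ 0 := by positivity
  field_simp
  have h5 : √2 ^ 2 = 2 := by rw [sq, h3]
  have h6 : √(β - α) ^ 2 = β - α := by rw [sq, h2]
  rw [h5, h6]
  ring

lemma abs_integral_mul_derivative_le {k : ℕ} (hk : 1 ≤ k) {s : SignType} (hs : s ≠ 0) {α β : ℝ}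
    (h : α < β) {g : ℝ → ℝ} (hg : MemSobolev (k + 2) g α β) {e : ℝ[X]} (he : e.natDegree ≤ k) :
    |∫ r in (-1 : ℝ)..1, (g (fromRef α β r) -
        (radauInterp k s (fun r => g (fromRef α β r))).eval r) * (derivative e).eval r| ≤
      2 * √2 * (1 + lebesgueConst k s) * brambleHilbertConst (k + 1) * √(markovConst k) *
        (β - α) ^ (k + 1) * seminormH (k + 2) g α β * √((β - α) / 2 * refIntegral (e * e)) := by
  have hd : 0 < β - α := by linarith
  have hL := lebesgueConst_nonneg k s
  have hζ := (isBrambleHilbertConst_brambleHilbertConst (k + 1)).1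
  have hA := avgSeminorm_nonneg (k + 2) g α β
  have hψ : derivative^[k] (derivative e) = 0 := by
    rw [← Function.iterate_succ_apply]
    exact iterate_derivative_eq_zero (Nat.lt_succ_of_le he)
  have h1 := abs_integral_sub_radauInterp_mul_le hk hs h hg hψ
  have h2 : √(refIntegral (derivative e * derivative e)) ≤
      √(markovConst k) * √(refIntegral (e * e)) := by
    rw [← Real.sqrt_mul (isMarkovConst_markovConst k).1]
    exact Real.sqrt_le_sqrt (refIntegral_derivative_mul_self_le he)
  refine h1.trans ((mul_le_mul_of_nonneg_left (mul_le_mul_of_nonneg_left h2 (by positivity))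
    (by positivity)).trans (le_of_eq ?_))
  rw [← sqrt_mul_avgSeminorm h, Real.sqrt_mul (by positivity : 0 ≤ (β - α) / 2),
    Real.sqrt_div hd.le]
  have h4 : √2 ≠ 0 := by positivity
  have h5 : √2 ^ 2 = 2 := Real.sq_sqrt zero_le_two
  have h6 : √(β - α) ^ 2 = β - α := Real.sq_sqrt hd.le
  field_simp
  rw [h5, h6]
  ring

/-- The part of the modified inner product with the `k`-th derivatives: the inverse inequalities
for the test function, stability of the interpolation for the other factor. -/
lemma abs_half_width_mul_refIntegral_iterate_le {k : ℕ} {s : SignType} (hs : s ≠ 0)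
    {α β : ℝ} (h : α < β) {v : ℝ → ℝ} (hv : MemSobolev (k + 1) v α β) {e : ℝ[X]}
    (he : e.natDegree ≤ k) :
    |(β - α) / 2 * refIntegral (derivative^[k] (radauInterp k s (fun r => v (fromRef α β r))) *
        derivative^[k] e)| ≤
      (1 / 2) ^ k * √(∏ m ∈ Finset.Icc 1 k, markovConst m) *
        ((β - α) ^ k * seminormH k v α β +
          interpConst k k s * (β - α) ^ (k + 1) * seminormH (k + 1) v α β) *
        √((β - α) / 2 * refIntegral (e * e)) := by
  have hd : 0 < β - α := by linarith
  set q := radauInterp k s (fun r => v (fromRef α β r)) with hq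
  have hcs := abs_refIntegral_mul_le (derivative^[k] q) (derivative^[k] e)
  have hPn : 0 ≤ ∏ m ∈ Finset.Icc 1 k, markovConst m :=
    Finset.prod_nonneg fun m _ => (isMarkovConst_markovConst m).1
  have hM : √(refIntegral (derivative^[k] e * derivative^[k] e)) ≤
      √(∏ m ∈ Finset.Icc 1 k, markovConst m) * √(refIntegral (e * e)) := by
    rw [← Real.sqrt_mul hPn]
    exact Real.sqrt_le_sqrt (refIntegral_iterate_derivative_mul_self_le he)
  have hR : Rh k s α β v = fun y => q.eval (toRef α β y) := rfl
  have hI := (isInterpConst_interpConst (le_refl k) hs).2 α β h v hv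
  rw [show k + 1 - k = 1 by omega, pow_one] at hI
  have htri : seminormH k (Rh k s α β v) α β ≤ seminormH k v α β +
      seminormH k (fun x => v x - Rh k s α β v x) α β := by
    have hRc := contDiff_eval_toRef q α β k
    have hu := uniqueDiffOn_Icc h
    have hvc : ContDiffOn ℝ k v (Set.Icc α β) := hv.1
    have hdc : ContDiffOn ℝ k (fun x => v x - Rh k s α β v x) (Set.Icc α β) :=
      hvc.sub (by rw [hR]; exact hRc.contDiffOn)
    have h1 := sqrt_integral_add_sq_le h.le
      (memLp_of_continuousOn (hvc.continuousOn_iteratedDerivWithin le_rfl hu))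
      (memLp_of_continuousOn (hdc.continuousOn_iteratedDerivWithin le_rfl hu)).neg
    simp only [Pi.neg_apply, neg_sq] at h1
    refine le_trans (le_of_eq ?_) h1
    rw [seminormH]
    congr 1
    refine intervalIntegral.integral_congr fun x hx => ?_
    rw [Set.uIcc_of_le h.le] at hx
    have : iteratedDerivWithin k (fun x => v x - Rh k s α β v x) (Set.Icc α β) x =
        iteratedDerivWithin k v (Set.Icc α β) x -
          iteratedDerivWithin k (Rh k s α β v) (Set.Icc α β) x :=
      iteratedDerivWithin_sub hx hu (hvc x hx)
        (by rw [hR]; exact hRc.contDiffAt.contDiffWithinAt)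
    simp only [this]
    ring
  have hS : √((β - α) / 2 * refIntegral (derivative^[k] q * derivative^[k] q)) ≤
      ((β - α) / 2) ^ k * (seminormH k v α β +
        interpConst k k s * (β - α) * seminormH (k + 1) v α β) := by
    have e1 : √((β - α) / 2 * refIntegral (derivative^[k] q * derivative^[k] q)) =
        ((β - α) / 2) ^ k * seminormH k (Rh k s α β v) α β := by
      rw [hR, seminormH_eval_toRef h, ← mul_assoc, ← mul_pow]
      have : (β - α) / 2 * (2 / (β - α)) = 1 := by field_simp
      rw [this, one_pow, one_mul]
    rw [e1]
    exact mul_le_mul_of_nonneg_left (htri.trans (by linarith)) (by positivity)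
  rw [abs_mul, abs_of_pos (by positivity : 0 < (β - α) / 2)]
  have hh : 0 ≤ (β - α) / 2 := by positivity
  calc _ ≤ (β - α) / 2 * (√(refIntegral (derivative^[k] q * derivative^[k] q)) *
        (√(∏ m ∈ Finset.Icc 1 k, markovConst m) * √(refIntegral (e * e)))) := by
        gcongr
        exact hcs.trans (mul_le_mul_of_nonneg_left hM (Real.sqrt_nonneg _))
    _ = √((β - α) / 2 * refIntegral (derivative^[k] q * derivative^[k] q)) *
        (√(∏ m ∈ Finset.Icc 1 k, markovConst m) * √((β - α) / 2 * refIntegral (e * e))) := by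
        rw [Real.sqrt_mul hh, Real.sqrt_mul hh]
        linear_combination (-√(refIntegral (derivative^[k] q * derivative^[k] q)) *
          √(∏ m ∈ Finset.Icc 1 k, markovConst m) * √(refIntegral (e * e))) *
            Real.mul_self_sqrt hh
    _ ≤ (((β - α) / 2) ^ k * (seminormH k v α β +
          interpConst k k s * (β - α) * seminormH (k + 1) v α β)) *
        (√(∏ m ∈ Finset.Icc 1 k, markovConst m) * √((β - α) / 2 * refIntegral (e * e))) :=
        mul_le_mul_of_nonneg_right hS (by positivity)
    _ = _ := by rw [div_eq_mul_one_div (β - α) 2, mul_pow]; ring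

/-! ### Growth of the energy of the discrete error -/

section Mesh

variable {N : ℕ}

/-- The `L²(Ω)` norm of a piecewise polynomial given on the reference element. -/
noncomputable def polyNorm (x : Fin (N + 1) → ℝ) (e : Fin N → ℝ[X]) : ℝ :=
  √(∑ j, width x j / 2 * refIntegral (e j * e j))

/-- The coefficient of `Δx^{k+1} |u₀|_{H^{k+2}}` in the rate of growth of the error. -/
noncomputable def rateHigh (k : ℕ) (a c : ℝ) : ℝ :=
  |a| * (2 * brambleHilbertConst k + 4 * brambleHilbertConst (k + 1) * √(markovConst k)) *
      (1 + lebesgueConst k (SignType.sign a)) +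
    |c| * interpConst k k (SignType.sign a) * (1 / 2) ^ k *
      √(∏ m ∈ Finset.Icc 1 k, markovConst m) * |a| / 2

/-- The coefficient of `Δx^k |u₀|_{H^{k+1}}` in the rate of growth of the error. -/
noncomputable def rateLow (k : ℕ) (a c : ℝ) : ℝ :=
  |c| * (1 / 2) ^ k * √(∏ m ∈ Finset.Icc 1 k, markovConst m) * |a| / 2

lemma rateHigh_nonneg (k : ℕ) {a : ℝ} (ha : a ≠ 0) (c : ℝ) : 0 ≤ rateHigh k a c := by
  have h1 := (isBrambleHilbertConst_brambleHilbertConst k).1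
  have h2 := (isBrambleHilbertConst_brambleHilbertConst (k + 1)).1
  have h3 := lebesgueConst_nonneg k (SignType.sign a)
  have h4 := (isInterpConst_interpConst (le_refl k) (sign_ne_zero.2 ha)).1
  unfold rateHigh; positivity

lemma rateLow_nonneg (k : ℕ) (a c : ℝ) : 0 ≤ rateLow k a c := by
  unfold rateLow; positivity

/-- Half the time derivative of the energy of the discrete error on the cell `j`, up to the
dissipation of the upwind flux. The nodal values of the time derivative of the discrete error are
those of the interpolant of `∂_t u = -a ∂_x u` plus the derivative of the reconstructed flux. -/
lemma energy_rate_cell_le [NeZero N] {k : ℕ} (hk : 1 ≤ k) {a : ℝ} (ha : a ≠ 0) {c : ℝ}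
    (hc : cMinus k < c) {r : Fin (k + 1) → ℝ} (hr : Function.Injective r)
    {x : Fin (N + 1) → ℝ} (hx : StrictMono x) (V : Fin N → Fin (k + 1) → ℝ) {g : ℝ → ℝ}
    (hg : Function.Periodic g (x (Fin.last N) - x 0))
    (hgs : ∀ α β : ℝ, α < β → MemSobolev (k + 2) g α β) (j : Fin N) :
    width x j / 2 * modForm k c
        (nodalPoly r (fun i => -a * (meshInterp k (SignType.sign a) x (deriv g) j).eval (r i) +
          fluxDerivative a c r x V j i))
        (meshInterp k (SignType.sign a) x g j - nodalPoly r (V j)) +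
      upwindForm a (fun j => meshInterp k (SignType.sign a) x g j - nodalPoly r (V j)) j
        (meshInterp k (SignType.sign a) x g j - nodalPoly r (V j)) ≤
    (rateHigh k a c * meshSize x ^ (k + 1) * seminormH (k + 2) g (left x j) (right x j) +
      rateLow k a c * meshSize x ^ k * seminormH (k + 1) g (left x j) (right x j)) *
      √(width x j / 2 * refIntegral
        ((meshInterp k (SignType.sign a) x g j - nodalPoly r (V j)) *
          (meshInterp k (SignType.sign a) x g j - nodalPoly r (V j)))) := by
  have hs := sign_ne_zero.2 ha
  have hlr := left_lt_right hx j
  have hwp := width_pos hx j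
  have hwm := width_le_meshSize x j
  set s := SignType.sign a
  set e := meshInterp k s x g j - nodalPoly r (V j) with he
  set Q := meshInterp k s x (deriv g) j with hQ
  have hedeg : e.natDegree ≤ k :=
    (natDegree_sub_le_iff_left (natDegree_nodalPoly_le hr (V j))).2
      (natDegree_radauInterp_le k hs _)
  have hgc : ContDiff ℝ (k + 1 : ℕ) g := contDiff_of_memSobolev hgs
  have hgc1 : ContDiff ℝ 1 g := hgc.of_le (by exact_mod_cast (by omega : 1 ≤ k + 1))
  have hvs := memSobolev_deriv hgs hlr
  have hpoly : nodalPoly r (fun i => -a * Q.eval (r i) + fluxDerivative a c r x V j i) =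
      (-a) • Q + nodalPoly r (fluxDerivative a c r x V j) := by
    refine nodalPoly_eq_of_eval hr (natDegree_add_le_of_degree_le
      ((natDegree_smul_le _ _).trans (natDegree_radauInterp_le k hs _))
      (natDegree_nodalPoly_le hr _)) fun i => ?_
    rw [eval_add, eval_smul, eval_nodalPoly hr, smul_eq_mul]
  have hscheme := width_mul_modForm_fluxDerivative hk a hc hr hx V j hedeg
  have hsub := upwindForm_sub a (meshInterp k s x g) (fun j => nodalPoly r (V j)) j e
  have hcons := upwindForm_meshInterp k ha hg hgc1 j e
  have hF : Continuous (fun r => fromRef (left x j) (right x j) r) := by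
    simp only [fromRef_eq]; fun_prop
  have hcd : Continuous (fun r => deriv g (fromRef (left x j) (right x j) r)) :=
    (hgc1.continuous_deriv le_rfl).comp hF
  have hsplit : ∫ r in (-1 : ℝ)..1,
      (deriv g (fromRef (left x j) (right x j) r) - Q.eval r) * e.eval r =
      (∫ r in (-1 : ℝ)..1, deriv g (fromRef (left x j) (right x j) r) * e.eval r) -
        refIntegral (Q * e) := by
    have hc1 : Continuous (fun r => deriv g (fromRef (left x j) (right x j) r) * e.eval r) :=
      hcd.mul e.continuous
    rw [refIntegral_apply, ← intervalIntegral.integral_sub (hc1.intervalIntegrable _ _)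
      ((Q * e).continuous.intervalIntegrable _ _)]
    refine intervalIntegral.integral_congr fun r _ => ?_
    simp only [eval_mul]; ring
  have hT1 := abs_half_width_mul_integral_le hk hs hlr hvs e
  have hT2 := abs_integral_mul_derivative_le hk hs hlr (hgs _ _ hlr) hedeg
  have hT3 := abs_half_width_mul_refIntegral_iterate_le hs hlr hvs hedeg
  have hsem : ∀ m, seminormH m (deriv g) (left x j) (right x j) =
      seminormH (m + 1) g (left x j) (right x j) := fun m => by
    rw [seminormH_eq_iteratedDeriv hlr.le, seminormH_eq_iteratedDeriv hlr.le, iteratedDeriv_succ']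
  rw [hsem] at hT1
  rw [hsem, hsem] at hT3
  change |width x j / 2 * ∫ r in (-1 : ℝ)..1,
    (deriv g (fromRef (left x j) (right x j) r) - Q.eval r) * e.eval r| ≤
    _ * width x j ^ (k + 1) * _ * √(width x j / 2 * _) at hT1
  change |∫ r in (-1 : ℝ)..1, (g (fromRef (left x j) (right x j) r) -
    (meshInterp k s x g j).eval r) * (derivative e).eval r| ≤
    _ * width x j ^ (k + 1) * _ * √(width x j / 2 * _) at hT2
  change |width x j / 2 * refIntegral (derivative^[k] Q * derivative^[k] e)| ≤
    _ * (width x j ^ k * _ + _ * width x j ^ (k + 1) * _) * √(width x j / 2 * _) at hT3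
  set n := √(width x j / 2 * refIntegral (e * e))
  set S1 := seminormH (k + 1) g (left x j) (right x j) with hS1
  set S2 := seminormH (k + 2) g (left x j) (right x j) with hS2
  have hn : 0 ≤ n := Real.sqrt_nonneg _
  have hS1n : 0 ≤ S1 := seminormH_nonneg _ _ _ _
  have hS2n : 0 ≤ S2 := seminormH_nonneg _ _ _ _
  set I1 := width x j / 2 * ∫ r in (-1 : ℝ)..1,
    (deriv g (fromRef (left x j) (right x j) r) - Q.eval r) * e.eval r with hI1
  set I2 := ∫ r in (-1 : ℝ)..1, (g (fromRef (left x j) (right x j) r) -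
    (meshInterp k s x g j).eval r) * (derivative e).eval r with hI2
  set I3 := width x j / 2 * refIntegral (derivative^[k] Q * derivative^[k] e) with hI3
  have hident : width x j / 2 * modForm k c
      (nodalPoly r (fun i => -a * Q.eval (r i) + fluxDerivative a c r x V j i)) e +
      upwindForm a (fun j => meshInterp k s x g j - nodalPoly r (V j)) j e =
      a * I1 + a * I2 - a * (c / 2) * I3 := by
    rw [hpoly, map_add, LinearMap.add_apply, mul_add, hscheme, hsub, hcons, map_smul,
      LinearMap.smul_apply, smul_eq_mul, modForm_apply, hI1, hsplit, hI3]
    ring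
  rw [hident]
  have hL := lebesgueConst_nonneg k s
  have hζa := (isBrambleHilbertConst_brambleHilbertConst k).1
  have hζb := (isBrambleHilbertConst_brambleHilbertConst (k + 1)).1
  have hCkk := (isInterpConst_interpConst (le_refl k) hs).1
  have h2 : √2 ≤ 2 := by rw [Real.sqrt_le_left] <;> norm_num
  have hp1 : width x j ^ (k + 1) ≤ meshSize x ^ (k + 1) := pow_le_pow_left₀ hwp.le hwm _
  have hp0 : width x j ^ k ≤ meshSize x ^ k := pow_le_pow_left₀ hwp.le hwm _
  have hm0 : 0 ≤ meshSize x := hwp.le.trans hwm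
  have b1 : |I1| ≤ 2 * (1 + lebesgueConst k s) * brambleHilbertConst k * meshSize x ^ (k + 1) *
      S2 * n := hT1.trans (by gcongr)
  have b2 : |I2| ≤ 2 * 2 * (1 + lebesgueConst k s) * brambleHilbertConst (k + 1) *
      √(markovConst k) * meshSize x ^ (k + 1) * S2 * n := hT2.trans (by gcongr)
  have b3 : |I3| ≤ (1 / 2) ^ k * √(∏ m ∈ Finset.Icc 1 k, markovConst m) *
      (meshSize x ^ k * S1 + interpConst k k s * meshSize x ^ (k + 1) * S2) * n :=
    hT3.trans (by gcongr)
  have t1 : a * I1 ≤ |a| * |I1| := (le_abs_self _).trans (abs_mul _ _).le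
  have t2 : a * I2 ≤ |a| * |I2| := (le_abs_self _).trans (abs_mul _ _).le
  have t3 : -(a * (c / 2) * I3) ≤ |a| * (|c| / 2) * |I3| := by
    refine (neg_le_abs _).trans (le_of_eq ?_)
    rw [abs_mul, abs_mul, abs_div, abs_two]
  calc _ ≤ |a| * |I1| + |a| * |I2| + |a| * (|c| / 2) * |I3| := by linarith
    _ ≤ |a| * (2 * (1 + lebesgueConst k s) * brambleHilbertConst k * meshSize x ^ (k + 1) *
          S2 * n) +
        |a| * (2 * 2 * (1 + lebesgueConst k s) * brambleHilbertConst (k + 1) *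
          √(markovConst k) * meshSize x ^ (k + 1) * S2 * n) +
        |a| * (|c| / 2) * ((1 / 2) ^ k * √(∏ m ∈ Finset.Icc 1 k, markovConst m) *
          (meshSize x ^ k * S1 + interpConst k k s * meshSize x ^ (k + 1) * S2) * n) := by
        gcongr
    _ = _ := by rw [rateHigh, rateLow]; ring

/-- Summing over the mesh, the dissipation has a sign and the Cauchy-Schwarz inequality applies. -/
lemma energy_rate_le [NeZero N] {k : ℕ} (hk : 1 ≤ k) {a : ℝ} (ha : a ≠ 0) {c : ℝ}
    (hc : cMinus k < c) {r : Fin (k + 1) → ℝ} (hr : Function.Injective r)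
    {x : Fin (N + 1) → ℝ} (hx : StrictMono x) (V : Fin N → Fin (k + 1) → ℝ) {g : ℝ → ℝ}
    (hg : Function.Periodic g (x (Fin.last N) - x 0))
    (hgs : ∀ α β : ℝ, α < β → MemSobolev (k + 2) g α β) :
    ∑ j, width x j / 2 * modForm k c
        (nodalPoly r (fun i => -a * (meshInterp k (SignType.sign a) x (deriv g) j).eval (r i) +
          fluxDerivative a c r x V j i))
        (meshInterp k (SignType.sign a) x g j - nodalPoly r (V j)) ≤
    (rateHigh k a c * meshSize x ^ (k + 1) *
        √(∑ j, seminormH (k + 2) g (left x j) (right x j) ^ 2) +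
      rateLow k a c * meshSize x ^ k *
        √(∑ j, seminormH (k + 1) g (left x j) (right x j) ^ 2)) *
      polyNorm x (fun j => meshInterp k (SignType.sign a) x g j - nodalPoly r (V j)) := by
  set e : Fin N → ℝ[X] := fun j => meshInterp k (SignType.sign a) x g j - nodalPoly r (V j) with he
  have h0 := sum_upwindForm_self_nonneg a e
  have h1 := Finset.sum_le_sum fun j (_ : j ∈ Finset.univ) =>
    energy_rate_cell_le hk ha hc hr hx V hg hgs j
  rw [Finset.sum_add_distrib] at h1
  have hm0 : 0 ≤ meshSize x := by
    have j : Fin N := 0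
    exact (width_pos hx j).le.trans (width_le_meshSize x j)
  have hn : polyNorm x e = √(∑ j, √(width x j / 2 * refIntegral (e j * e j)) ^ 2) := by
    rw [polyNorm]
    congr 1
    refine Finset.sum_congr rfl fun j _ => (Real.sq_sqrt ?_).symm
    have := (width_pos hx j).le
    have := refIntegral_mul_self_nonneg (e j)
    positivity
  have c2 := Real.sum_mul_le_sqrt_mul_sqrt Finset.univ
    (fun j => seminormH (k + 2) g (left x j) (right x j))
    (fun j => √(width x j / 2 * refIntegral (e j * e j)))
  have c1 := Real.sum_mul_le_sqrt_mul_sqrt Finset.univ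
    (fun j => seminormH (k + 1) g (left x j) (right x j))
    (fun j => √(width x j / 2 * refIntegral (e j * e j)))
  rw [← hn] at c1 c2
  have hr1 := rateHigh_nonneg k ha c
  have hr0 := rateLow_nonneg k a c
  have hsum : ∑ j, (rateHigh k a c * meshSize x ^ (k + 1) *
        seminormH (k + 2) g (left x j) (right x j) +
      rateLow k a c * meshSize x ^ k * seminormH (k + 1) g (left x j) (right x j)) *
      √(width x j / 2 * refIntegral (e j * e j)) =
      rateHigh k a c * meshSize x ^ (k + 1) * ∑ j, seminormH (k + 2) g (left x j) (right x j) *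
        √(width x j / 2 * refIntegral (e j * e j)) +
      rateLow k a c * meshSize x ^ k * ∑ j, seminormH (k + 1) g (left x j) (right x j) *
        √(width x j / 2 * refIntegral (e j * e j)) := by
    rw [Finset.mul_sum, Finset.mul_sum, ← Finset.sum_add_distrib]
    exact Finset.sum_congr rfl fun j _ => by ring
  have d2 := mul_le_mul_of_nonneg_left c2
    (by positivity : 0 ≤ rateHigh k a c * meshSize x ^ (k + 1))
  have d1 := mul_le_mul_of_nonneg_left c1 (by positivity : 0 ≤ rateLow k a c * meshSize x ^ k)
  have h1' := h1.trans hsum.le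
  have h0' : 0 ≤ ∑ j, upwindForm a
    (fun j => meshInterp k (SignType.sign a) x g j - nodalPoly r (V j)) j
    (meshInterp k (SignType.sign a) x g j - nodalPoly r (V j)) := h0
  calc _ ≤ _ := le_of_add_le_of_nonneg_left h1' h0'
    _ ≤ _ := add_le_add d2 d1
    _ = _ := by ring

end Mesh

/-! ### The error estimate -/

section Mesh

variable {N : ℕ}

lemma normL2_add_le {x : Fin (N + 1) → ℝ} (hx : StrictMono x) {f g : Fin N → ℝ → ℝ}
    (hf : ∀ j, MemLp (f j) 2 (volume.restrict (Set.Icc (left x j) (right x j))))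
    (hg : ∀ j, MemLp (g j) 2 (volume.restrict (Set.Icc (left x j) (right x j)))) :
    normL2 x (fun j y => f j y + g j y) ≤ normL2 x f + normL2 x g := by
  have hn : ∀ (h : Fin N → ℝ → ℝ) (j : Fin N), 0 ≤ ∫ y in (left x j)..(right x j), h j y ^ 2 :=
    fun h j => intervalIntegral.integral_nonneg (left_lt_right hx j).le fun _ _ => sq_nonneg _
  set A : Fin N → ℝ := fun j => √(∫ y in (left x j)..(right x j), f j y ^ 2) with hA
  set B : Fin N → ℝ := fun j => √(∫ y in (left x j)..(right x j), g j y ^ 2) with hB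
  have eA : normL2 x f = √(∑ j, A j ^ 2) := by
    rw [normL2]; congr 1
    exact Finset.sum_congr rfl fun j _ => (Real.sq_sqrt (hn f j)).symm
  have eB : normL2 x g = √(∑ j, B j ^ 2) := by
    rw [normL2]; congr 1
    exact Finset.sum_congr rfl fun j _ => (Real.sq_sqrt (hn g j)).symm
  have h1 : ∀ j, ∫ y in (left x j)..(right x j), (f j y + g j y) ^ 2 ≤ (A j + B j) ^ 2 :=
    fun j => (Real.sqrt_le_left (add_nonneg (Real.sqrt_nonneg _) (Real.sqrt_nonneg _))).1
      (sqrt_integral_add_sq_le (left_lt_right hx j).le (hf j) (hg j))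
  have hcs := Real.sum_mul_le_sqrt_mul_sqrt Finset.univ A B
  have hA0 : 0 ≤ ∑ j, A j ^ 2 := Finset.sum_nonneg fun _ _ => sq_nonneg _
  have hB0 : 0 ≤ ∑ j, B j ^ 2 := Finset.sum_nonneg fun _ _ => sq_nonneg _
  rw [eA, eB, normL2, Real.sqrt_le_left (by positivity), add_sq, Real.sq_sqrt hA0,
    Real.sq_sqrt hB0]
  refine (Finset.sum_le_sum fun j _ => h1 j).trans ?_
  simp only [add_sq, Finset.sum_add_distrib]
  have : ∑ j, 2 * A j * B j = 2 * ∑ j, A j * B j := by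
    rw [Finset.mul_sum]; exact Finset.sum_congr rfl fun j _ => by ring
  rw [this]
  linarith

lemma normL2_eval_toRef {x : Fin (N + 1) → ℝ} (hx : StrictMono x) (e : Fin N → ℝ[X]) :
    normL2 x (fun j y => (e j).eval (toRef (left x j) (right x j) y)) = polyNorm x e := by
  rw [normL2, polyNorm]
  congr 1
  exact Finset.sum_congr rfl fun j _ => integral_sq_eval_toRef (left_lt_right hx j) (e j)

lemma brokenNorm_eval_toRef (k : ℕ) (c : ℝ) {x : Fin (N + 1) → ℝ} (hx : StrictMono x)
    (e : Fin N → ℝ[X]) :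
    brokenNorm k c x (fun j y => (e j).eval (toRef (left x j) (right x j) y)) =
      √(∑ j, width x j / 2 * modForm k c (e j) (e j)) := by
  rw [brokenNorm]
  congr 1
  refine Finset.sum_congr rfl fun j _ => ?_
  have hlr := left_lt_right hx j
  have hw : width x j ≠ 0 := (width_pos hx j).ne'
  rw [iteratedDeriv_eval_toRef, integral_eq_refElement]
  simp only [toRef_fromRef hlr]
  change width x j / 2 * _ = _
  congr 1
  rw [modForm_apply, ← refIntegral_C_mul, ← map_add, refIntegral_apply]
  refine intervalIntegral.integral_congr fun r _ => ?_
  simp only [eval_add, eval_mul, eval_C]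
  rw [show right x j - left x j = width x j from rfl, mul_pow, ← pow_mul, mul_comm k 2]
  have : (2 / width x j) ^ (2 * k) * (width x j / 2) ^ (2 * k) = 1 := by
    rw [← mul_pow, div_mul_div_cancel₀ hw, div_self two_ne_zero, one_pow]
  linear_combination (c / 2 * (derivative^[k] (e j)).eval r ^ 2) * this

/-- The interpolation error over the whole mesh. -/
lemma normL2_sub_Rh_le {k : ℕ} {s : SignType} (hs : s ≠ 0) {x : Fin (N + 1) → ℝ}
    (hx : StrictMono x) {g : ℝ → ℝ} (hg : ∀ α β : ℝ, α < β → MemSobolev (k + 1) g α β) :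
    normL2 x (fun j y => g y - Rh k s (left x j) (right x j) g y) ≤
      interpConst k 0 s * meshSize x ^ (k + 1) *
        √(∑ j, seminormH (k + 1) g (left x j) (right x j) ^ 2) := by
  have hI := isInterpConst_interpConst k.zero_le hs
  rcases isEmpty_or_nonempty (Fin N) with hN | ⟨⟨j₀⟩⟩
  · simp [normL2]
  have hm0 : 0 ≤ meshSize x := (width_pos hx j₀).le.trans (width_le_meshSize x j₀)
  have hC0 := hI.1
  have hb : 0 ≤ interpConst k 0 s * meshSize x ^ (k + 1) := by positivity
  rw [normL2, ← Real.sqrt_sq hb, ← Real.sqrt_mul (sq_nonneg _), Finset.mul_sum]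
  refine Real.sqrt_le_sqrt (Finset.sum_le_sum fun j _ => ?_)
  have hlr := left_lt_right hx j
  have h1 := hI.2 _ _ hlr g (hg _ _ hlr)
  have h2 := seminormH_sq hlr.le 0 (fun y => g y - Rh k s (left x j) (right x j) g y)
  simp only [iteratedDerivWithin_zero] at h2
  rw [← h2, ← mul_pow]
  refine pow_le_pow_left₀ (seminormH_nonneg _ _ _ _) (h1.trans ?_) 2
  have hS := seminormH_nonneg (k + 1) g (left x j) (right x j)
  have hw : (right x j - left x j) ^ (k + 1 - 0) ≤ meshSize x ^ (k + 1) :=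
    pow_le_pow_left₀ (width_pos hx j).le (width_le_meshSize x j) _
  gcongr

lemma Rh_sub_cellFun {k : ℕ} {s : SignType} (hs : s ≠ 0) {r : Fin (k + 1) → ℝ}
    (hr : Function.Injective r) {x : Fin (N + 1) → ℝ} (hx : StrictMono x) (g : ℝ → ℝ)
    (V : Fin N → Fin (k + 1) → ℝ) (j : Fin N) (y : ℝ) :
    Rh k s (left x j) (right x j) (fun y => g y - cellFun r x V j y) y =
      (meshInterp k s x g j - nodalPoly r (V j)).eval (toRef (left x j) (right x j) y) := by
  simp only [Rh_eq, cellFun, toRef_fromRef (left_lt_right hx j)]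
  rw [radauInterp_sub, radauInterp_eq_of_eval hs (natDegree_nodalPoly_le hr (V j))
    (fun ρ _ => rfl), meshInterp]

/-- The nodal values of the discrete error are differentiable in time, with the derivative that
enters the energy rate `energy_rate_le`. -/
lemma hasDerivWithinAt_discreteError [NeZero N] {k : ℕ} {a c T : ℝ} {s : SignType}
    {r : Fin (k + 1) → ℝ} {x : Fin (N + 1) → ℝ}
    {U : ℝ → Fin N → Fin (k + 1) → ℝ} (hU : IsESFRSolution a c T r x U) {u₀ : ℝ → ℝ}
    (hu₀ : Differentiable ℝ u₀) {t : ℝ} (ht : t ∈ Set.Icc 0 T) (j : Fin N) (i : Fin (k + 1)) :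
    HasDerivWithinAt
      (fun τ => (meshInterp k s x (fun y => u₀ (y - a * τ)) j).eval (r i) - U τ j i)
      (-a * (meshInterp k s x (deriv fun y => u₀ (y - a * t)) j).eval (r i) +
        fluxDerivative a c r x (U t) j i) (Set.Icc 0 T) t := by
  have h1 := hU t ht j i
  have hd : deriv (fun y => u₀ (y - a * t)) = fun y => deriv u₀ (y - a * t) :=
    funext fun y => deriv_comp_sub_const _ _ y
  have h2 : HasDerivAt (fun τ => (meshInterp k s x (fun y => u₀ (y - a * τ)) j).eval (r i))
      (-a * (meshInterp k s x (deriv fun y => u₀ (y - a * t)) j).eval (r i)) t := by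
    rw [hd]
    simp only [meshInterp, radauInterp_eq_sum, eval_finsetSum, eval_mul, eval_C, Finset.mul_sum]
    refine HasDerivAt.fun_sum fun ρ _ => ?_
    have h3 : HasDerivAt (fun τ => fromRef (left x j) (right x j) ρ - a * τ) (-a) t := by
      simpa using ((hasDerivAt_id t).const_mul a).const_sub (fromRef (left x j) (right x j) ρ)
    have h4 := (((hu₀ _).hasDerivAt (x := fromRef (left x j) (right x j) ρ - a * t)).comp t
      h3).mul_const ((Lagrange.basis (radauNodes k s) id ρ).eval (r i))
    refine h4.congr_deriv ?_
    ring
  refine (h2.hasDerivWithinAt.sub h1).congr_deriv ?_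
  ring

/-- The error estimate, for any constant `μ` with `μ ‖w‖² ≤ ‖w‖²_{k,2}` on `P^k`. -/
theorem normL2_error_le [NeZero N] {k : ℕ} (hk : 1 ≤ k) {a : ℝ} (ha : a ≠ 0) {c : ℝ}
    (hc : cMinus k < c) {x : Fin (N + 1) → ℝ} (hx : StrictMono x) {T : ℝ} (hT : 0 ≤ T)
    {u₀ : ℝ → ℝ} (hper : Function.Periodic u₀ (x (Fin.last N) - x 0))
    (hu₀ : ∀ α β : ℝ, α < β → MemSobolev (k + 2) u₀ α β) {u : ℝ → ℝ → ℝ}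
    (hu : IsAdvectionSolution a (x (Fin.last N) - x 0) T u₀ u) {r : Fin (k + 1) → ℝ}
    (hr : Function.Injective r) {U : ℝ → Fin N → Fin (k + 1) → ℝ}
    (hU : IsESFRSolution a c T r x U) {μ : ℝ} (hμ : 0 < μ)
    (hμk : ∀ w : ℝ[X], w.natDegree ≤ k → μ * refIntegral (w * w) ≤ modForm k c w w) :
    normL2 x (fun j y => u y T - cellFun r x (U T) j y) ≤
      brokenNorm k c x (fun j => Rh k (SignType.sign a) (left x j) (right x j)
        (fun y => u y 0 - cellFun r x (U 0) j y)) / √μ +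
      (rateHigh k a c * T / μ * seminormH (k + 2) u₀ (x 0) (x (Fin.last N)) +
        interpConst k 0 (SignType.sign a) * seminormH (k + 1) u₀ (x 0) (x (Fin.last N))) *
          meshSize x ^ (k + 1) +
      rateLow k a c * T / μ * seminormH (k + 1) u₀ (x 0) (x (Fin.last N)) * meshSize x ^ k := by
  have hs := sign_ne_zero.2 ha
  set s := SignType.sign a
  set H1 := seminormH (k + 1) u₀ (x 0) (x (Fin.last N))
  set H2 := seminormH (k + 2) u₀ (x 0) (x (Fin.last N))
  have hH1 : 0 ≤ H1 := seminormH_nonneg _ _ _ _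
  have hH2 : 0 ≤ H2 := seminormH_nonneg _ _ _ _
  have hm0 : 0 ≤ meshSize x := (width_pos hx 0).le.trans (width_le_meshSize x 0)
  have hr1 := rateHigh_nonneg k ha c
  have hr0 := rateLow_nonneg k a c
  have hu₀' : ∀ α β : ℝ, α < β → MemSobolev (k + 1) u₀ α β := fun α β h => memSobolev_of_succ hu₀ h
  -- The exact solution at time `t`, with its regularity and its seminorms.
  set g : ℝ → ℝ → ℝ := fun t y => u₀ (y - a * t) with hgdef
  have hgs : ∀ t, ∀ α β : ℝ, α < β → MemSobolev (k + 2) (g t) α β := fun t α β h =>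
    memSobolev_comp_sub hu₀ (a * t) h
  have hgs' : ∀ t, ∀ α β : ℝ, α < β → MemSobolev (k + 1) (g t) α β := fun t α β h =>
    memSobolev_comp_sub hu₀' (a * t) h
  have hgp : ∀ t, Function.Periodic (g t) (x (Fin.last N) - x 0) := fun t y => by
    have := hper (y - a * t)
    rw [sub_add_eq_add_sub] at this
    exact this
  have hS1 : ∀ t, √(∑ j, seminormH (k + 1) (g t) (left x j) (right x j) ^ 2) = H1 := fun t => by
    rw [sum_sq_seminormH_comp_sub hx _ hper
      (fun α β h => memLp_iteratedDeriv_of_memSobolev hu₀' h), Real.sqrt_sq hH1]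
  have hS2 : ∀ t, √(∑ j, seminormH (k + 2) (g t) (left x j) (right x j) ^ 2) = H2 := fun t => by
    rw [sum_sq_seminormH_comp_sub hx _ hper
      (fun α β h => memLp_iteratedDeriv_of_memSobolev hu₀ h), Real.sqrt_sq hH2]
  have hdiff : Differentiable ℝ u₀ := (contDiff_of_memSobolev hu₀).differentiable (by simp)
  have hgu : ∀ t ∈ Set.Icc 0 T, ∀ y, u y t = g t y := fun t ht y => hu.eq_initial ht y
  -- The discrete error and its energy.
  set e : ℝ → Fin N → ℝ[X] := fun t j => meshInterp k s x (g t) j - nodalPoly r (U t j) with he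
  have hedeg : ∀ t j, (e t j).natDegree ≤ k := fun t j =>
    (natDegree_sub_le_iff_left (natDegree_nodalPoly_le hr _)).2 (natDegree_radauInterp_le k hs _)
  set En : ℝ → ℝ := fun t => ∑ j, width x j / 2 * modForm k c (e t j) (e t j) with hEn
  have hpoly : ∀ t, μ * polyNorm x (e t) ^ 2 ≤ En t := by
    intro t
    have hnn : 0 ≤ ∑ j, width x j / 2 * refIntegral (e t j * e t j) :=
      Finset.sum_nonneg fun j _ => mul_nonneg (by linarith [width_pos hx j])
        (refIntegral_mul_self_nonneg _)
    rw [polyNorm, Real.sq_sqrt hnn, Finset.mul_sum]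
    refine Finset.sum_le_sum fun j _ => ?_
    rw [mul_left_comm]
    exact mul_le_mul_of_nonneg_left (hμk _ (hedeg t j)) (by linarith [width_pos hx j])
  have hEn0 : ∀ t, 0 ≤ En t := fun t => le_trans (by positivity) (hpoly t)
  have hpolyN : ∀ t, polyNorm x (e t) ≤ √(En t) / √μ := fun t => by
    rw [← Real.sqrt_div (hEn0 t)]
    refine Real.le_sqrt_of_sq_le ?_
    rw [le_div_iff₀ hμ, mul_comm]
    exact hpoly t
  set K := rateHigh k a c * meshSize x ^ (k + 1) * H2 + rateLow k a c * meshSize x ^ k * H1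
    with hK
  have hK0 : 0 ≤ K := by positivity
  have hgrowth : √(En T) ≤ √(En 0) + K / √μ * T := by
    refine sqrt_le_of_deriv_le (E' := fun t => ∑ j, width x j / 2 * (2 * modForm k c
      (nodalPoly r (fun i => -a * (meshInterp k s x (deriv (g t)) j).eval (r i) +
          fluxDerivative a c r x (U t) j i)) (e t j))) hT (by positivity) ?_ hEn0 ?_
    · intro t ht
      refine HasDerivWithinAt.fun_sum fun j _ => HasDerivWithinAt.const_mul _ ?_
      have hnodal : ∀ τ, nodalPoly r (fun i => (meshInterp k s x (g τ) j).eval (r i) - U τ j i) =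
          e τ j := fun τ => nodalPoly_eq_of_eval hr (hedeg τ j) fun i => by
        rw [he]; simp only [eval_sub, eval_nodalPoly hr]
      have := hasDerivWithinAt_modForm_nodalPoly c r
        (V := fun τ i => (meshInterp k s x (g τ) j).eval (r i) - U τ j i)
        (V' := fun i => -a * (meshInterp k s x (deriv (g t)) j).eval (r i) +
          fluxDerivative a c r x (U t) j i)
        (fun i => hasDerivWithinAt_discreteError (s := s) hU hdiff ht j i)
      simpa only [hnodal] using this
    · intro t _
      have h1 := energy_rate_le hk ha hc hr hx (U t) (hgp t) (hgs t)
      rw [hS1, hS2] at h1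
      have h2 := mul_le_mul_of_nonneg_left (hpolyN t) hK0
      have h3 : ∑ j, width x j / 2 * (2 * modForm k c
          (nodalPoly r (fun i => -a * (meshInterp k s x (deriv (g t)) j).eval (r i) +
            fluxDerivative a c r x (U t) j i)) (e t j)) =
          2 * ∑ j, width x j / 2 * modForm k c
          (nodalPoly r (fun i => -a * (meshInterp k s x (deriv (g t)) j).eval (r i) +
            fluxDerivative a c r x (U t) j i)) (e t j) := by
        rw [Finset.mul_sum]
        exact Finset.sum_congr rfl fun j _ => by ring
      rw [h3]
      calc _ ≤ 2 * (K * polyNorm x (e t)) := mul_le_mul_of_nonneg_left h1 zero_le_two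
        _ ≤ 2 * (K * (√(En t) / √μ)) := by linarith
        _ = _ := by ring
  have hinit : brokenNorm k c x (fun j => Rh k s (left x j) (right x j)
      (fun y => u y 0 - cellFun r x (U 0) j y)) = √(En 0) := by
    rw [hEn, ← brokenNorm_eval_toRef k c hx]
    congr 1
    ext j y
    rw [he, ← Rh_sub_cellFun hs hr hx]
    simp only [hgu 0 (Set.left_mem_Icc.2 hT)]
  have herr : (fun (j : Fin N) y => u y T - cellFun r x (U T) j y) =
      fun j y => (g T y - Rh k s (left x j) (right x j) (g T) y) +
        (e T j).eval (toRef (left x j) (right x j) y) := by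
    ext j y
    rw [hgu T (Set.right_mem_Icc.2 hT), he, eval_sub, Rh_eq, meshInterp, cellFun]
    ring
  have hgT : Continuous (g T) := (contDiff_of_memSobolev (hgs T)).continuous
  have hRc : ∀ j, Continuous (Rh k s (left x j) (right x j) (g T)) := fun j =>
    (contDiff_eval_toRef _ _ _ 0).continuous
  have htri := normL2_add_le hx
    (f := fun j y => g T y - Rh k s (left x j) (right x j) (g T) y)
    (g := fun j y => (e T j).eval (toRef (left x j) (right x j) y))
    (fun j => memLp_of_continuousOn (hgT.sub (hRc j)).continuousOn)
    (fun j => memLp_of_continuousOn (contDiff_eval_toRef _ _ _ 0).continuous.continuousOn)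
  have hproj := normL2_sub_Rh_le hs hx (hgs' T)
  rw [hS1] at hproj
  rw [normL2_eval_toRef hx] at htri
  rw [herr, hinit]
  have hfin : polyNorm x (e T) ≤ √(En 0) / √μ + K * T / μ := by
    refine (hpolyN T).trans ?_
    rw [div_le_iff₀ (Real.sqrt_pos.2 hμ)]
    refine hgrowth.trans (le_of_eq ?_)
    have h1 : √μ ≠ 0 := (Real.sqrt_pos.2 hμ).ne'
    have h2 : √μ ^ 2 = μ := Real.sq_sqrt hμ.le
    field_simp
    linear_combination (-(K * T)) * h2
  calc _ ≤ _ := htri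
    _ ≤ interpConst k 0 s * meshSize x ^ (k + 1) * H1 + (√(En 0) / √μ + K * T / μ) :=
      add_le_add hproj hfin
    _ = _ := by rw [hK]; ring

end Mesh

end ESFR

theorem theorem3p1 (k : ℕ) (hk : 1 ≤ k) (a : ℝ) (ha : a ≠ 0) (c : ℝ) (hc : ESFR.cMinus k < c)
    (N : ℕ) [NeZero N] (x : Fin (N + 1) → ℝ) (hx : StrictMono x)
    (T : ℝ) (hT : 0 < T)
    (u₀ : ℝ → ℝ) (hper : Function.Periodic u₀ (x (Fin.last N) - x 0))
    (hu₀ : ∀ α β : ℝ, α < β → ESFR.MemSobolev (k + 2) u₀ α β)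
    (u : ℝ → ℝ → ℝ) (hu : ESFR.IsAdvectionSolution a (x (Fin.last N) - x 0) T u₀ u)
    (r : Fin (k + 1) → ℝ) (hr : Function.Injective r)
    (U : ℝ → Fin N → Fin (k + 1) → ℝ) (hU : ESFR.IsESFRSolution a c T r x U) :
    let s : SignType := SignType.sign a
    let ζa : ℝ := ESFR.brambleHilbertConst k
    let ζb : ℝ := ESFR.brambleHilbertConst (k + 1)
    let Λ : ℝ := ESFR.lebesgueConst k s
    let C : ℕ → ℝ := ESFR.markovConst
    let Ck0 : ℝ := ESFR.interpConst k 0 s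
    let Ckk : ℝ := ESFR.interpConst k k s
    let Δx : ℝ := ESFR.meshSize x
    let H1 : ℝ := ESFR.seminormH (k + 1) u₀ (x 0) (x (Fin.last N))
    let H2 : ℝ := ESFR.seminormH (k + 2) u₀ (x 0) (x (Fin.last N))
    let P : ℝ := √(∏ m ∈ Finset.Icc 1 k, C m)
    let κ : ℝ := 1 + ESFR.eta k c
    let error : ℝ := ESFR.normL2 x (fun j y => u y T - ESFR.cellFun r x (U T) j y)
    let initialError : ℝ := ESFR.brokenNorm k c x (fun j =>
      ESFR.Rh k s (ESFR.left x j) (ESFR.right x j) (fun y => u y 0 - ESFR.cellFun r x (U 0) j y))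
    -- the best constants are finite and admissible
    ESFR.IsBrambleHilbertConst k ζa ∧ ESFR.IsBrambleHilbertConst (k + 1) ζb ∧
    (∀ m ∈ Finset.Icc 1 k, ESFR.IsMarkovConst m (C m)) ∧
    ESFR.IsInterpConst k 0 s Ck0 ∧ ESFR.IsInterpConst k k s Ckk ∧
    -- the error estimate
    (0 ≤ c →
      error ≤ initialError
        + (|a| * T * (2 * ζa + 4 * ζb * √(C k)) * (1 + Λ) * H2
            + Ck0 * H1
            + |c| * Ckk * (1 / 2) ^ k * P * H2 * |a| * (T / 2)) * Δx ^ (k + 1)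
        + (|c| * (1 / 2) ^ k * P * H1 * |a| * (T / 2)) * Δx ^ k) ∧
    (c < 0 →
      error ≤ initialError / √κ
        + (|a| * T * (2 * ζa + 4 * ζb * √(C k)) * (1 + Λ) * H2 / κ
            + Ck0 * H1
            + |c| * Ckk * (1 / 2) ^ k * P * H2 * |a| * (T / 2) / κ) * Δx ^ (k + 1)
        + (|c| * (1 / 2) ^ k * P * H1 * |a| * (T / 2) / κ) * Δx ^ k) := by
  intro s ζa ζb Λ C Ck0 Ckk Δx H1 H2 P κ error initialError
  have hs : s ≠ 0 := sign_ne_zero.2 ha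
  have hκ : 0 < κ := ESFR.one_add_eta_pos hc
  refine ⟨ESFR.isBrambleHilbertConst_brambleHilbertConst k,
    ESFR.isBrambleHilbertConst_brambleHilbertConst (k + 1),
    fun m _ => ESFR.isMarkovConst_markovConst m,
    ESFR.isInterpConst_interpConst k.zero_le hs, ESFR.isInterpConst_interpConst le_rfl hs,
    fun hc0 => ?_, fun hc0 => ?_⟩
  · have h := ESFR.normL2_error_le hk ha hc hx hT.le hper hu₀ hu hr hU one_pos
      (fun w _ => by rw [one_mul]; exact ESFR.refIntegral_le_modForm hc0 w)
    refine h.trans (le_of_eq ?_)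
    rw [Real.sqrt_one, div_one, div_one, div_one, ESFR.rateHigh, ESFR.rateLow]
    ring
  · have h := ESFR.normL2_error_le hk ha hc hx hT.le hper hu₀ hu hr hU hκ
      (fun w hw => ESFR.one_add_eta_mul_le_modForm hc0.le hw)
    refine h.trans (le_of_eq ?_)
    rw [ESFR.rateHigh, ESFR.rateLow]
    ring
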